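/- **Setting.** Algebras are unital and associative over $\mathbb C$, and $\otimes=\otimes_{\mathbb C}$. Let $H$ be a commutative Hopf algebra and $A$ a right $H$-comodule algebra with coaction $\delta(a)=a_{(0)}\otimes a_{(1)}$ and coinvariants $B=\{b\in A:\delta(b)=b\otimes 1\}$. Assume that $B\subseteq A$ is a Hopf--Galois extension, i.e. $\chi:A\otimes_BA\to A\otimes H$, $a'\otimes_B a\mapsto a'a_{(0)}\otimes a_{(1)}$, is bijective, and that $A$ is faithfully flat as a right $B$-module. Write $\tau(h)=\chi^{-1}(1\otimes h)$. Let $\theta$ be a real skew-symmetric $n\times n$ matrix and $\lambda_\theta(r,l)=e^{\pi i\langle\theta r,l\rangle}$ for $r,l\in\mathbb Z^n$. *Scenario I.* $A=\bigoplus_{r\in\mathbb Z^n}A_r$ is a graded algebra with $\delta(A_r)\subseteq A_r\otimes H$. Put $H_\Theta=H$ and let $A_\Theta$ be the vector space $A$ with product $a_r\cdot a'_l=\lambda_\theta(r,l)\,a_ra'_l$ on homogeneous elements. *Scenario II.* $H$ and $A$ are algebras graded by $\mathbb Z^n\times\mathbb Z^n$, with $\Delta(H_{(r,l)})\subseteq\bigoplus_sH_{(r,s)}\otimes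 H_{(s,l)}$, $\varepsilon(H_{(r,l)})=0$ for $r\ne l$, $S(H_{(r,l)})\subseteq H_{(-l,-r)}$, and $\delta(A_{(r,l)})\subseteq\bigoplus_sA_{(r,s)}\otimes H_{(s,l)}$. Let $H_\Theta$ and $A_\Theta$ be the same vector spaces with the product $x\cdot y=\lambda_\theta(r_1,l_1)\lambda_{-\theta}(r_2,l_2)\,xy$ for $x$, $y$ homogeneous of degrees $(r_1,r_2)$, $(l_1,l_2)$. With the coproduct, counit and antipode of $H$, $H_\Theta$ is a Hopf algebra, and $A_\Theta$ is an $H_\Theta$-comodule algebra with coaction $\delta$. For a Hopf--Galois extension $(H,A)$ let $\mathcal C(H,A)=(A\otimes A)^{coH}=\{x\in A\otimes A:\delta^{A\otimes A}(x)=x\otimes1\}$, where $\delta^{A\otimes A}(a\otimes\tilde a)=a_{(0)}\otimes\tilde a_{(0)}\otimes a_{(1)}\tilde a_{(1)}$, with product $(x\otimes\tilde x)(y\otimes\tilde y)=xy\otimes\tilde y\tilde x$, source $s(b)=b\otimes 1$, target $t(b)=1\otimes b$, counit $\varepsilon(a\otimes\tilde a)=a\tilde a$, $B$-bimodule structure $b\triangleright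 x\triangleleft b'=s(b)t(b')x$, and coproduct $\Delta(a\otimes\tilde a)=a_{(0)}\otimes\tau(a_{(1)})\otimes\tilde a$, an element of $\mathcal C\otimes_B\mathcal C\subseteq A\otimes(A\otimes_BA)\otimes A$ (the inclusion, $(x\otimes x')\otimes_B(y\otimes y')\mapsto x\otimes(x'\otimes_By)\otimes y'$, and the fact that $\Delta$ takes values in $\mathcal C\otimes_B\mathcal C$ are part of the claim below). **Theorem.** In Scenario I and in Scenario II the following holds. 1. $(H_\Theta,A_\Theta)$ is a Hopf--Galois extension. Its algebra of coinvariants $B_\Theta$ equals $B$ as a vector space, and $\mathcal C(H_\Theta,A_\Theta)=\mathcal C(H,A)$ as subspaces of $A\otimes A$. 2. $\mathcal C(H,A)$ is a left bialgebroid over $B$ and $\mathcal C(H_\Theta,A_\Theta)$, formed with the products of $A_\Theta$ and $H_\Theta$, is a left bialgebroid over $B_\Theta$. Only the structures that involve the product are deformed: for every $x$, the coproducts of $x$ in $\mathcal C\otimes_B\mathcal C$ and in $\mathcal C\otimes_{B_\Theta}\mathcal C$ have a common representative in $\mathcal C\otimes\mathcal C$. 3. In both cases the flip $S(a\otimes\tilde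 a)=\tilde a\otimes a$ maps $\mathcal C$ to itself, and it is an invertible antipode in the sense of Böhm and Szlachányi, with $S^{-1}=S$: it is a unital algebra anti-automorphism, $S\circ t=s$, and for all $h$, with $\Delta(h)=h_{(1)}\otimes_Bh_{(2)}$ (and $B_\Theta$ in place of $B$ in the deformed case), $$(S^{-1}h_{(2)})_{(1)}\otimes_B(S^{-1}h_{(2)})_{(2)}h_{(1)}=S^{-1}h\otimes_B1,\qquad (Sh_{(1)})_{(1)}h_{(2)}\otimes_B(Sh_{(1)})_{(2)}=1\otimes_BSh .$$ Thus $\mathcal C(H,A)$ is a Hopf algebroid over $B$, and $\mathcal C(H_\Theta,A_\Theta)$ is a Hopf algebroid over $B_\Theta$. -/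

import Mathlib

open scoped TensorProduct

universe u

noncomputable section

namespace HopfAlgebroids

/-! ## Tensor products balanced over a possibly noncommutative algebra -/

section Balanced

variable {B M N M' N' : Type*} [AddCommGroup M] [Module ℂ M] [AddCommGroup N] [Module ℂ N]
  [AddCommGroup M'] [Module ℂ M'] [AddCommGroup N'] [Module ℂ N']

/-- The relations `m ◁ b ⊗ n = m ⊗ b ▷ n`, for a right action `ρ b m = m ◁ b` on `M` and a left
action `σ b n = b ▷ n` on `N`. -/
def balancedRel (ρ : B → M → M) (σ : B → N → N) : Submodule ℂ (M ⊗[ℂ] N) :=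
  Submodule.span ℂ {z | ∃ b m n, z = ρ b m ⊗ₜ[ℂ] n - m ⊗ₜ[ℂ] σ b n}

/-- The balanced tensor product `M ⊗_B N`, for a right action `ρ b m = m ◁ b` on `M` and a left
action `σ b n = b ▷ n` on `N`. -/
abbrev Balanced (ρ : B → M → M) (σ : B → N → N) : Type _ := (M ⊗[ℂ] N) ⧸ balancedRel ρ σ

/-- The canonical projection `M ⊗ N → M ⊗_B N`. -/
abbrev Balanced.mk (ρ : B → M → M) (σ : B → N → N) : M ⊗[ℂ] N →ₗ[ℂ] Balanced ρ σ :=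
  (balancedRel ρ σ).mkQ

theorem balancedRel_le {P : Type*} [AddCommGroup P] [Module ℂ P] {ρ : B → M → M} {σ : B → N → N}
    (f : M ⊗[ℂ] N →ₗ[ℂ] P) (h : ∀ b m n, f (ρ b m ⊗ₜ n) = f (m ⊗ₜ σ b n)) :
    balancedRel ρ σ ≤ LinearMap.ker f := by
  rw [balancedRel, Submodule.span_le]
  rintro _ ⟨b, m, n, rfl⟩
  simp [h b m n]

/-- The map `f ⊗_B g : M ⊗_B N → M' ⊗_{B'} N'` induced by maps that intertwine the actions along
a map of index sets `φ : B → B'`. -/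
def Balanced.map {B' : Type*} {ρ : B → M → M} {σ : B → N → N}
    {ρ' : B' → M' → M'} {σ' : B' → N' → N'} (φ : B → B') (f : M →ₗ[ℂ] M') (g : N →ₗ[ℂ] N')
    (hf : ∀ b m, f (ρ b m) = ρ' (φ b) (f m)) (hg : ∀ b n, g (σ b n) = σ' (φ b) (g n)) :
    Balanced ρ σ →ₗ[ℂ] Balanced ρ' σ' :=
  (balancedRel ρ σ).liftQ (Balanced.mk ρ' σ' ∘ₗ TensorProduct.map f g) <| by
    refine balancedRel_le _ fun b m n => ?_
    simp only [LinearMap.comp_apply, TensorProduct.map_tmul, hf, hg]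
    rw [← sub_eq_zero, ← map_sub]
    exact (Submodule.Quotient.mk_eq_zero _).2 (Submodule.subset_span ⟨φ b, f m, g n, rfl⟩)

end Balanced

/-! ## Left bialgebroids and Hopf algebroids -/

section Bialgebroid

variable {B L : Type*} [Ring B] [Algebra ℂ B] [Ring L] [Algebra ℂ L]

/-- `L ⊗_B L` for the `B`-bimodule structure `b ▷ x ◁ b' = s b * t b' * x` on `L`. -/
abbrev BTensor (s : B →ₐ[ℂ] L) (t : Bᵐᵒᵖ →ₐ[ℂ] L) : Type _ :=
  Balanced (fun b x => t (.op b) * x : B → L → L) (fun b y => s b * y : B → L → L)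

/-- The projection `L ⊗ L → L ⊗_B L`. -/
abbrev BTensor.mk (s : B →ₐ[ℂ] L) (t : Bᵐᵒᵖ →ₐ[ℂ] L) : L ⊗[ℂ] L →ₗ[ℂ] BTensor s t :=
  Balanced.mk _ _

/-- Linear maps out of `L ⊗_B L` are balanced linear maps out of `L ⊗ L`. -/
def BTensor.lift (s : B →ₐ[ℂ] L) (t : Bᵐᵒᵖ →ₐ[ℂ] L) {P : Type*} [AddCommGroup P] [Module ℂ P]
    (f : L ⊗[ℂ] L →ₗ[ℂ] P) (h : ∀ b x y, f ((t (.op b) * x) ⊗ₜ y) = f (x ⊗ₜ (s b * y))) :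
    BTensor s t →ₗ[ℂ] P :=
  Submodule.liftQ _ f (balancedRel_le f h)

/-- The relations that define `L ⊗_B L ⊗_B L` as a quotient of `L ⊗ (L ⊗ L)`. -/
def balancedRel₃ (s : B →ₐ[ℂ] L) (t : Bᵐᵒᵖ →ₐ[ℂ] L) : Submodule ℂ (L ⊗[ℂ] (L ⊗[ℂ] L)) :=
  Submodule.span ℂ
    ({z | ∃ (b : B) (x y w : L), z = (t (.op b) * x) ⊗ₜ (y ⊗ₜ w) - x ⊗ₜ ((s b * y) ⊗ₜ w)} ∪
     {z | ∃ (b : B) (x y w : L), z = x ⊗ₜ ((t (.op b) * y) ⊗ₜ w) - x ⊗ₜ (y ⊗ₜ (s b * w))})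

/-- `L ⊗_B L ⊗_B L`. -/
abbrev BTensor₃ (s : B →ₐ[ℂ] L) (t : Bᵐᵒᵖ →ₐ[ℂ] L) : Type _ :=
  (L ⊗[ℂ] (L ⊗[ℂ] L)) ⧸ balancedRel₃ s t

/-- The linear map `(L ⊗_B L) ⊗ L → L ⊗_B L ⊗_B L`, `(x ⊗_B y) ⊗ w ↦ x ⊗_B y ⊗_B w`. -/
def joinRight (s : B →ₐ[ℂ] L) (t : Bᵐᵒᵖ →ₐ[ℂ] L) : BTensor s t ⊗[ℂ] L →ₗ[ℂ] BTensor₃ s t :=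
  TensorProduct.lift <| (Submodule.liftQ _ (TensorProduct.curry
    ((balancedRel₃ s t).mkQ ∘ₗ (TensorProduct.assoc ℂ L L L).toLinearMap))) <| by
    refine balancedRel_le _ fun b x y => ?_
    ext w
    simp only [TensorProduct.curry_apply, LinearMap.comp_apply, LinearEquiv.coe_coe,
      TensorProduct.assoc_tmul]
    rw [← sub_eq_zero, ← map_sub]
    exact (Submodule.Quotient.mk_eq_zero _).2
      (Submodule.subset_span (Or.inl ⟨b, x, y, w, rfl⟩))

/-- The linear map `L ⊗ (L ⊗_B L) → L ⊗_B L ⊗_B L`, `x ⊗ (y ⊗_B w) ↦ x ⊗_B y ⊗_B w`. -/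
def joinLeft (s : B →ₐ[ℂ] L) (t : Bᵐᵒᵖ →ₐ[ℂ] L) : L ⊗[ℂ] BTensor s t →ₗ[ℂ] BTensor₃ s t :=
  TensorProduct.lift <| LinearMap.flip <| (Submodule.liftQ _ (LinearMap.flip (TensorProduct.curry
    ((balancedRel₃ s t).mkQ)))) <| by
    refine balancedRel_le _ fun b y w => ?_
    ext x
    simp only [TensorProduct.curry_apply, LinearMap.flip_apply]
    rw [← sub_eq_zero, ← map_sub]
    exact (Submodule.Quotient.mk_eq_zero _).2
      (Submodule.subset_span (Or.inr ⟨b, x, y, w, rfl⟩))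

/-- Right multiplication on the first tensor factor: `c ↦ (x ⊗_B y ↦ x * c ⊗_B y)`. -/
def mulFst (s : B →ₐ[ℂ] L) (t : Bᵐᵒᵖ →ₐ[ℂ] L) : L →ₗ[ℂ] BTensor s t →ₗ[ℂ] BTensor s t where
  toFun c := Balanced.map id (LinearMap.mulRight ℂ c) LinearMap.id
    (fun b x => by simp [mul_assoc]) (fun b x => rfl)
  map_add' c d := by
    apply Submodule.linearMap_qext
    ext x y
    simp [Balanced.map, mul_add, TensorProduct.add_tmul]
  map_smul' r c := by
    apply Submodule.linearMap_qext
    ext x y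
    simp [Balanced.map, ← Submodule.Quotient.mk_smul, TensorProduct.smul_tmul']

/-- Right multiplication on the second tensor factor: `c ↦ (x ⊗_B y ↦ x ⊗_B y * c)`. -/
def mulSnd (s : B →ₐ[ℂ] L) (t : Bᵐᵒᵖ →ₐ[ℂ] L) : L →ₗ[ℂ] BTensor s t →ₗ[ℂ] BTensor s t where
  toFun c := Balanced.map id LinearMap.id (LinearMap.mulRight ℂ c)
    (fun b x => rfl) (fun b x => by simp [mul_assoc])
  map_add' c d := by
    apply Submodule.linearMap_qext
    ext x y
    simp [Balanced.map, mul_add, TensorProduct.tmul_add]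
  map_smul' r c := by
    apply Submodule.linearMap_qext
    ext x y
    simp [Balanced.map, TensorProduct.tmul_smul]

/-- `(L, s, t, Δ, ε)` is a left `B`-bialgebroid. The base algebra acts by
`b ▷ x ◁ b' = s b * t b' * x`. A formula in Sweedler notation `Δ x = x₁ ⊗_B x₂` is stated for every
representative `z` in `L ⊗ L` of `Δ x`. -/
structure IsLeftBialgebroid (s : B →ₐ[ℂ] L) (t : Bᵐᵒᵖ →ₐ[ℂ] L) (Δ : L →ₗ[ℂ] BTensor s t)
    (ε : L →ₗ[ℂ] B) : Prop where
  /-- source and target have commuting ranges -/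
  commute : ∀ b b', Commute (s b) (t b')
  /-- `Δ` is left `B`-linear -/
  comul_source : ∀ b x z, BTensor.mk s t z = Δ x →
    Δ (s b * x) = BTensor.mk s t ((s b ⊗ₜ[ℂ] (1 : L)) * z)
  /-- `Δ` is right `B`-linear -/
  comul_target : ∀ b x z, BTensor.mk s t z = Δ x →
    Δ (t b * x) = BTensor.mk s t (((1 : L) ⊗ₜ[ℂ] t b) * z)
  /-- coassociativity in `L ⊗_B L ⊗_B L` -/
  coassoc : ∀ x z, BTensor.mk s t z = Δ x →
    joinRight s t (TensorProduct.map Δ LinearMap.id z) =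
      joinLeft s t (TensorProduct.map LinearMap.id Δ z)
  /-- `ε` is left `B`-linear -/
  counit_source : ∀ b x, ε (s b * x) = b * ε x
  /-- `ε` is right `B`-linear -/
  counit_target : ∀ b x, ε (t (.op b) * x) = ε x * b
  /-- `s (ε x₁) * x₂ = x` -/
  counit_left : ∀ x z, BTensor.mk s t z = Δ x →
    LinearMap.mul' ℂ L (TensorProduct.map (s.toLinearMap ∘ₗ ε) LinearMap.id z) = x
  /-- `t (ε x₂) * x₁ = x` -/
  counit_right : ∀ x z, BTensor.mk s t z = Δ x →
    LinearMap.mul' ℂ L (TensorProduct.comm ℂ L L (TensorProduct.map LinearMap.id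
      (t.toLinearMap ∘ₗ (MulOpposite.opLinearEquiv ℂ).toLinearMap ∘ₗ ε) z)) = x
  /-- `Δ` takes its values in the Takeuchi product: `x₁ * t b ⊗_B x₂ = x₁ ⊗_B x₂ * s b` -/
  takeuchi : ∀ x b, mulFst s t (t (.op b)) (Δ x) = mulSnd s t (s b) (Δ x)
  /-- `Δ` is unital -/
  comul_one : Δ 1 = BTensor.mk s t (1 ⊗ₜ[ℂ] 1)
  /-- `Δ` is multiplicative -/
  comul_mul : ∀ x y z w, BTensor.mk s t z = Δ x → BTensor.mk s t w = Δ y →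
    Δ (x * y) = BTensor.mk s t (z * w)
  counit_one : ε 1 = 1
  counit_mul_source : ∀ x y, ε (x * s (ε y)) = ε (x * y)
  counit_mul_target : ∀ x y, ε (x * t (.op (ε y))) = ε (x * y)

/-- `S` is an invertible antipode of the left bialgebroid `(L, s, t, Δ, ε)` in the sense of Böhm
and Szlachányi. The two compatibility conditions with the coproduct are
`(S⁻¹ h₂)₁ ⊗_B (S⁻¹ h₂)₂ * h₁ = S⁻¹ h ⊗_B 1` and `(S h₁)₁ * h₂ ⊗_B (S h₁)₂ = 1 ⊗_B S h`, stated for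
every representative `z` in `L ⊗ L` of `Δ h`. -/
structure IsInvertibleAntipode (s : B →ₐ[ℂ] L) (t : Bᵐᵒᵖ →ₐ[ℂ] L) (Δ : L →ₗ[ℂ] BTensor s t)
    (S : L ≃ₗ[ℂ] L) : Prop where
  map_one : S 1 = 1
  map_mul : ∀ x y, S (x * y) = S y * S x
  target : ∀ b, S (t (.op b)) = s b
  comul_symm : ∀ h z, BTensor.mk s t z = Δ h →
    TensorProduct.lift ((mulSnd s t).compl₂ (Δ ∘ₗ S.symm.toLinearMap)) z =
      BTensor.mk s t (S.symm h ⊗ₜ 1)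
  comul : ∀ h z, BTensor.mk s t z = Δ h →
    TensorProduct.lift ((mulFst s t).flip ∘ₗ Δ ∘ₗ S.toLinearMap) z =
      BTensor.mk s t (1 ⊗ₜ S h)

end Bialgebroid
/-! ## Comodule algebras, Hopf--Galois extensions and the Ehresmann--Schauenburg bialgebroid -/

/-- The algebra `A ⊗ Aᵒᵖ`. -/
def Env (A : Type*) [Ring A] [Algebra ℂ A] : Type _ := A ⊗[ℂ] Aᵐᵒᵖ

namespace Env

variable {A : Type*} [Ring A] [Algebra ℂ A]

instance : Ring (Env A) := inferInstanceAs (Ring (A ⊗[ℂ] Aᵐᵒᵖ))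

instance : Algebra ℂ (Env A) := inferInstanceAs (Algebra ℂ (A ⊗[ℂ] Aᵐᵒᵖ))

/-- The underlying vector space of `A ⊗ Aᵒᵖ` is `A ⊗ A`. -/
def equiv : Env A ≃ₗ[ℂ] A ⊗[ℂ] A :=
  TensorProduct.congr (LinearEquiv.refl ℂ A) (MulOpposite.opLinearEquiv ℂ).symm

/-- `a ↦ a ⊗ 1` -/
def inl : A →ₐ[ℂ] Env A := (Algebra.TensorProduct.includeLeft : A →ₐ[ℂ] A ⊗[ℂ] Aᵐᵒᵖ)

/-- `a ↦ 1 ⊗ a` -/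
def inr : Aᵐᵒᵖ →ₐ[ℂ] Env A := (Algebra.TensorProduct.includeRight : Aᵐᵒᵖ →ₐ[ℂ] A ⊗[ℂ] Aᵐᵒᵖ)

/-- The product is `(x ⊗ x') (y ⊗ y') = x y ⊗ y' x'`. -/
theorem mul_tmul (x x' y y' : A) :
    equiv.symm (x ⊗ₜ[ℂ] x') * equiv.symm (y ⊗ₜ[ℂ] y') = equiv.symm ((x * y) ⊗ₜ[ℂ] (y' * x')) :=
  Algebra.TensorProduct.tmul_mul_tmul (R := ℂ) x y (MulOpposite.op x') (MulOpposite.op y')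

theorem one_eq : (1 : Env A) = equiv.symm (1 ⊗ₜ[ℂ] 1) := rfl

@[simp] theorem equiv_inl (a : A) : equiv (inl a) = a ⊗ₜ[ℂ] 1 := rfl

@[simp] theorem equiv_inr (a : Aᵐᵒᵖ) : equiv (inr a) = 1 ⊗ₜ[ℂ] a.unop := rfl

end Env

/-- A right comodule algebra `A` over the Hopf algebra `H`, with coaction `a ↦ a₀ ⊗ a₁`. -/
structure ComoduleAlgebra (H A : Type*) [Ring H] [HopfAlgebra ℂ H] [Ring A] [Algebra ℂ A] where
  /-- the coaction -/
  coact : A →ₐ[ℂ] A ⊗[ℂ] H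
  coassoc : ∀ a, TensorProduct.assoc ℂ A H H (coact.toLinearMap.rTensor H (coact a)) =
    (Coalgebra.comul (R := ℂ) (A := H)).lTensor A (coact a)
  counit : ∀ a, TensorProduct.rid ℂ A
    ((Coalgebra.counit (R := ℂ) (A := H)).lTensor A (coact a)) = a

namespace ComoduleAlgebra

section General

variable {H A : Type*} [Ring H] [HopfAlgebra ℂ H] [Ring A] [Algebra ℂ A] (δ : ComoduleAlgebra H A)

/-- The subalgebra `B` of coinvariant elements, `δ b = b ⊗ 1`. -/
def coinv : Subalgebra ℂ A := AlgHom.equalizer δ.coact Algebra.TensorProduct.includeLeft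

theorem mem_coinv {a : A} : a ∈ δ.coinv ↔ δ.coact a = a ⊗ₜ 1 := Iff.rfl

/-- `A ⊗_B A`. -/
abbrev AA : Type _ :=
  Balanced (fun b a => a * b : δ.coinv → A → A) (fun b a => b * a : δ.coinv → A → A)

/-- The projection `A ⊗ A → A ⊗_B A`. -/
abbrev mkAA : A ⊗[ℂ] A →ₗ[ℂ] δ.AA := Balanced.mk _ _

/-- The canonical Galois map `A ⊗_B A → A ⊗ H`, `a' ⊗_B a ↦ a' * a₀ ⊗ a₁`. -/
def galois : δ.AA →ₗ[ℂ] A ⊗[ℂ] H :=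
  Submodule.liftQ _ (TensorProduct.lift
    ((LinearMap.mul ℂ (A ⊗[ℂ] H)).compl₁₂
      (Algebra.TensorProduct.includeLeft : A →ₐ[ℂ] A ⊗[ℂ] H).toLinearMap
      δ.coact.toLinearMap)) <| by
    refine balancedRel_le _ fun b a' a => ?_
    have hb := δ.mem_coinv.1 b.2
    simp [hb, ← mul_assoc]

/-- The extension `B ⊆ A` is Hopf--Galois. -/
def IsHopfGalois : Prop := Function.Bijective δ.galois

/-- The translation map `τ : H → A ⊗_B A`, `τ h = χ⁻¹ (1 ⊗ h)`. -/
def translation (hG : δ.IsHopfGalois) : H →ₗ[ℂ] δ.AA :=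
  (LinearEquiv.ofBijective δ.galois hG).symm.toLinearMap ∘ₗ TensorProduct.mk ℂ A H 1

/-- The diagonal coaction `a ⊗ a' ↦ a₀ ⊗ a'₀ ⊗ a₁ * a'₁` on `A ⊗ A`. -/
def diag : A ⊗[ℂ] A →ₗ[ℂ] (A ⊗[ℂ] A) ⊗[ℂ] H :=
  (LinearMap.mul' ℂ H).lTensor (A ⊗[ℂ] A) ∘ₗ
    (TensorProduct.tensorTensorTensorComm ℂ A H A H).toLinearMap ∘ₗ
    TensorProduct.map δ.coact.toLinearMap δ.coact.toLinearMap

theorem diag_pure_mul (a a' : A) (y : Env A) (hy : δ.diag (Env.equiv y) = Env.equiv y ⊗ₜ 1) :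
    δ.diag (Env.equiv (Env.equiv.symm (a ⊗ₜ a') * y)) =
      (LinearMap.lTensor (A ⊗[ℂ] A) (LinearMap.id : H →ₗ[ℂ] H))
      ((Env.equiv.toLinearMap ∘ₗ LinearMap.mulRight ℂ y ∘ₗ Env.equiv.symm.toLinearMap).rTensor H
        (δ.diag (a ⊗ₜ a'))) := by
  let E := A ⊗[ℂ] A
  let P : A ⊗[ℂ] H →ₗ[ℂ] (E ⊗[ℂ] H →ₗ[ℂ] E ⊗[ℂ] H) := TensorProduct.lift
    ((TensorProduct.mapBilinear (.id ℂ) E H E H).compl₁₂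
      (LinearMap.rTensorHom A ∘ₗ LinearMap.mul ℂ A)
      (LinearMap.mul ℂ H))
  let Q : A ⊗[ℂ] H →ₗ[ℂ] (E ⊗[ℂ] H →ₗ[ℂ] E ⊗[ℂ] H) := TensorProduct.lift
    ((TensorProduct.mapBilinear (.id ℂ) E H E H).compl₁₂
      (LinearMap.lTensorHom A ∘ₗ (LinearMap.mul ℂ A).flip)
      (LinearMap.mul ℂ H).flip)
  let D : (A ⊗[ℂ] H) →ₗ[ℂ] (A ⊗[ℂ] H) →ₗ[ℂ] E ⊗[ℂ] H := TensorProduct.curry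
    ((LinearMap.mul' ℂ H).lTensor (A ⊗[ℂ] A) ∘ₗ
      (TensorProduct.tensorTensorTensorComm ℂ A H A H).toLinearMap)
  have hD : ∀ c c', δ.diag (c ⊗ₜ c') = D (δ.coact c) (δ.coact c') := fun c c' => by
    simp [diag, D]
  have key : ∀ u v w z : A ⊗[ℂ] H, D (u * v) (z * w) = P u (Q w (D v z)) := by
    intro u v w z
    induction u using TensorProduct.induction_on with
    | zero => simp
    | add u u' hu hu' => simp only [add_mul, map_add, LinearMap.add_apply, hu, hu']
    | tmul u1 u2 =>
    induction v using TensorProduct.induction_on with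
    | zero => simp
    | add u u' hu hu' => simp only [mul_add, map_add, LinearMap.add_apply, hu, hu']
    | tmul v1 v2 =>
    induction w using TensorProduct.induction_on with
    | zero => simp
    | add u u' hu hu' => simp only [mul_add, map_add, LinearMap.add_apply, hu, hu']
    | tmul w1 w2 =>
    induction z using TensorProduct.induction_on with
    | zero => simp
    | add u u' hu hu' => simp only [add_mul, map_add, hu, hu']
    | tmul z1 z2 =>
      simp [D, P, Q, E, mul_assoc]
  have key1 : ∀ (u w : A ⊗[ℂ] H) (y : A ⊗[ℂ] A), P u (Q w (y ⊗ₜ 1)) =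
      (Env.equiv.toLinearMap ∘ₗ LinearMap.mulRight ℂ (Env.equiv.symm y) ∘ₗ
        Env.equiv.symm.toLinearMap).rTensor H (D u w) := by
    intro u w y
    induction u using TensorProduct.induction_on with
    | zero => simp
    | add u u' hu hu' => simp only [map_add, LinearMap.add_apply, hu, hu']
    | tmul u1 u2 =>
    induction w using TensorProduct.induction_on with
    | zero => simp
    | add u u' hu hu' => simp only [map_add, LinearMap.add_apply, hu, hu']
    | tmul w1 w2 =>
    induction y using TensorProduct.induction_on with
    | zero => simp
    | add u u' hu hu' =>
      rw [TensorProduct.add_tmul, map_add, map_add, hu, hu']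
      simp [D, mul_add, TensorProduct.add_tmul]
    | tmul y1 y2 =>
      simp [D, P, Q, E, Env.mul_tmul]
  have : ∀ y, δ.diag (Env.equiv (Env.equiv.symm (a ⊗ₜ a') * Env.equiv.symm y)) =
      P (δ.coact a) (Q (δ.coact a') (δ.diag y)) := by
    intro y
    induction y using TensorProduct.induction_on with
    | zero => simp
    | add u u' hu hu' => simp only [mul_add, map_add, hu, hu']
    | tmul c c' =>
      have e1 := map_mul δ.coact a c
      have e2 := map_mul δ.coact c' a'
      rw [Env.mul_tmul, LinearEquiv.apply_symm_apply, hD, hD, e1, e2, key]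
  have h2 := this (Env.equiv y)
  rw [LinearEquiv.symm_apply_apply] at h2
  rw [h2, hy, key1, hD, LinearEquiv.symm_apply_apply]
  simp

/-- The Ehresmann--Schauenburg algebra `C = (A ⊗ A)^{co H}` of coinvariants of the diagonal coaction,
with product `(x ⊗ x') (y ⊗ y') = x y ⊗ y' x'`. -/
def ES : Subalgebra ℂ (Env A) where
  carrier := {x | δ.diag (Env.equiv x) = Env.equiv x ⊗ₜ 1}
  mul_mem' {x y} hx hy := by
    have : ∀ x, δ.diag (Env.equiv (Env.equiv.symm x * y)) =
      (Env.equiv.toLinearMap ∘ₗ LinearMap.mulRight ℂ y ∘ₗ Env.equiv.symm.toLinearMap).rTensor H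
        (δ.diag x) := by
      intro x
      induction x using TensorProduct.induction_on with
      | zero => simp
      | add u v hu hv => simp only [add_mul, map_add, hu, hv]
      | tmul a a' => simpa using δ.diag_pure_mul a a' y hy
    have h := this (Env.equiv x)
    rw [LinearEquiv.symm_apply_apply] at h
    change _ = _ at hx
    change _ = _
    rw [h, hx]
    simp
  add_mem' {x y} hx hy := by
    change _ = _ at hx hy
    change _ = _
    rw [map_add, map_add, hx, hy, TensorProduct.add_tmul]
  algebraMap_mem' r := by
    change _ = _
    simp [diag, Algebra.algebraMap_eq_smul_one, Env.one_eq, TensorProduct.smul_tmul',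
      Algebra.TensorProduct.one_def]

theorem mem_ES {x : Env A} : x ∈ δ.ES ↔ δ.diag (Env.equiv x) = Env.equiv x ⊗ₜ 1 := Iff.rfl

/-- The source map `s b = b ⊗ 1`. -/
def source : δ.coinv →ₐ[ℂ] δ.ES :=
  (Env.inl.comp δ.coinv.val).codRestrict δ.ES <| by
    intro b
    have hb := δ.mem_coinv.1 b.2
    simp [mem_ES, diag, hb, Algebra.TensorProduct.one_def]

/-- The target map `t b = 1 ⊗ b`. -/
def target : (δ.coinv)ᵐᵒᵖ →ₐ[ℂ] δ.ES :=
  (Env.inr.comp (AlgHom.op δ.coinv.val)).codRestrict δ.ES <| by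
    intro b
    have hb := δ.mem_coinv.1 b.unop.2
    simp [mem_ES, diag, hb, Algebra.TensorProduct.one_def]

theorem coact_mul' (x : A ⊗[ℂ] A) :
    δ.coact (LinearMap.mul' ℂ A x) = (LinearMap.mul' ℂ A).rTensor H (δ.diag x) := by
  induction x using TensorProduct.induction_on with
  | zero => simp
  | add u v hu hv => simp only [map_add, hu, hv]
  | tmul a a' =>
    simp only [diag, LinearMap.comp_apply, LinearEquiv.coe_coe, LinearMap.mul'_apply,
      TensorProduct.map_tmul, AlgHom.toLinearMap_apply]
    rw [map_mul δ.coact]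
    generalize δ.coact a = u
    generalize δ.coact a' = v
    induction u using TensorProduct.induction_on with
    | zero => simp
    | add u u' hu hu' => simp only [add_mul, TensorProduct.add_tmul, map_add, hu, hu']
    | tmul u1 u2 =>
    induction v using TensorProduct.induction_on with
    | zero => simp
    | add u u' hu hu' => simp only [mul_add, TensorProduct.tmul_add, map_add, hu, hu']
    | tmul v1 v2 => simp

/-- The counit `ε (a ⊗ a') = a * a'`. -/
def counitES : δ.ES →ₗ[ℂ] δ.coinv :=
  (LinearMap.mul' ℂ A ∘ₗ Env.equiv.toLinearMap ∘ₗ δ.ES.val.toLinearMap).codRestrict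
    (Subalgebra.toSubmodule δ.coinv) <| by
    intro x
    have hx := δ.mem_ES.1 x.2
    rw [Subalgebra.mem_toSubmodule, mem_coinv]
    simp [coact_mul', hx]

/-- `C ⊗_B C`. -/
abbrev ESTensor : Type _ := BTensor (B := δ.coinv) (L := δ.ES) δ.source δ.target

/-- The linear map `(A ⊗ A) ⊗ (A ⊗ A) → A ⊗ (A ⊗_B A) ⊗ A`,
`(x ⊗ x') ⊗ (y ⊗ y') ↦ x ⊗ (x' ⊗_B y) ⊗ y'`. -/
def join : (A ⊗[ℂ] A) ⊗[ℂ] (A ⊗[ℂ] A) →ₗ[ℂ] (A ⊗[ℂ] δ.AA) ⊗[ℂ] A :=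
  (δ.mkAA.lTensor A ∘ₗ (TensorProduct.assoc ℂ A A A).toLinearMap).rTensor A ∘ₗ
    (TensorProduct.assoc ℂ (A ⊗[ℂ] A) A A).symm.toLinearMap

/-- The map `C ⊗_B C → A ⊗ (A ⊗_B A) ⊗ A`,
`(x ⊗ x') ⊗_B (y ⊗ y') ↦ x ⊗ (x' ⊗_B y) ⊗ y'`. -/
def embed : δ.ESTensor →ₗ[ℂ] (A ⊗[ℂ] δ.AA) ⊗[ℂ] A :=
  BTensor.lift (B := δ.coinv) (L := δ.ES) (P := (A ⊗[ℂ] δ.AA) ⊗[ℂ] A) δ.source δ.target (δ.join ∘ₗ TensorProduct.map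
      (Env.equiv.toLinearMap ∘ₗ δ.ES.val.toLinearMap : δ.ES →ₗ[ℂ] A ⊗[ℂ] A)
      (Env.equiv.toLinearMap ∘ₗ δ.ES.val.toLinearMap : δ.ES →ₗ[ℂ] A ⊗[ℂ] A)) <| by
    intro b x y
    obtain ⟨x, hx⟩ : ∃ x', Env.equiv.symm x' = (x : Env A) := ⟨_, Env.equiv.symm_apply_apply _⟩
    obtain ⟨y, hy⟩ : ∃ y', Env.equiv.symm y' = (y : Env A) := ⟨_, Env.equiv.symm_apply_apply _⟩
    have hs : (δ.source b : Env A) = Env.equiv.symm ((b : A) ⊗ₜ 1) := rfl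
    have ht : (δ.target (.op b) : Env A) = Env.equiv.symm (1 ⊗ₜ (b : A)) := rfl
    simp only [LinearMap.comp_apply, TensorProduct.map_tmul, AlgHom.toLinearMap_apply,
      Subalgebra.coe_val, MulMemClass.coe_mul, ← hx, ← hy, hs, ht]
    clear hx hy
    induction x using TensorProduct.induction_on with
    | zero => simp
    | add u u' hu hu' => simp only [mul_add, TensorProduct.add_tmul, map_add, hu, hu']
    | tmul x x' =>
    induction y using TensorProduct.induction_on with
    | zero => simp
    | add u u' hu hu' => simp only [mul_add, TensorProduct.tmul_add, map_add, hu, hu']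
    | tmul y y' =>
      have : δ.mkAA ((x' * b) ⊗ₜ y) = δ.mkAA (x' ⊗ₜ (b * y)) := by
        rw [← sub_eq_zero, ← map_sub]
        exact (Submodule.Quotient.mk_eq_zero _).2 (Submodule.subset_span ⟨b, x', y, rfl⟩)
      rw [Env.mul_tmul, Env.mul_tmul]
      simp only [join, LinearEquiv.coe_coe, LinearEquiv.apply_symm_apply, one_mul, mul_one,
        LinearMap.comp_apply, TensorProduct.assoc_symm_tmul, LinearMap.rTensor_tmul,
        TensorProduct.assoc_tmul, LinearMap.lTensor_tmul, this]

/-- The map `a ⊗ a' ↦ a₀ ⊗ τ a₁ ⊗ a'` on `A ⊗ A`. -/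
def coprod (hG : δ.IsHopfGalois) : A ⊗[ℂ] A →ₗ[ℂ] (A ⊗[ℂ] δ.AA) ⊗[ℂ] A :=
  ((δ.translation hG).lTensor A ∘ₗ δ.coact.toLinearMap).rTensor A

/-- The Ehresmann--Schauenburg bialgebroid `C` of a Hopf--Galois extension is a Hopf algebroid over
the algebra `B` of coinvariants, with coproduct `Δ`, given by `Δ (a ⊗ a') = a₀ ⊗ τ a₁ ⊗ a'` under the
embedding of `C ⊗_B C` in `A ⊗ (A ⊗_B A) ⊗ A`, and with the flip as an invertible antipode `S` that
is its own inverse. -/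
structure IsFlipHopfAlgebroid (hG : δ.IsHopfGalois) (Δ : δ.ES →ₗ[ℂ] δ.ESTensor)
    (S : δ.ES ≃ₗ[ℂ] δ.ES) : Prop where
  embed_injective : Function.Injective δ.embed
  comul_eq : ∀ x : δ.ES, δ.embed (Δ x) = δ.coprod hG (Env.equiv (x : Env A))
  bialgebroid : IsLeftBialgebroid (B := δ.coinv) (L := δ.ES) δ.source δ.target Δ δ.counitES
  antipode_eq : ∀ x : δ.ES,
    Env.equiv (S x : Env A) = TensorProduct.comm ℂ A A (Env.equiv (x : Env A))
  symm_eq : S.symm = S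
  antipode : IsInvertibleAntipode (B := δ.coinv) (L := δ.ES) δ.source δ.target Δ S

end General

/-- `A` is faithfully flat as a right module over the algebra `B` of coinvariants: a map `F` of left
`B`-modules is injective if and only if `id ⊗_B F` is injective. -/
def IsFaithfullyFlat {H A : Type u} [Ring H] [HopfAlgebra ℂ H] [Ring A] [Algebra ℂ A]
    (δ : ComoduleAlgebra H A) : Prop :=
  ∀ (M N : Type u) [AddCommGroup M] [Module ℂ M] [Module δ.coinv M] [IsScalarTower ℂ δ.coinv M]
    [AddCommGroup N] [Module ℂ N] [Module δ.coinv N] [IsScalarTower ℂ δ.coinv N]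
    (F : M →ₗ[δ.coinv] N),
    Function.Injective F ↔
      Function.Injective
        (Balanced.map (ρ := (fun b a => a * b : δ.coinv → A → A))
          (ρ' := (fun b a => a * b : δ.coinv → A → A))
          (σ := fun (b : δ.coinv) (m : M) => b • m) (σ' := fun (b : δ.coinv) (n : N) => b • n)
          id LinearMap.id (F.restrictScalars ℂ) (fun _ _ => rfl) (fun b m => F.map_smul b m))

end ComoduleAlgebra
/-! ## Deformation of graded algebras -/

/-- The bicharacter `(r, l) ↦ exp (π i q(r, l))` of a biadditive real form `q`. -/
def phase {G : Type*} [AddCommGroup G] (q : G →+ G →+ ℝ) (r l : G) : ℂ :=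
  Complex.exp (Real.pi * Complex.I * (q r l : ℂ))

section Phase

variable {G : Type*} [AddCommGroup G] (q : G →+ G →+ ℝ)

theorem phase_add_left (r s l : G) : phase q (r + s) l = phase q r l * phase q s l := by
  simp [phase, mul_add, Complex.exp_add]

theorem phase_add_right (r s l : G) : phase q r (s + l) = phase q r s * phase q r l := by
  simp [phase, mul_add, Complex.exp_add]

@[simp] theorem phase_zero_left (l : G) : phase q 0 l = 1 := by simp [phase]

@[simp] theorem phase_zero_right (l : G) : phase q l 0 = 1 := by simp [phase]

end Phase

section Twist

variable {G A : Type*} [AddCommGroup G] [Ring A] [Algebra ℂ A]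

/-- The deformed product of a graded algebra: `a_r · b_l = exp (π i q(r, l)) a_r b_l` for `a_r` and
`b_l` homogeneous of degrees `r` and `l`, extended bilinearly. -/
def twistMul [DecidableEq G] (q : G →+ G →+ ℝ) (𝒜 : G → Submodule ℂ A) [GradedAlgebra 𝒜] :
    A →ₗ[ℂ] A →ₗ[ℂ] A :=
  DirectSum.toModule ℂ G (A →ₗ[ℂ] A) (fun r =>
    (DirectSum.toModule ℂ G (𝒜 r →ₗ[ℂ] A) (fun l =>
        phase q r l • ((LinearMap.mul ℂ A).compl₁₂ (𝒜 r).subtype (𝒜 l).subtype).flip) ∘ₗ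
      (DirectSum.decomposeLinearEquiv 𝒜).toLinearMap).flip) ∘ₗ
    (DirectSum.decomposeLinearEquiv 𝒜).toLinearMap

theorem twistMul_apply [DecidableEq G] (q : G →+ G →+ ℝ) (𝒜 : G → Submodule ℂ A) [GradedAlgebra 𝒜]
    {r l : G} {a b : A} (ha : a ∈ 𝒜 r) (hb : b ∈ 𝒜 l) :
    twistMul q 𝒜 a b = phase q r l • (a * b) := by
  lift a to 𝒜 r using ha
  lift b to 𝒜 l using hb
  simp only [twistMul, LinearMap.comp_apply, LinearEquiv.coe_coe,
    DirectSum.decomposeLinearEquiv_apply_coe, DirectSum.toModule_lof, LinearMap.flip_apply]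
  simp

theorem hom_ext_of_graded [DecidableEq G] (𝒜 : G → Submodule ℂ A) [GradedAlgebra 𝒜] {P : Type*}
    [AddCommGroup P] [Module ℂ P] {f g : A →ₗ[ℂ] P} (h : ∀ r, ∀ a ∈ 𝒜 r, f a = g a) : f = g := by
  ext a
  induction a using DirectSum.Decomposition.inductionOn 𝒜 with
  | zero => simp
  | homogeneous a => exact h _ _ a.2
  | add a b ha hb => simp [ha, hb]

/-- The vector space underlying the deformation `A_q` of a graded algebra `A`. -/
def Twist (_q : G →+ G →+ ℝ) (_𝒜 : G → Submodule ℂ A) : Type _ := A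

namespace Twist

variable (q : G →+ G →+ ℝ) (𝒜 : G → Submodule ℂ A)

instance : AddCommGroup (Twist q 𝒜) := inferInstanceAs (AddCommGroup A)

instance : Module ℂ (Twist q 𝒜) := inferInstanceAs (Module ℂ A)

/-- The identity map from `A` to its deformation. -/
def equiv : A ≃ₗ[ℂ] Twist q 𝒜 := LinearEquiv.refl ℂ A

variable [DecidableEq G] [GradedAlgebra 𝒜]

theorem twistMul_assoc (a b c : A) :
    twistMul q 𝒜 (twistMul q 𝒜 a b) c = twistMul q 𝒜 a (twistMul q 𝒜 b c) := by
  induction a using DirectSum.Decomposition.inductionOn 𝒜 with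
  | zero => simp
  | add a b ha hb => simp [ha, hb]
  | @homogeneous r a =>
  induction b using DirectSum.Decomposition.inductionOn 𝒜 with
  | zero => simp
  | add a b ha hb => simp [ha, hb]
  | @homogeneous l b =>
  induction c using DirectSum.Decomposition.inductionOn 𝒜 with
  | zero => simp
  | add a b ha hb => simp [ha, hb]
  | @homogeneous s c =>
  rw [twistMul_apply q 𝒜 a.2 b.2, twistMul_apply q 𝒜 b.2 c.2, map_smul, map_smul,
    LinearMap.smul_apply, twistMul_apply q 𝒜 (SetLike.mul_mem_graded a.2 b.2) c.2,
    twistMul_apply q 𝒜 a.2 (SetLike.mul_mem_graded b.2 c.2), smul_smul, smul_smul,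
    phase_add_left, phase_add_right, mul_assoc]
  congr 1
  ring

theorem one_twistMul (a : A) : twistMul q 𝒜 1 a = a := by
  induction a using DirectSum.Decomposition.inductionOn 𝒜 with
  | zero => simp
  | add a b ha hb => simp [ha, hb]
  | @homogeneous r a => simp [twistMul_apply q 𝒜 SetLike.GradedOne.one_mem a.2]

theorem twistMul_one (a : A) : twistMul q 𝒜 a 1 = a := by
  induction a using DirectSum.Decomposition.inductionOn 𝒜 with
  | zero => simp
  | add a b ha hb => simp [ha, hb]
  | @homogeneous r a => simp [twistMul_apply q 𝒜 a.2 SetLike.GradedOne.one_mem]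

instance : Ring (Twist q 𝒜) :=
  { (inferInstance : AddCommGroup (Twist q 𝒜)) with
    mul := fun a b => twistMul q 𝒜 a b
    one := (1 : A)
    mul_assoc := twistMul_assoc q 𝒜
    one_mul := one_twistMul q 𝒜
    mul_one := twistMul_one q 𝒜
    zero_mul := fun a => LinearMap.map_zero₂ (twistMul q 𝒜) a
    mul_zero := fun a => map_zero (twistMul q 𝒜 a)
    left_distrib := fun a b c => map_add (twistMul q 𝒜 a) b c
    right_distrib := fun a b c => LinearMap.map_add₂ (twistMul q 𝒜) a b c }

instance : Algebra ℂ (Twist q 𝒜) :=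
  Algebra.ofModule (fun r a b => LinearMap.map_smul₂ (twistMul q 𝒜) r a b)
    (fun r a b => map_smul (twistMul q 𝒜 a) r b)

theorem equiv_one : equiv q 𝒜 1 = 1 := rfl

theorem equiv_mul (a b : A) : equiv q 𝒜 a * equiv q 𝒜 b = equiv q 𝒜 (twistMul q 𝒜 a b) := rfl

theorem equiv_mul_of_mem {r l : G} {a b : A} (ha : a ∈ 𝒜 r) (hb : b ∈ 𝒜 l) :
    equiv q 𝒜 a * equiv q 𝒜 b = phase q r l • equiv q 𝒜 (a * b) := by
  rw [equiv_mul, twistMul_apply q 𝒜 ha hb, map_smul]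

/-- A linear map out of a deformed algebra that is multiplicative on homogeneous elements is an
algebra map. -/
def homOfGraded {T : Type*} [Ring T] [Algebra ℂ T] (f : A →ₗ[ℂ] T) (h1 : f 1 = 1)
    (hmul : ∀ r l, ∀ a ∈ 𝒜 r, ∀ b ∈ 𝒜 l, f a * f b = phase q r l • f (a * b)) :
    Twist q 𝒜 →ₐ[ℂ] T :=
  AlgHom.ofLinearMap (f ∘ₗ (equiv q 𝒜).symm.toLinearMap) h1 <| by
    intro a b
    change f (twistMul q 𝒜 a b) = f a * f b
    change A at a b
    induction a using DirectSum.Decomposition.inductionOn 𝒜 with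
    | zero => simp
    | add a b ha hb => simp [ha, hb, add_mul]
    | @homogeneous r a =>
    induction b using DirectSum.Decomposition.inductionOn 𝒜 with
    | zero => simp
    | add a b ha hb => simp [ha, hb, mul_add]
    | @homogeneous l b =>
    rw [twistMul_apply q 𝒜 a.2 b.2, map_smul, hmul _ _ _ a.2 _ b.2]

end Twist

end Twist

/-- The subspace `V ⊗ W` of `M ⊗ N`. -/
abbrev tensorSub {M N : Type*} [AddCommGroup M] [Module ℂ M] [AddCommGroup N] [Module ℂ N]
    (V : Submodule ℂ M) (W : Submodule ℂ N) : Submodule ℂ (M ⊗[ℂ] N) :=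
  LinearMap.range (TensorProduct.map V.subtype W.subtype)

/-! ### Deformation by a skew-symmetric matrix -/

/-- Real skew-symmetric `n × n` matrices. -/
abbrev SkewMatrix (n : ℕ) : Type := {θ : Matrix (Fin n) (Fin n) ℝ // θ.transpose = -θ}

/-- Degrees, elements of `ℤⁿ`. -/
abbrev Deg (n : ℕ) : Type := Fin n → ℤ

/-- The additive map `l ↦ ⟨v, l⟩` on `ℤⁿ`. -/
def pairing {n : ℕ} (v : Fin n → ℝ) : Deg n →+ ℝ :=
  AddMonoidHom.mk' (fun l => v ⬝ᵥ (fun j => (l j : ℝ))) (fun l l' => by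
    rw [← dotProduct_add]
    congr 1
    ext j
    simp)

/-- The form `(r, l) ↦ ⟨θ r, l⟩` on `ℤⁿ`. The bicharacter `λ_θ` is `phase (form θ)`. -/
def form {n : ℕ} (θ : Matrix (Fin n) (Fin n) ℝ) : Deg n →+ Deg n →+ ℝ :=
  AddMonoidHom.mk' (fun r => pairing (θ.mulVec (fun k => (r k : ℝ)))) (fun r r' => by
    have h : (fun k => ((r + r') k : ℝ)) = (fun k => (r k : ℝ)) + (fun k => (r' k : ℝ)) := by
      ext j
      simp
    rw [h, Matrix.mulVec_add]
    exact AddMonoidHom.ext fun l => add_dotProduct (θ.mulVec fun k => (r k : ℝ))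
      (θ.mulVec fun k => (r' k : ℝ)) (fun j => (l j : ℝ)))

/-- The form on `ℤⁿ × ℤⁿ` of the block matrix `Θ = diag (θ, -θ)`. -/
def biform {n : ℕ} (θ : Matrix (Fin n) (Fin n) ℝ) : (Deg n × Deg n) →+ (Deg n × Deg n) →+ ℝ :=
  AddMonoidHom.mk' (fun r => (form θ r.1).comp (AddMonoidHom.fst _ _) +
      (form (-θ) r.2).comp (AddMonoidHom.snd _ _))
    (fun r r' => by
      ext1 l
      simp only [AddMonoidHom.add_apply, AddMonoidHom.comp_apply, Prod.fst_add, Prod.snd_add,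
        map_add]
      ring)

theorem form_neg {n : ℕ} (θ : Matrix (Fin n) (Fin n) ℝ) (r l : Deg n) :
    form (-θ) r l = -form θ r l := by
  simp [form, pairing, Matrix.neg_mulVec]

theorem form_self {n : ℕ} (θ : SkewMatrix n) (r : Deg n) : form θ.1 r r = 0 := by
  have h : ∀ v : Fin n → ℝ, θ.1.mulVec v ⬝ᵥ v = -(θ.1.mulVec v ⬝ᵥ v) := fun v => by
    conv_lhs => rw [dotProduct_comm, Matrix.dotProduct_mulVec, ← Matrix.mulVec_transpose, θ.2,
      Matrix.neg_mulVec, neg_dotProduct]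
  have := h (fun k => (r k : ℝ))
  simp only [form, pairing, AddMonoidHom.mk'_apply]
  linarith

theorem phase_biform {n : ℕ} (θ : Matrix (Fin n) (Fin n) ℝ) (r l : Deg n × Deg n) :
    phase (biform θ) r l = phase (form θ) r.1 l.1 * phase (form (-θ)) r.2 l.2 := by
  simp [phase, biform, mul_add, Complex.exp_add]

theorem phase_form_neg {n : ℕ} (θ : Matrix (Fin n) (Fin n) ℝ) (r l : Deg n) :
    phase (form θ) r l * phase (form (-θ)) r l = 1 := by
  simp [phase, form_neg, ← Complex.exp_add]

@[simp] theorem phase_form_self {n : ℕ} (θ : SkewMatrix n) (r : Deg n) :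
    phase (form θ.1) r r = 1 := by
  simp [phase, form_self]
theorem coassoc_transport {M M' K K' : Type*} [AddCommGroup M] [Module ℂ M] [AddCommGroup M']
    [Module ℂ M'] [AddCommGroup K] [Module ℂ K] [AddCommGroup K'] [Module ℂ K']
    (e : M →ₗ[ℂ] M') (g : K →ₗ[ℂ] K') {f : M →ₗ[ℂ] M ⊗[ℂ] K} {f' : M' →ₗ[ℂ] M' ⊗[ℂ] K'}
    {D : K →ₗ[ℂ] K ⊗[ℂ] K} {D' : K' →ₗ[ℂ] K' ⊗[ℂ] K'}
    (hf : ∀ a, f' (e a) = TensorProduct.map e g (f a))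
    (hD : ∀ k, D' (g k) = TensorProduct.map g g (D k)) (a : M)
    (h : TensorProduct.assoc ℂ M K K (f.rTensor K (f a)) = D.lTensor M (f a)) :
    TensorProduct.assoc ℂ M' K' K' (f'.rTensor K' (f' (e a))) = D'.lTensor M' (f' (e a)) := by
  have h1 : ∀ z : M ⊗[ℂ] K, f'.rTensor K' (TensorProduct.map e g z) =
      TensorProduct.map (TensorProduct.map e g) g (f.rTensor K z) := by
    intro z
    induction z using TensorProduct.induction_on with
    | zero => simp
    | add u v hu hv => simp only [map_add, hu, hv]
    | tmul m k => simp [hf]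
  have h2 : ∀ z : M ⊗[ℂ] K, D'.lTensor M' (TensorProduct.map e g z) =
      TensorProduct.map e (TensorProduct.map g g) (D.lTensor M z) := by
    intro z
    induction z using TensorProduct.induction_on with
    | zero => simp
    | add u v hu hv => simp only [map_add, hu, hv]
    | tmul m k => simp [hD]
  have h3 : ∀ z : (M ⊗[ℂ] K) ⊗[ℂ] K,
      TensorProduct.assoc ℂ M' K' K' (TensorProduct.map (TensorProduct.map e g) g z) =
      TensorProduct.map e (TensorProduct.map g g) (TensorProduct.assoc ℂ M K K z) := by
    intro z
    induction z using TensorProduct.induction_on with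
    | zero => simp
    | add u v hu hv => simp only [map_add, hu, hv]
    | tmul m k =>
    induction m using TensorProduct.induction_on with
    | zero => simp
    | add u v hu hv => simp only [map_add, TensorProduct.add_tmul, hu, hv]
    | tmul m k => simp
  rw [hf, h1, h3, h2, h]

/-! ### Scenario I: the Hopf algebra is not deformed -/

section ScenarioI

variable {G H A : Type*} [AddCommGroup G] [DecidableEq G] [Ring H] [HopfAlgebra ℂ H] [Ring A]
  [Algebra ℂ A]

/-- The coaction preserves the grading of `A`: `δ (A_r) ⊆ A_r ⊗ H`. -/
def ComoduleAlgebra.IsGraded (δ : ComoduleAlgebra H A) (𝒜 : G → Submodule ℂ A) : Prop :=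
  ∀ r, ∀ a ∈ 𝒜 r, δ.coact a ∈ tensorSub (𝒜 r) (⊤ : Submodule ℂ H)

theorem rTensor_equiv_mul (q : G →+ G →+ ℝ) (𝒜 : G → Submodule ℂ A) [GradedAlgebra 𝒜] {r l : G}
    {z w : A ⊗[ℂ] H} (hz : z ∈ tensorSub (𝒜 r) (⊤ : Submodule ℂ H))
    (hw : w ∈ tensorSub (𝒜 l) (⊤ : Submodule ℂ H)) :
    (Twist.equiv q 𝒜).toLinearMap.rTensor H z * (Twist.equiv q 𝒜).toLinearMap.rTensor H w =
      phase q r l • (Twist.equiv q 𝒜).toLinearMap.rTensor H (z * w) := by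
  obtain ⟨z, rfl⟩ := hz
  obtain ⟨w, rfl⟩ := hw
  induction z using TensorProduct.induction_on with
  | zero => simp
  | add a b ha hb => simp only [map_add, add_mul, ha, hb, smul_add]
  | tmul a h =>
  induction w using TensorProduct.induction_on with
  | zero => simp
  | add a b ha hb => simp only [map_add, mul_add, ha, hb, smul_add]
  | tmul b k =>
  simp [Twist.equiv_mul_of_mem q 𝒜 a.2 b.2, TensorProduct.smul_tmul']

/-- The deformation of an `H`-comodule algebra, with the same coaction. -/
def ComoduleAlgebra.deform (δ : ComoduleAlgebra H A) (q : G →+ G →+ ℝ) (𝒜 : G → Submodule ℂ A)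
    [GradedAlgebra 𝒜] (hδ : δ.IsGraded 𝒜) : ComoduleAlgebra H (Twist q 𝒜) where
  coact := Twist.homOfGraded q 𝒜
    ((Twist.equiv q 𝒜).toLinearMap.rTensor H ∘ₗ δ.coact.toLinearMap)
    (by simp [Algebra.TensorProduct.one_def, Twist.equiv_one])
    (fun r l a ha b hb => by
      have e := map_mul δ.coact a b
      simp only [LinearMap.comp_apply, AlgHom.toLinearMap_apply, e]
      exact rTensor_equiv_mul q 𝒜 (hδ r a ha) (hδ l b hb))
  coassoc a := coassoc_transport (Twist.equiv q 𝒜).toLinearMap (LinearMap.id : H →ₗ[ℂ] H)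
    (fun _ => rfl) (fun k => by simp) ((Twist.equiv q 𝒜).symm a) (δ.coassoc _)
  counit a := by
    have h : ∀ z : A ⊗[ℂ] H, TensorProduct.rid ℂ (Twist q 𝒜)
        ((Coalgebra.counit (R := ℂ) (A := H)).lTensor (Twist q 𝒜)
          ((Twist.equiv q 𝒜).toLinearMap.rTensor H z)) =
        Twist.equiv q 𝒜 (TensorProduct.rid ℂ A
          ((Coalgebra.counit (R := ℂ) (A := H)).lTensor A z)) := by
      intro z
      induction z using TensorProduct.induction_on with
      | zero => simp
      | add u v hu hv => simp only [map_add, hu, hv]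
      | tmul m k => simp
    exact (h _).trans (congrArg (Twist.equiv q 𝒜) (δ.counit ((Twist.equiv q 𝒜).symm a)))

end ScenarioI

/-! ### Scenario II: the Hopf algebra is deformed as well -/

section ScenarioII

variable {n : ℕ} {H A : Type*} [Ring H] [HopfAlgebra ℂ H] [Ring A] [Algebra ℂ A]

/-- The compatibility of the structure maps of a Hopf algebra with a bigrading by `ℤⁿ × ℤⁿ`. (The
product preserves the bigrading: this is part of `GradedAlgebra ℋ`.) -/
class IsBigradedHopf (ℋ : Deg n × Deg n → Submodule ℂ H) : Prop where
  /-- `Δ (H_(r, l)) ⊆ ⨁ s, H_(r, s) ⊗ H_(s, l)` -/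
  comul_mem : ∀ r l, ∀ h ∈ ℋ (r, l),
    Coalgebra.comul (R := ℂ) h ∈ ⨆ s, tensorSub (ℋ (r, s)) (ℋ (s, l))
  /-- `ε (H_(r, l)) = 0` for `r ≠ l` -/
  counit_eq_zero : ∀ r l, ∀ h ∈ ℋ (r, l), r ≠ l → Coalgebra.counit (R := ℂ) h = 0
  /-- `S (H_(r, l)) ⊆ H_(-l, -r)` -/
  antipode_mem : ∀ r l, ∀ h ∈ ℋ (r, l), HopfAlgebra.antipode ℂ h ∈ ℋ (-l, -r)

/-- The coaction is compatible with the bigradings: `δ (A_(r, l)) ⊆ ⨁ s, A_(r, s) ⊗ H_(s, l)`. -/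
def ComoduleAlgebra.IsBigraded (δ : ComoduleAlgebra H A) (𝒜 : Deg n × Deg n → Submodule ℂ A)
    (ℋ : Deg n × Deg n → Submodule ℂ H) : Prop :=
  ∀ r l, ∀ a ∈ 𝒜 (r, l), δ.coact a ∈ ⨆ s, tensorSub (𝒜 (r, s)) (ℋ (s, l))

/-- The identity map from `A ⊗ H` to `A_Θ ⊗ H_Θ`. -/
abbrev twistTensor (θ : SkewMatrix n) (𝒜 : Deg n × Deg n → Submodule ℂ A)
    (ℋ : Deg n × Deg n → Submodule ℂ H) :
    A ⊗[ℂ] H →ₗ[ℂ] Twist (biform θ.1) 𝒜 ⊗[ℂ] Twist (biform θ.1) ℋ :=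
  TensorProduct.map (Twist.equiv (biform θ.1) 𝒜).toLinearMap
    (Twist.equiv (biform θ.1) ℋ).toLinearMap

theorem twistTensor_mul (θ : SkewMatrix n) (𝒜 : Deg n × Deg n → Submodule ℂ A) [GradedAlgebra 𝒜]
    (ℋ : Deg n × Deg n → Submodule ℂ H) [GradedAlgebra ℋ] {r l p k : Deg n} {z w : A ⊗[ℂ] H}
    (hz : z ∈ ⨆ s, tensorSub (𝒜 (r, s)) (ℋ (s, l)))
    (hw : w ∈ ⨆ s, tensorSub (𝒜 (p, s)) (ℋ (s, k))) :
    twistTensor θ 𝒜 ℋ z * twistTensor θ 𝒜 ℋ w =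
      phase (biform θ.1) (r, l) (p, k) • twistTensor θ 𝒜 ℋ (z * w) := by
  induction hz using Submodule.iSup_induction' with
  | zero => simp
  | add a b _ _ ha hb => simp only [map_add, add_mul, ha, hb, smul_add]
  | mem s z hz =>
  induction hw using Submodule.iSup_induction' with
  | zero => simp
  | add a b _ _ ha hb => simp only [map_add, mul_add, ha, hb, smul_add]
  | mem t w hw =>
  obtain ⟨z, rfl⟩ := hz
  obtain ⟨w, rfl⟩ := hw
  induction z using TensorProduct.induction_on with
  | zero => simp
  | add a b ha hb => simp only [map_add, add_mul, ha, hb, smul_add]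
  | tmul a h =>
  induction w using TensorProduct.induction_on with
  | zero => simp
  | add a b ha hb => simp only [map_add, mul_add, ha, hb, smul_add]
  | tmul b k' =>
  simp only [TensorProduct.map_tmul, Submodule.coe_subtype, LinearEquiv.coe_coe,
    Algebra.TensorProduct.tmul_mul_tmul, Twist.equiv_mul_of_mem (biform θ.1) 𝒜 a.2 b.2,
    Twist.equiv_mul_of_mem (biform θ.1) ℋ h.2 k'.2, TensorProduct.smul_tmul_smul, phase_biform]
  congr 1
  linear_combination phase (form θ.1) r p * phase (form (-θ.1)) l k * phase_form_neg θ.1 s t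

/-- A map `f : A → A ⊗ H` that is compatible with the bigradings is an algebra map for the deformed
products. -/
def twistCoact (θ : SkewMatrix n) (𝒜 : Deg n × Deg n → Submodule ℂ A) [GradedAlgebra 𝒜]
    (ℋ : Deg n × Deg n → Submodule ℂ H) [GradedAlgebra ℋ] (f : A →ₐ[ℂ] A ⊗[ℂ] H)
    (hf : ∀ r l, ∀ a ∈ 𝒜 (r, l), f a ∈ ⨆ s, tensorSub (𝒜 (r, s)) (ℋ (s, l))) :
    Twist (biform θ.1) 𝒜 →ₐ[ℂ] Twist (biform θ.1) 𝒜 ⊗[ℂ] Twist (biform θ.1) ℋ :=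
  Twist.homOfGraded (biform θ.1) 𝒜 (twistTensor θ 𝒜 ℋ ∘ₗ f.toLinearMap)
    (by simp [Algebra.TensorProduct.one_def, Twist.equiv_one])
    (fun r l a ha b hb => by
      have e := map_mul f a b
      simp only [LinearMap.comp_apply, AlgHom.toLinearMap_apply, e]
      exact twistTensor_mul θ 𝒜 ℋ (hf r.1 r.2 a ha) (hf l.1 l.2 b hb))

section Hopf

variable (θ : SkewMatrix n) (ℋ : Deg n × Deg n → Submodule ℂ H) [GradedAlgebra ℋ]
  [hℋ : IsBigradedHopf ℋ]

/-- The coalgebra `H_Θ`, with the coproduct and the counit of `H`. -/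
instance twistCoalgebra : Coalgebra ℂ (Twist (biform θ.1) ℋ) where
  comul := twistTensor θ ℋ ℋ ∘ₗ Coalgebra.comul ∘ₗ (Twist.equiv (biform θ.1) ℋ).symm.toLinearMap
  counit := Coalgebra.counit ∘ₗ (Twist.equiv (biform θ.1) ℋ).symm.toLinearMap
  coassoc := by
    ext a
    exact coassoc_transport (Twist.equiv (biform θ.1) ℋ).toLinearMap
      (Twist.equiv (biform θ.1) ℋ).toLinearMap (fun _ => rfl) (fun k => rfl)
      ((Twist.equiv (biform θ.1) ℋ).symm a) (Coalgebra.coassoc_apply (R := ℂ) (A := H) _)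
  rTensor_counit_comp_comul := by
    ext a
    have h : ∀ z : H ⊗[ℂ] H, (Coalgebra.counit ∘ₗ
        (Twist.equiv (biform θ.1) ℋ).symm.toLinearMap).rTensor _ (twistTensor θ ℋ ℋ z) =
        (Twist.equiv (biform θ.1) ℋ).toLinearMap.lTensor ℂ
          ((Coalgebra.counit (R := ℂ) (A := H)).rTensor H z) := by
      intro z
      induction z using TensorProduct.induction_on with
      | zero => simp
      | add u v hu hv => simp only [map_add, hu, hv]
      | tmul m k => simp
    refine (h _).trans ((congrArg _
      (Coalgebra.rTensor_counit_comul (R := ℂ) (A := H) _)).trans ?_)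
    rfl
  lTensor_counit_comp_comul := by
    ext a
    have h : ∀ z : H ⊗[ℂ] H, (Coalgebra.counit ∘ₗ
        (Twist.equiv (biform θ.1) ℋ).symm.toLinearMap).lTensor _ (twistTensor θ ℋ ℋ z) =
        (Twist.equiv (biform θ.1) ℋ).toLinearMap.rTensor ℂ
          ((Coalgebra.counit (R := ℂ) (A := H)).lTensor H z) := by
      intro z
      induction z using TensorProduct.induction_on with
      | zero => simp
      | add u v hu hv => simp only [map_add, hu, hv]
      | tmul m k => simp
    refine (h _).trans ((congrArg _
      (Coalgebra.lTensor_counit_comul (R := ℂ) (A := H) _)).trans ?_)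
    rfl

theorem twist_counit_mul (a b : H) :
    Coalgebra.counit (R := ℂ) (twistMul (biform θ.1) ℋ a b) =
      Coalgebra.counit (R := ℂ) a * Coalgebra.counit (R := ℂ) b := by
  induction a using DirectSum.Decomposition.inductionOn ℋ with
  | zero => simp
  | add a b ha hb => simp [ha, hb, add_mul]
  | @homogeneous r a =>
  induction b using DirectSum.Decomposition.inductionOn ℋ with
  | zero => simp
  | add a b ha hb => simp [ha, hb, mul_add]
  | @homogeneous l b =>
  rw [twistMul_apply _ ℋ a.2 b.2, map_smul, Bialgebra.counit_mul, phase_biform]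
  by_cases hr : r.1 = r.2
  · by_cases hl : l.1 = l.2
    · rw [hr, hl, phase_form_neg, one_smul]
    · rw [hℋ.counit_eq_zero l.1 l.2 b b.2 hl]
      simp
  · rw [hℋ.counit_eq_zero r.1 r.2 a a.2 hr]
    simp

/-- The bialgebra `H_Θ`. -/
instance twistBialgebra : Bialgebra ℂ (Twist (biform θ.1) ℋ) :=
  Bialgebra.mk' ℂ (Twist (biform θ.1) ℋ) (Bialgebra.counit_one (R := ℂ) (A := H))
    (fun {a b} => twist_counit_mul θ ℋ a b)
    (map_one (twistCoact θ ℋ ℋ (Bialgebra.comulAlgHom ℂ H) hℋ.comul_mem))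
    (fun {a b} => map_mul (twistCoact θ ℋ ℋ (Bialgebra.comulAlgHom ℂ H) hℋ.comul_mem) a b)

/-- The antipode of `H_Θ` is the one of `H`. -/
def twistAntipode : Twist (biform θ.1) ℋ →ₗ[ℂ] Twist (biform θ.1) ℋ :=
  (Twist.equiv (biform θ.1) ℋ).toLinearMap ∘ₗ HopfAlgebra.antipode ℂ ∘ₗ
    (Twist.equiv (biform θ.1) ℋ).symm.toLinearMap

theorem twistAntipode_rTensor {r l : Deg n} {z : H ⊗[ℂ] H}
    (hz : z ∈ ⨆ s, tensorSub (ℋ (r, s)) (ℋ (s, l))) :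
    LinearMap.mul' ℂ (Twist (biform θ.1) ℋ)
        ((twistAntipode θ ℋ).rTensor _ (twistTensor θ ℋ ℋ z)) =
      phase (form θ.1) r l • Twist.equiv (biform θ.1) ℋ
        (LinearMap.mul' ℂ H ((HopfAlgebra.antipode ℂ).rTensor H z)) := by
  induction hz using Submodule.iSup_induction' with
  | zero => simp
  | add a b _ _ ha hb => simp only [map_add, ha, hb, smul_add]
  | mem s z hz =>
  obtain ⟨z, rfl⟩ := hz
  induction z using TensorProduct.induction_on with
  | zero => simp
  | add a b ha hb => simp only [map_add, ha, hb, smul_add]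
  | tmul a b =>
  have h := Twist.equiv_mul_of_mem (biform θ.1) ℋ (hℋ.antipode_mem r s a a.2) b.2
  simp only [TensorProduct.map_tmul, Submodule.coe_subtype, LinearMap.rTensor_tmul,
    LinearMap.mul'_apply, twistAntipode, LinearMap.comp_apply, LinearEquiv.coe_coe,
    LinearEquiv.symm_apply_apply, h]
  congr 1
  simp [phase, biform, form_neg, form_self]

theorem twistAntipode_lTensor {r l : Deg n} {z : H ⊗[ℂ] H}
    (hz : z ∈ ⨆ s, tensorSub (ℋ (r, s)) (ℋ (s, l))) :
    LinearMap.mul' ℂ (Twist (biform θ.1) ℋ)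
        ((twistAntipode θ ℋ).lTensor _ (twistTensor θ ℋ ℋ z)) =
      phase (form (-θ.1)) r l • Twist.equiv (biform θ.1) ℋ
        (LinearMap.mul' ℂ H ((HopfAlgebra.antipode ℂ).lTensor H z)) := by
  induction hz using Submodule.iSup_induction' with
  | zero => simp
  | add a b _ _ ha hb => simp only [map_add, ha, hb, smul_add]
  | mem s z hz =>
  obtain ⟨z, rfl⟩ := hz
  induction z using TensorProduct.induction_on with
  | zero => simp
  | add a b ha hb => simp only [map_add, ha, hb, smul_add]
  | tmul a b =>
  have h := Twist.equiv_mul_of_mem (biform θ.1) ℋ a.2 (hℋ.antipode_mem s l b b.2)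
  simp only [TensorProduct.map_tmul, Submodule.coe_subtype, LinearMap.lTensor_tmul,
    LinearMap.mul'_apply, twistAntipode, LinearMap.comp_apply, LinearEquiv.coe_coe,
    LinearEquiv.symm_apply_apply, h]
  congr 1
  simp [phase, biform, form_neg, form_self]

theorem phase_smul_counit {c : ℂ} {r l : Deg n} {h : H} (hh : h ∈ ℋ (r, l))
    (hc : r = l → c = 1) :
    c • Twist.equiv (biform θ.1) ℋ (algebraMap ℂ H (Coalgebra.counit h)) =
      algebraMap ℂ (Twist (biform θ.1) ℋ) (Coalgebra.counit h) := by
  by_cases hr : r = l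
  · rw [hc hr, one_smul, Algebra.algebraMap_eq_smul_one, Algebra.algebraMap_eq_smul_one, map_smul,
      Twist.equiv_one]
  · rw [hℋ.counit_eq_zero r l h hh hr]
    simp

/-- The Hopf algebra `H_Θ`, with deformed product and the coproduct, counit and antipode of `H`. -/
instance twistHopf : HopfAlgebra ℂ (Twist (biform θ.1) ℋ) where
  antipode := twistAntipode θ ℋ
  mul_antipode_rTensor_comul := by
    refine hom_ext_of_graded (A := H) ℋ fun r h hh => ?_
    refine (twistAntipode_rTensor θ ℋ (hℋ.comul_mem r.1 r.2 h hh)).trans ?_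
    rw [HopfAlgebra.mul_antipode_rTensor_comul_apply]
    exact phase_smul_counit θ ℋ hh (fun e => by rw [e, phase_form_self])
  mul_antipode_lTensor_comul := by
    refine hom_ext_of_graded (A := H) ℋ fun r h hh => ?_
    refine (twistAntipode_lTensor θ ℋ (hℋ.comul_mem r.1 r.2 h hh)).trans ?_
    rw [HopfAlgebra.mul_antipode_lTensor_comul_apply]
    exact phase_smul_counit θ ℋ hh (fun e => by rw [e]; simp [phase, form_neg, form_self])

/-- The `H_Θ`-comodule algebra `A_Θ`, with the same coaction. -/
def ComoduleAlgebra.bideform (δ : ComoduleAlgebra H A) (𝒜 : Deg n × Deg n → Submodule ℂ A)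
    [GradedAlgebra 𝒜] (hδ : δ.IsBigraded 𝒜 ℋ) :
    ComoduleAlgebra (Twist (biform θ.1) ℋ) (Twist (biform θ.1) 𝒜) where
  coact := twistCoact θ 𝒜 ℋ δ.coact hδ
  coassoc a := coassoc_transport (Twist.equiv (biform θ.1) 𝒜).toLinearMap
    (Twist.equiv (biform θ.1) ℋ).toLinearMap (fun _ => rfl) (fun _ => rfl)
    ((Twist.equiv (biform θ.1) 𝒜).symm a) (δ.coassoc _)
  counit a := by
    have h : ∀ z : A ⊗[ℂ] H, TensorProduct.rid ℂ (Twist (biform θ.1) 𝒜)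
        ((Coalgebra.counit (R := ℂ) (A := Twist (biform θ.1) ℋ)).lTensor _
          (twistTensor θ 𝒜 ℋ z)) =
        Twist.equiv (biform θ.1) 𝒜 (TensorProduct.rid ℂ A
          ((Coalgebra.counit (R := ℂ) (A := H)).lTensor A z)) := by
      intro z
      induction z using TensorProduct.induction_on with
      | zero => simp
      | add u v hu hv => simp only [map_add, hu, hv]
      | tmul m k =>
        have : Coalgebra.counit (R := ℂ) (Twist.equiv (biform θ.1) ℋ k) =
          Coalgebra.counit (R := ℂ) k := rfl
        simp [this]
    exact (h _).trans (congrArg (Twist.equiv (biform θ.1) 𝒜)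
      (δ.counit ((Twist.equiv (biform θ.1) 𝒜).symm a)))

end Hopf

end ScenarioII
/-! ## The deformed Hopf algebroid -/

/-- `δ'` is an extension on the vector space of `δ`, identified by `e : A ≃ A'`, such that:
both extensions are Hopf--Galois; the Ehresmann--Schauenburg bialgebroids `C` and `C'` are Hopf
algebroids with the flip as antipode; `B' = B` and `C' = C` as vector spaces; and the coproducts
`Δ x` in `C ⊗_B C` and `Δ' x` in `C ⊗_{B'} C` have a common representative in `C ⊗ C`. -/
def ComoduleAlgebra.DeformsToHopfAlgebroid {H A H' A' : Type*} [Ring H] [HopfAlgebra ℂ H] [Ring A]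
    [Algebra ℂ A] [Ring H'] [HopfAlgebra ℂ H'] [Ring A'] [Algebra ℂ A'] (δ : ComoduleAlgebra H A)
    (δ' : ComoduleAlgebra H' A') (e : A ≃ₗ[ℂ] A') : Prop :=
  ∃ (hG : δ.IsHopfGalois) (hG' : δ'.IsHopfGalois)
    (Δ : δ.ES →ₗ[ℂ] δ.ESTensor) (S : δ.ES ≃ₗ[ℂ] δ.ES)
    (Δ' : δ'.ES →ₗ[ℂ] δ'.ESTensor) (S' : δ'.ES ≃ₗ[ℂ] δ'.ES) (j : δ.ES ≃ₗ[ℂ] δ'.ES),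
    δ.IsFlipHopfAlgebroid hG Δ S ∧
    δ'.IsFlipHopfAlgebroid hG' Δ' S' ∧
    (∀ a, e a ∈ δ'.coinv ↔ a ∈ δ.coinv) ∧
    (∀ x : δ.ES, Env.equiv (j x : Env A') = TensorProduct.congr e e (Env.equiv (x : Env A))) ∧
    ∀ x : δ.ES, ∃ z : δ.ES ⊗[ℂ] δ.ES,
      BTensor.mk (B := δ.coinv) (L := δ.ES) δ.source δ.target z = Δ x ∧
      BTensor.mk (B := δ'.coinv) (L := δ'.ES) δ'.source δ'.target
        (TensorProduct.map j.toLinearMap j.toLinearMap z) = Δ' (j x)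

end HopfAlgebroids

end

open HopfAlgebroids

/-! Write C for the algebra of coinvariants in A ⊗ A. Calculations take place in A ⊗ A ⊗ A rather
than in A ⊗ (A ⊗_B A) ⊗ A: multiplying the inner factors gives (x ⊗ x') ⊗ (y ⊗ y') ↦ x ⊗ x'y ⊗ y'
(`mu₂`, and `mu₃` for three factors). Multiplication sends τ(h) to ε(h)1, so the coproduct becomes a
⊗ a' ↦ a ⊗ 1 ⊗ a'. The bialgebroid axioms then are evident identities of tensors, and the two
antipode axioms say that a ⊗ 1 ⊗ a' may be rotated cyclically. All of this needs only
`IsBalancedFaithful`: `mu₂` and `mu₃` are injective on C ⊗_B C and C ⊗_B C ⊗_B C, and a ⊗ 1 ⊗ a'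
lies in the range of `mu₂`.

For (H, A) these facts come from faithfully flat descent. The structure theorem for relative Hopf
modules, `IsFaithfullyFlat.extend_bijective`, gives A ⊗_B (A ⊗ V)^{co H} = A ⊗ V for every comodule
V. With V = A it reads A ⊗_B C = A ⊗ A, and by `extend_tensInd_bijective` each further factor C ⊗_B
- contributes another factor A. So `mu₂` and `mu₃` extend to isomorphisms over A, and faithful
flatness brings injectivity, and surjectivity onto coinvariants, back down.

For the deformed pair neither faithful flatness of A_Θ over B_Θ nor commutativity of H_Θ is
available or needed. Both scenarios are instances of `IsTwist`: the product of A is twisted by q in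
the first degrees and p in the second ones, that of H by -p and p. Coinvariance forces second degree
0 on B and opposite second degrees on C; as p is alternating, its phases vanish there and B and C
stay the same spaces. The identity of C ⊗ C does not respect the relations over B and B_Θ, but after
multiplication by exp(-π i q(r', l)) on homogeneous tensors of inner first degrees r' and l it does.
With such weights χ, `mu₂` and `mu₃` of the two extensions differ by invertible diagonal operators,
so the Galois property and `IsBalancedFaithful` carry over. Finally the middle factor 1 of a ⊗ 1 ⊗
a' has degree 0, so Δ(x) has a representative with r' + l = 0; there q(r', l) = 0, and the same
tensor represents the deformed coproduct. -/

noncomputable section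

namespace HopfAlgebroids

/-! ## Linear maps on iterated tensor powers of an algebra -/

section Star

variable {A W : Type*} [Ring A] [Algebra ℂ A] [AddCommGroup W] [Module ℂ W]

/-- The map `(x ⊗ x') ⊗ (y ⊗ w) ↦ x ⊗ (x' * y ⊗ w)`. -/
def star (A W : Type*) [Ring A] [Algebra ℂ A] [AddCommGroup W] [Module ℂ W] :
    (A ⊗[ℂ] A) ⊗[ℂ] (A ⊗[ℂ] W) →ₗ[ℂ] A ⊗[ℂ] (A ⊗[ℂ] W) :=
  ((LinearMap.mul' ℂ A).rTensor W ∘ₗ (TensorProduct.assoc ℂ A A W).symm.toLinearMap).lTensor A ∘ₗ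
    (TensorProduct.assoc ℂ A A (A ⊗[ℂ] W)).toLinearMap

@[simp] theorem star_tmul (x x' y : A) (w : W) :
    star A W ((x ⊗ₜ x') ⊗ₜ (y ⊗ₜ w)) = x ⊗ₜ ((x' * y) ⊗ₜ w) := by
  simp [star]

/-- The map `a ⊗ w ↦ a ⊗ (1 ⊗ w)`. -/
def insOne (A W : Type*) [Ring A] [Algebra ℂ A] [AddCommGroup W] [Module ℂ W] :
    A ⊗[ℂ] W →ₗ[ℂ] A ⊗[ℂ] (A ⊗[ℂ] W) :=
  (TensorProduct.mk ℂ A W 1).lTensor A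

@[simp] theorem insOne_tmul (a : A) (w : W) : insOne A W (a ⊗ₜ w) = a ⊗ₜ (1 ⊗ₜ w) := rfl

/-- A linear identity between tensors can be checked on pure tensors. -/
theorem tensor_ext {M N P : Type*} [AddCommMonoid M] [Module ℂ M] [AddCommMonoid N] [Module ℂ N]
    [AddCommMonoid P] [Module ℂ P] (f g : M ⊗[ℂ] N →ₗ[ℂ] P)
    (h : ∀ m n, f (m ⊗ₜ n) = g (m ⊗ₜ n)) (z : M ⊗[ℂ] N) : f z = g z :=
  LinearMap.congr_fun (TensorProduct.ext' h) z

theorem tensor_ext₄ {M N M' N' P : Type*} [AddCommMonoid M] [Module ℂ M] [AddCommMonoid N]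
    [Module ℂ N] [AddCommMonoid M'] [Module ℂ M'] [AddCommMonoid N'] [Module ℂ N']
    [AddCommMonoid P] [Module ℂ P] (f g : (M ⊗[ℂ] N) ⊗[ℂ] (M' ⊗[ℂ] N') →ₗ[ℂ] P)
    (h : ∀ m n m' n', f ((m ⊗ₜ n) ⊗ₜ (m' ⊗ₜ n')) = g ((m ⊗ₜ n) ⊗ₜ (m' ⊗ₜ n')))
    (z : (M ⊗[ℂ] N) ⊗[ℂ] (M' ⊗[ℂ] N')) : f z = g z := by
  refine tensor_ext f g (fun x y => ?_) z
  refine tensor_ext (f ∘ₗ (TensorProduct.mk ℂ _ _).flip y) (g ∘ₗ (TensorProduct.mk ℂ _ _).flip y)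
    (fun m n => ?_) x
  exact tensor_ext (f ∘ₗ TensorProduct.mk ℂ _ _ (m ⊗ₜ n)) (g ∘ₗ TensorProduct.mk ℂ _ _ (m ⊗ₜ n))
    (fun m' n' => h m n m' n') y

end Star

/-! ### The product of `A ⊗ Aᵒᵖ` after multiplication of the inner factors -/

namespace Env

variable {A : Type*} [Ring A] [Algebra ℂ A]

theorem ind {p : Env A → Prop} (x : Env A) (h0 : p 0)
    (ht : ∀ a a', p (equiv.symm (a ⊗ₜ a'))) (ha : ∀ x y, p x → p y → p (x + y)) : p x := by
  obtain ⟨x, rfl⟩ := equiv.symm.surjective x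
  induction x using TensorProduct.induction_on with
  | zero => simpa using h0
  | add u v hu hv => simpa using ha _ _ hu hv
  | tmul a a' => exact ht a a'

/-- `star` on `Env A ⊗ Env A`. -/
def star₂ (A : Type*) [Ring A] [Algebra ℂ A] : Env A ⊗[ℂ] Env A →ₗ[ℂ] A ⊗[ℂ] (A ⊗[ℂ] A) :=
  star A A ∘ₗ TensorProduct.map equiv.toLinearMap equiv.toLinearMap

@[simp] theorem star₂_tmul (x y : Env A) : star₂ A (x ⊗ₜ y) = star A A (equiv x ⊗ₜ equiv y) := rfl

/-- The section `u ⊗ (v ⊗ w) ↦ (u ⊗ v) ⊗ (1 ⊗ w)` of `star₂`. -/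
def sec (A : Type*) [Ring A] [Algebra ℂ A] : A ⊗[ℂ] (A ⊗[ℂ] A) →ₗ[ℂ] Env A ⊗[ℂ] Env A :=
  TensorProduct.map equiv.symm.toLinearMap (equiv.symm.toLinearMap ∘ₗ TensorProduct.mk ℂ A A 1) ∘ₗ
    (TensorProduct.assoc ℂ A A A).symm.toLinearMap

@[simp] theorem sec_tmul (u v w : A) :
    sec A (u ⊗ₜ (v ⊗ₜ w)) = equiv.symm (u ⊗ₜ v) ⊗ₜ equiv.symm (1 ⊗ₜ w) := rfl

/-- In the product with (p ⊗ p') ⊗ (q ⊗ q') the middle factor is p'x'yq, so z enters only through x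
⊗ x'y ⊗ y' and may be exchanged for any tensor with the same image. The one supplied by `sec` need
not come from C ⊗ C, which is why the computation is done in all of A ⊗ Aᵒᵖ. -/
theorem star₂_mul (z w : Env A ⊗[ℂ] Env A) : star₂ A (z * w) = star₂ A (sec A (star₂ A z) * w) := by
  induction w using TensorProduct.induction_on with
  | zero => simp
  | add u v hu hv => simp only [mul_add, map_add, hu, hv]
  | tmul p q =>
  induction z using TensorProduct.induction_on with
  | zero => simp
  | add u v hu hv => simp only [add_mul, map_add, hu, hv]
  | tmul x y =>
  induction p using ind with
  | h0 => simp
  | ha u v hu hv => simp only [TensorProduct.add_tmul, mul_add, map_add, hu, hv]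
  | ht p p' =>
  induction q using ind with
  | h0 => simp
  | ha u v hu hv => simp only [TensorProduct.tmul_add, mul_add, map_add, hu, hv]
  | ht q q' =>
  induction x using ind with
  | h0 => simp
  | ha u v hu hv => simp only [TensorProduct.add_tmul, add_mul, map_add, hu, hv]
  | ht x x' =>
  induction y using ind with
  | h0 => simp
  | ha u v hu hv => simp only [TensorProduct.tmul_add, add_mul, map_add, hu, hv]
  | ht y y' =>
  simp [mul_tmul, mul_assoc]

/-- For x = a ⊗ a' the left factor is (a ⊗ 1) ⊗ (1 ⊗ a'), which acts on the outer factors only and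
leaves the unit in the middle. Together with `star₂_mul` this is multiplicativity of the coproduct.
-/
theorem star₂_sec_insOne_mul {x y : Env A} {w : Env A ⊗[ℂ] Env A}
    (hw : star₂ A w = insOne A A (equiv y)) :
    star₂ A (sec A (insOne A A (equiv x)) * w) = insOne A A (equiv (x * y)) := by
  induction x using ind with
  | h0 => simp
  | ha u v hu hv => simp only [add_mul, map_add, hu, hv]
  | ht a a' =>
  have h1 : ∀ w : Env A ⊗[ℂ] Env A,
      star₂ A (sec A (insOne A A (equiv (equiv.symm (a ⊗ₜ a')))) * w) =
      TensorProduct.map (LinearMap.mulLeft ℂ a)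
        ((LinearMap.mulRight ℂ a').lTensor A) (star₂ A w) := by
    intro w
    induction w using TensorProduct.induction_on with
    | zero => simp
    | add u v hu hv => simp only [mul_add, map_add, hu, hv]
    | tmul p q =>
    induction p using ind with
    | h0 => simp
    | ha u v hu hv => simp only [TensorProduct.add_tmul, mul_add, map_add, hu, hv]
    | ht p p' =>
    induction q using ind with
    | h0 => simp
    | ha u v hu hv => simp only [TensorProduct.tmul_add, mul_add, map_add, hu, hv]
    | ht q q' =>
    simp [mul_tmul]
  rw [h1, hw]
  clear hw h1
  induction y using ind with
  | h0 => simp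
  | ha u v hu hv => simp only [mul_add, map_add, hu, hv]
  | ht y y' => simp [mul_tmul]

end Env

/-! ### The maps `mu₂` and `mu₃` on tensor powers of `C` -/

namespace ComoduleAlgebra

variable {H A : Type*} [Ring H] [HopfAlgebra ℂ H] [Ring A] [Algebra ℂ A] (δ : ComoduleAlgebra H A)

/-- The inclusion of the Ehresmann--Schauenburg algebra in `A ⊗ A`. -/
def inclES : δ.ES →ₗ[ℂ] A ⊗[ℂ] A := Env.equiv.toLinearMap ∘ₗ δ.ES.val.toLinearMap

theorem inclES_apply (x : δ.ES) : δ.inclES x = Env.equiv (x : Env A) := rfl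

theorem inclES_injective : Function.Injective δ.inclES :=
  Env.equiv.injective.comp Subtype.val_injective

theorem diag_inclES (x : δ.ES) : δ.diag (δ.inclES x) = δ.inclES x ⊗ₜ 1 := x.2

theorem exists_inclES_eq {X : A ⊗[ℂ] A} (h : δ.diag X = X ⊗ₜ 1) : ∃ x, δ.inclES x = X :=
  ⟨⟨Env.equiv.symm X, by rw [mem_ES, LinearEquiv.apply_symm_apply, h]⟩, by simp [inclES_apply]⟩

theorem inclES_one : δ.inclES 1 = 1 ⊗ₜ 1 := rfl

theorem inclES_source_mul (b : δ.coinv) (x : δ.ES) :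
    δ.inclES (δ.source b * x) = (LinearMap.mulLeft ℂ (b : A)).rTensor A (δ.inclES x) := by
  have h : ∀ y : Env A, Env.equiv (Env.equiv.symm ((b : A) ⊗ₜ 1) * y) =
      (LinearMap.mulLeft ℂ (b : A)).rTensor A (Env.equiv y) := fun y => by
    induction y using Env.ind with
    | h0 => simp
    | ha u v hu hv => simp only [mul_add, map_add, hu, hv]
    | ht y y' => simp [Env.mul_tmul]
  exact h x

theorem inclES_target_mul (b : δ.coinv) (x : δ.ES) :
    δ.inclES (δ.target (.op b) * x) = (LinearMap.mulRight ℂ (b : A)).lTensor A (δ.inclES x) := by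
  have h : ∀ y : Env A, Env.equiv (Env.equiv.symm (1 ⊗ₜ (b : A)) * y) =
      (LinearMap.mulRight ℂ (b : A)).lTensor A (Env.equiv y) := fun y => by
    induction y using Env.ind with
    | h0 => simp
    | ha u v hu hv => simp only [mul_add, map_add, hu, hv]
    | ht y y' => simp [Env.mul_tmul]
  exact h x

/-- The map `(x ⊗ x') ⊗ (y ⊗ y') ↦ x ⊗ x' * y ⊗ y'` on `C ⊗ C`. -/
def mu₂ : δ.ES ⊗[ℂ] δ.ES →ₗ[ℂ] A ⊗[ℂ] (A ⊗[ℂ] A) :=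
  star A A ∘ₗ TensorProduct.map δ.inclES δ.inclES

/-- The map `(x ⊗ x') ⊗ (y ⊗ y') ⊗ (w ⊗ w') ↦ x ⊗ x' * y ⊗ y' * w ⊗ w'` on `C ⊗ C ⊗ C`. -/
def mu₃ : δ.ES ⊗[ℂ] (δ.ES ⊗[ℂ] δ.ES) →ₗ[ℂ] A ⊗[ℂ] (A ⊗[ℂ] (A ⊗[ℂ] A)) :=
  star A (A ⊗[ℂ] A) ∘ₗ TensorProduct.map δ.inclES δ.mu₂

@[simp] theorem mu₂_tmul (x y : δ.ES) :
    δ.mu₂ (x ⊗ₜ y) = star A A (δ.inclES x ⊗ₜ δ.inclES y) := rfl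

@[simp] theorem mu₃_tmul (x : δ.ES) (y : δ.ES ⊗[ℂ] δ.ES) :
    δ.mu₃ (x ⊗ₜ y) = star A (A ⊗[ℂ] A) (δ.inclES x ⊗ₜ δ.mu₂ y) := rfl

theorem mu₂_eq_star₂ (z : δ.ES ⊗[ℂ] δ.ES) :
    δ.mu₂ z = Env.star₂ A (Algebra.TensorProduct.map δ.ES.val δ.ES.val z) :=
  tensor_ext δ.mu₂
    (Env.star₂ A ∘ₗ (Algebra.TensorProduct.map δ.ES.val δ.ES.val).toLinearMap)
    (fun _ _ => rfl) z

/-- Associativity (x'b)y = x'(by) in the middle factor; it makes `mu₂` and `mu₃` descend to tensor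
products over B. -/
theorem star_balanced {A W : Type*} [Ring A] [Algebra ℂ A] [AddCommGroup W] [Module ℂ W] (b : A)
    (X : A ⊗[ℂ] A) (Y : A ⊗[ℂ] W) :
    star A W ((LinearMap.mulRight ℂ b).lTensor A X ⊗ₜ Y) =
      star A W (X ⊗ₜ (LinearMap.mulLeft ℂ b).rTensor W Y) :=
  tensor_ext₄ (star A W ∘ₗ ((LinearMap.mulRight ℂ b).lTensor A).rTensor _)
    (star A W ∘ₗ ((LinearMap.mulLeft ℂ b).rTensor W).lTensor _)
    (fun m n m' n' => by simp [mul_assoc]) (X ⊗ₜ Y)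

theorem star_left {A W : Type*} [Ring A] [Algebra ℂ A] [AddCommGroup W] [Module ℂ W]
    (f : A →ₗ[ℂ] A) (X : A ⊗[ℂ] A) (Y : A ⊗[ℂ] W) :
    star A W (f.rTensor A X ⊗ₜ Y) = f.rTensor (A ⊗[ℂ] W) (star A W (X ⊗ₜ Y)) :=
  tensor_ext₄ (star A W ∘ₗ (f.rTensor A).rTensor _) (f.rTensor (A ⊗[ℂ] W) ∘ₗ star A W)
    (fun m n m' n' => by simp) (X ⊗ₜ Y)

theorem star_right {A W W' : Type*} [Ring A] [Algebra ℂ A] [AddCommGroup W] [Module ℂ W]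
    [AddCommGroup W'] [Module ℂ W'] (f : W →ₗ[ℂ] W') (X : A ⊗[ℂ] A) (Y : A ⊗[ℂ] W) :
    star A W' (X ⊗ₜ f.lTensor A Y) = (f.lTensor A).lTensor A (star A W (X ⊗ₜ Y)) :=
  tensor_ext₄ (star A W' ∘ₗ (f.lTensor A).lTensor _) ((f.lTensor A).lTensor A ∘ₗ star A W)
    (fun m n m' n' => by simp) (X ⊗ₜ Y)

/-- `mu₂` on `C ⊗_B C`. -/
def mu₂Bar : δ.ESTensor →ₗ[ℂ] A ⊗[ℂ] (A ⊗[ℂ] A) :=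
  BTensor.lift (B := δ.coinv) (L := δ.ES) δ.source δ.target δ.mu₂ <| by
    intro b x y
    simp only [mu₂_tmul, inclES_target_mul, inclES_source_mul, star_balanced]

/-- The projection `C ⊗ C → C ⊗_B C`. -/
abbrev mkES : δ.ES ⊗[ℂ] δ.ES →ₗ[ℂ] δ.ESTensor :=
  BTensor.mk (B := δ.coinv) (L := δ.ES) δ.source δ.target

@[simp] theorem mu₂Bar_mk (z : δ.ES ⊗[ℂ] δ.ES) : δ.mu₂Bar (δ.mkES z) = δ.mu₂ z := rfl

theorem mu₂_source_mul (b : δ.coinv) (z : δ.ES ⊗[ℂ] δ.ES) :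
    δ.mu₂ ((δ.source b ⊗ₜ 1) * z) = (LinearMap.mulLeft ℂ (b : A)).rTensor _ (δ.mu₂ z) :=
  tensor_ext (δ.mu₂ ∘ₗ LinearMap.mulLeft ℂ (δ.source b ⊗ₜ 1))
    ((LinearMap.mulLeft ℂ (b : A)).rTensor _ ∘ₗ δ.mu₂)
    (fun x y => by simp [inclES_source_mul, star_left]) z

theorem mu₂_target_mul (b : δ.coinv) (z : δ.ES ⊗[ℂ] δ.ES) :
    δ.mu₂ ((1 ⊗ₜ δ.target (.op b)) * z) =
      ((LinearMap.mulRight ℂ (b : A)).lTensor A).lTensor A (δ.mu₂ z) :=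
  tensor_ext (δ.mu₂ ∘ₗ LinearMap.mulLeft ℂ (1 ⊗ₜ δ.target (.op b)))
    (((LinearMap.mulRight ℂ (b : A)).lTensor A).lTensor A ∘ₗ δ.mu₂)
    (fun x y => by simp [inclES_target_mul, star_right]) z

/-- `mu₃` on `C ⊗_B C ⊗_B C`. -/
def mu₃Bar : BTensor₃ (B := δ.coinv) (L := δ.ES) δ.source δ.target →ₗ[ℂ]
    A ⊗[ℂ] (A ⊗[ℂ] (A ⊗[ℂ] A)) :=
  Submodule.liftQ _ δ.mu₃ <| by
    rw [balancedRel₃, Submodule.span_le]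
    rintro _ (⟨b, x, y, w, rfl⟩ | ⟨b, x, y, w, rfl⟩)
    · simp [inclES_target_mul, inclES_source_mul, star_balanced, star_left]
    · simp [inclES_target_mul, inclES_source_mul, star_balanced]

/-- The Ehresmann--Schauenburg algebra `C` is such that `mu₂` and `mu₃` are injective on
`C ⊗_B C` and `C ⊗_B C ⊗_B C`, and `a ⊗ 1 ⊗ a'` is in the range of `mu₂` for `a ⊗ a'` in `C`. -/
structure IsBalancedFaithful : Prop where
  ker_mu₂_le : ∀ z, δ.mu₂ z = 0 → δ.mkES z = 0
  ker_mu₃_le : ∀ z, δ.mu₃ z = 0 →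
    z ∈ balancedRel₃ (B := δ.coinv) (L := δ.ES) δ.source δ.target
  exists_mu₂_eq : ∀ x : δ.ES, ∃ z, δ.mu₂ z = insOne A A (δ.inclES x)

end ComoduleAlgebra

namespace ComoduleAlgebra

variable {H A : Type*} [Ring H] [HopfAlgebra ℂ H] [Ring A] [Algebra ℂ A] (δ : ComoduleAlgebra H A)

/-! ## The Hopf algebroid structure -/

namespace IsBalancedFaithful

variable {δ} (hE : δ.IsBalancedFaithful)
include hE

theorem mu₂Bar_injective : Function.Injective δ.mu₂Bar := by
  rw [← LinearMap.ker_eq_bot, Submodule.eq_bot_iff]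
  intro w hw
  obtain ⟨z, rfl⟩ := Submodule.mkQ_surjective _ w
  exact hE.ker_mu₂_le z hw

theorem mu₃Bar_injective : Function.Injective δ.mu₃Bar := by
  rw [← LinearMap.ker_eq_bot, Submodule.eq_bot_iff]
  intro w hw
  obtain ⟨z, rfl⟩ := Submodule.mkQ_surjective _ w
  exact (Submodule.Quotient.mk_eq_zero _).2 (hE.ker_mu₃_le z hw)

/-- The coproduct `a ⊗ a' ↦ a ⊗ 1 ⊗ a'` under the embedding `mu₂Bar`. -/
def comul : δ.ES →ₗ[ℂ] δ.ESTensor :=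
  (LinearEquiv.ofInjective δ.mu₂Bar hE.mu₂Bar_injective).symm.toLinearMap ∘ₗ
    (insOne A A ∘ₗ δ.inclES).codRestrict (LinearMap.range δ.mu₂Bar) (fun x => by
      obtain ⟨z, hz⟩ := hE.exists_mu₂_eq x
      exact ⟨δ.mkES z, hz⟩)

theorem mu₂Bar_comul (x : δ.ES) : δ.mu₂Bar (hE.comul x) = insOne A A (δ.inclES x) :=
  congrArg Subtype.val
    ((LinearEquiv.ofInjective δ.mu₂Bar hE.mu₂Bar_injective).apply_symm_apply _)

/-- The axioms quantify over all representatives of a coproduct; this criterion turns each such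
hypothesis into an equation in A ⊗ A ⊗ A. -/
theorem mk_eq_comul_iff {x : δ.ES} {z : δ.ES ⊗[ℂ] δ.ES} :
    δ.mkES z = hE.comul x ↔ δ.mu₂ z = insOne A A (δ.inclES x) := by
  rw [← hE.mu₂Bar_injective.eq_iff, mu₂Bar_comul, mu₂Bar_mk]

end IsBalancedFaithful

/-- The map `x ⊗ y ⊗ w ↦ x * y ⊗ w`. -/
def mulLeftTwo : A ⊗[ℂ] (A ⊗[ℂ] A) →ₗ[ℂ] A ⊗[ℂ] A :=
  (LinearMap.mul' ℂ A).rTensor A ∘ₗ (TensorProduct.assoc ℂ A A A).symm.toLinearMap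

/-- On pure tensors both sides are xx'y ⊗ y'. Hence s(ε(x₁))x₂ is a function of x ⊗ x'y ⊗ y' alone,
and at a ⊗ 1 ⊗ a' it gives back a ⊗ a'. -/
theorem Env.equiv_mul_inl_mul' (X : A ⊗[ℂ] A) (Y : A ⊗[ℂ] A) :
    Env.equiv (Env.inl (LinearMap.mul' ℂ A X) * Env.equiv.symm Y) =
      mulLeftTwo (star A A (X ⊗ₜ Y)) :=
  tensor_ext₄ (Env.equiv.toLinearMap ∘ₗ TensorProduct.lift ((LinearMap.mul ℂ (Env A)).compl₁₂
      (Env.inl.toLinearMap ∘ₗ LinearMap.mul' ℂ A) Env.equiv.symm.toLinearMap))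
    (mulLeftTwo ∘ₗ star A A) (fun m n m' n' => by
      have : (Env.inl (m * n) : Env A) = Env.equiv.symm ((m * n) ⊗ₜ 1) := rfl
      simp only [LinearMap.comp_apply, TensorProduct.lift.tmul, LinearMap.compl₁₂_apply,
        LinearMap.mul'_apply, AlgHom.toLinearMap_apply, this, LinearEquiv.coe_coe,
        LinearMap.mul_apply', Env.mul_tmul]
      simp [mulLeftTwo, mul_assoc]) (X ⊗ₜ Y)

/-- The map `x ⊗ y ⊗ w ↦ x ⊗ y * w`. -/
def mulRightTwo : A ⊗[ℂ] (A ⊗[ℂ] A) →ₗ[ℂ] A ⊗[ℂ] A :=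
  (LinearMap.mul' ℂ A).lTensor A

/-- The mirror image for the other counit axiom: both sides are x ⊗ x'yy'. -/
theorem Env.equiv_mul_inr_mul' (X : A ⊗[ℂ] A) (Y : A ⊗[ℂ] A) :
    Env.equiv (Env.inr (.op (LinearMap.mul' ℂ A Y)) * Env.equiv.symm X) =
      mulRightTwo (star A A (X ⊗ₜ Y)) :=
  tensor_ext₄ (Env.equiv.toLinearMap ∘ₗ TensorProduct.lift ((LinearMap.mul ℂ (Env A)).compl₁₂
      (Env.inr.toLinearMap ∘ₗ (MulOpposite.opLinearEquiv ℂ).toLinearMap ∘ₗ LinearMap.mul' ℂ A)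
      Env.equiv.symm.toLinearMap).flip)
    (mulRightTwo ∘ₗ star A A) (fun m n m' n' => by
      have : (Env.inr (.op (m' * n')) : Env A) = Env.equiv.symm (1 ⊗ₜ (m' * n')) := rfl
      simp only [LinearMap.comp_apply, TensorProduct.lift.tmul, LinearMap.compl₁₂_apply,
        LinearMap.flip_apply, LinearMap.mul'_apply, AlgHom.toLinearMap_apply, LinearEquiv.coe_coe,
        MulOpposite.coe_opLinearEquiv, this, LinearMap.mul_apply', Env.mul_tmul]
      simp [mulRightTwo, mul_assoc]) (X ⊗ₜ Y)

theorem mulLeftTwo_insOne (X : A ⊗[ℂ] A) : mulLeftTwo (insOne A A X) = X :=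
  tensor_ext (mulLeftTwo ∘ₗ insOne A A) .id (fun m n => by simp [mulLeftTwo]) X

theorem mulRightTwo_insOne (X : A ⊗[ℂ] A) : mulRightTwo (insOne A A X) = X :=
  tensor_ext (mulRightTwo ∘ₗ insOne A A) .id (fun m n => by simp [mulRightTwo]) X

theorem counitES_coe (x : δ.ES) : (δ.counitES x : A) = LinearMap.mul' ℂ A (δ.inclES x) := rfl

theorem source_counitES_mul (z : δ.ES ⊗[ℂ] δ.ES) :
    δ.inclES (LinearMap.mul' ℂ δ.ES (TensorProduct.map (δ.source.toLinearMap ∘ₗ δ.counitES)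
      LinearMap.id z)) = mulLeftTwo (δ.mu₂ z) :=
  tensor_ext (δ.inclES ∘ₗ LinearMap.mul' ℂ δ.ES ∘ₗ
      (TensorProduct.map (δ.source.toLinearMap ∘ₗ δ.counitES) LinearMap.id)) (mulLeftTwo ∘ₗ δ.mu₂)
    (fun x y => by
      simp only [LinearMap.comp_apply, TensorProduct.map_tmul, LinearMap.mul'_apply]
      have h := Env.equiv_mul_inl_mul' (δ.inclES x) (δ.inclES y)
      rw [δ.inclES_apply y, LinearEquiv.symm_apply_apply] at h
      exact h) z

theorem target_counitES_mul (z : δ.ES ⊗[ℂ] δ.ES) :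
    δ.inclES (LinearMap.mul' ℂ δ.ES (TensorProduct.comm ℂ δ.ES δ.ES
      (TensorProduct.map LinearMap.id (δ.target.toLinearMap ∘ₗ
        (MulOpposite.opLinearEquiv ℂ).toLinearMap ∘ₗ δ.counitES) z))) = mulRightTwo (δ.mu₂ z) :=
  tensor_ext (δ.inclES ∘ₗ LinearMap.mul' ℂ δ.ES ∘ₗ (TensorProduct.comm ℂ δ.ES δ.ES).toLinearMap ∘ₗ
      (TensorProduct.map LinearMap.id (δ.target.toLinearMap ∘ₗ
        (MulOpposite.opLinearEquiv ℂ).toLinearMap ∘ₗ δ.counitES))) (mulRightTwo ∘ₗ δ.mu₂)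
    (fun x y => by
      simp only [LinearMap.comp_apply, TensorProduct.map_tmul, LinearEquiv.coe_coe,
        TensorProduct.comm_tmul, LinearMap.mul'_apply]
      have h := Env.equiv_mul_inr_mul' (δ.inclES x) (δ.inclES y)
      rw [δ.inclES_apply x, LinearEquiv.symm_apply_apply] at h
      exact h) z

/-- `x ⊗ y ⊗ w ↦ x ⊗ b * y ⊗ w` -/
def midLeft (b : A) : A ⊗[ℂ] (A ⊗[ℂ] A) →ₗ[ℂ] A ⊗[ℂ] (A ⊗[ℂ] A) :=
  ((LinearMap.mulLeft ℂ b).rTensor A).lTensor A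

/-- `x ⊗ y ⊗ w ↦ x ⊗ y * b ⊗ w` -/
def midRight (b : A) : A ⊗[ℂ] (A ⊗[ℂ] A) →ₗ[ℂ] A ⊗[ℂ] (A ⊗[ℂ] A) :=
  ((LinearMap.mulRight ℂ b).rTensor A).lTensor A

/-- The Takeuchi condition in A ⊗ A ⊗ A: b1 = 1b in the middle factor. -/
theorem midLeft_insOne (b : A) (X : A ⊗[ℂ] A) :
    midLeft b (insOne A A X) = midRight b (insOne A A X) :=
  tensor_ext (midLeft b ∘ₗ insOne A A) (midRight b ∘ₗ insOne A A)
    (fun m n => by simp [midLeft, midRight]) X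

/-- A linear identity on `C ⊗_B C` can be checked on the classes of pure tensors. -/
theorem ESTensor_ext {P : Type*} [AddCommGroup P] [Module ℂ P] (f g : δ.ESTensor →ₗ[ℂ] P)
    (h : ∀ x y, f (δ.mkES (x ⊗ₜ y)) = g (δ.mkES (x ⊗ₜ y))) (w : δ.ESTensor) : f w = g w := by
  obtain ⟨z, rfl⟩ := Submodule.mkQ_surjective _ w
  exact tensor_ext (f ∘ₗ δ.mkES) (g ∘ₗ δ.mkES) h z

/-- The map `X ↦ (x ⊗ y ⊗ w ↦ x * X₁ ⊗ X₂ * y ⊗ w)`. -/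
def actFst : A ⊗[ℂ] A →ₗ[ℂ] A ⊗[ℂ] (A ⊗[ℂ] A) →ₗ[ℂ] A ⊗[ℂ] (A ⊗[ℂ] A) :=
  TensorProduct.lift ((TensorProduct.mapBilinear (.id ℂ) A (A ⊗[ℂ] A) A (A ⊗[ℂ] A)).compl₁₂
    (LinearMap.mul ℂ A).flip (LinearMap.rTensorHom A ∘ₗ LinearMap.mul ℂ A))

@[simp] theorem actFst_tmul (p p' x y w : A) :
    actFst (p ⊗ₜ p') (x ⊗ₜ (y ⊗ₜ w)) = (x * p) ⊗ₜ ((p' * y) ⊗ₜ w) := rfl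

/-- The map `X ↦ (x ⊗ y ⊗ w ↦ x ⊗ y * X₁ ⊗ X₂ * w)`. -/
def actSnd : A ⊗[ℂ] A →ₗ[ℂ] A ⊗[ℂ] (A ⊗[ℂ] A) →ₗ[ℂ] A ⊗[ℂ] (A ⊗[ℂ] A) :=
  LinearMap.lTensorHom A ∘ₗ
    TensorProduct.lift ((TensorProduct.mapBilinear (.id ℂ) A A A A).compl₁₂
      (LinearMap.mul ℂ A).flip (LinearMap.mul ℂ A))

@[simp] theorem actSnd_tmul (p p' x y w : A) :
    actSnd (p ⊗ₜ p') (x ⊗ₜ (y ⊗ₜ w)) = x ⊗ₜ ((y * p) ⊗ₜ (p' * w)) := rfl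

/-- The factor x * p is xp ⊗ p'x', so the result is obtained from x ⊗ x'y ⊗ y' by placing p right of
the first factor and p' left of the middle one. Right multiplication on either leg of C ⊗_B C is
thereby visible under `mu₂`. -/
theorem star₂_mul_left (x y p : Env A) :
    star A A (Env.equiv (x * p) ⊗ₜ Env.equiv y) =
      actFst (Env.equiv p) (star A A (Env.equiv x ⊗ₜ Env.equiv y)) := by
  induction p using Env.ind with
  | h0 => simp
  | ha u v hu hv => simp only [TensorProduct.add_tmul, mul_add, map_add, hu, hv,
      LinearMap.add_apply]
  | ht p p' =>
  induction x using Env.ind with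
  | h0 => simp
  | ha u v hu hv => simp only [TensorProduct.add_tmul, add_mul, map_add, hu, hv]
  | ht x x' =>
  induction y using Env.ind with
  | h0 => simp
  | ha u v hu hv => simp only [TensorProduct.tmul_add, map_add, hu, hv]
  | ht y y' => simp [Env.mul_tmul, mul_assoc]

theorem star₂_mul_right (x y p : Env A) :
    star A A (Env.equiv x ⊗ₜ Env.equiv (y * p)) =
      actSnd (Env.equiv p) (star A A (Env.equiv x ⊗ₜ Env.equiv y)) := by
  induction p using Env.ind with
  | h0 => simp
  | ha u v hu hv => simp only [TensorProduct.tmul_add, mul_add, map_add, hu, hv,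
      LinearMap.add_apply]
  | ht p p' =>
  induction x using Env.ind with
  | h0 => simp
  | ha u v hu hv => simp only [TensorProduct.add_tmul, map_add, hu, hv]
  | ht x x' =>
  induction y using Env.ind with
  | h0 => simp
  | ha u v hu hv => simp only [TensorProduct.tmul_add, add_mul, map_add, hu, hv]
  | ht y y' => simp [Env.mul_tmul, mul_assoc]

theorem mu₂Bar_mulFst (c : δ.ES) (w : δ.ESTensor) :
    δ.mu₂Bar (mulFst (B := δ.coinv) (L := δ.ES) δ.source δ.target c w) =
      actFst (δ.inclES c) (δ.mu₂Bar w) :=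
  δ.ESTensor_ext (δ.mu₂Bar ∘ₗ mulFst (B := δ.coinv) (L := δ.ES) δ.source δ.target c)
    (actFst (δ.inclES c) ∘ₗ δ.mu₂Bar) (fun x y => star₂_mul_left (x : Env A) y c) w

theorem mu₂Bar_mulSnd (c : δ.ES) (w : δ.ESTensor) :
    δ.mu₂Bar (mulSnd (B := δ.coinv) (L := δ.ES) δ.source δ.target c w) =
      actSnd (δ.inclES c) (δ.mu₂Bar w) :=
  δ.ESTensor_ext (δ.mu₂Bar ∘ₗ mulSnd (B := δ.coinv) (L := δ.ES) δ.source δ.target c)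
    (actSnd (δ.inclES c) ∘ₗ δ.mu₂Bar) (fun x y => star₂_mul_right (x : Env A) y c) w

theorem inclES_target (b : δ.coinv) : δ.inclES (δ.target (.op b)) = 1 ⊗ₜ (b : A) := rfl

theorem inclES_source (b : δ.coinv) : δ.inclES (δ.source b) = (b : A) ⊗ₜ 1 := rfl

theorem tensor_ext₃ {M N N' P : Type*} [AddCommGroup M] [Module ℂ M] [AddCommGroup N]
    [Module ℂ N] [AddCommGroup N'] [Module ℂ N'] [AddCommGroup P] [Module ℂ P]
    (f g : M ⊗[ℂ] (N ⊗[ℂ] N') →ₗ[ℂ] P)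
    (h : ∀ m n n', f (m ⊗ₜ (n ⊗ₜ n')) = g (m ⊗ₜ (n ⊗ₜ n'))) (z : M ⊗[ℂ] (N ⊗[ℂ] N')) :
    f z = g z :=
  tensor_ext f g (fun m => tensor_ext (f ∘ₗ TensorProduct.mk ℂ _ _ m)
    (g ∘ₗ TensorProduct.mk ℂ _ _ m) (h m)) z

theorem actFst_one_tmul (b : A) (T : A ⊗[ℂ] (A ⊗[ℂ] A)) : actFst (1 ⊗ₜ b) T = midLeft b T :=
  tensor_ext₃ _ _ (fun _ _ _ => by simp [midLeft]) T

theorem actSnd_tmul_one (b : A) (T : A ⊗[ℂ] (A ⊗[ℂ] A)) : actSnd (b ⊗ₜ 1) T = midRight b T :=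
  tensor_ext₃ _ _ (fun _ _ _ => by simp [midRight]) T

theorem mu₃Bar_joinLeft (x : δ.ES) (w : δ.ESTensor) :
    δ.mu₃Bar (joinLeft (B := δ.coinv) (L := δ.ES) δ.source δ.target (x ⊗ₜ w)) =
      star A (A ⊗[ℂ] A) (δ.inclES x ⊗ₜ δ.mu₂Bar w) := by
  obtain ⟨z, rfl⟩ := Submodule.mkQ_surjective _ w
  rfl

/-- The two inner multiplications in X ⊗ Y ⊗ Z involve disjoint factors and can be done in either
order; so `mu₃` can be evaluated from either bracketing of a threefold product. -/
theorem star_assoc {W : Type*} [AddCommGroup W] [Module ℂ W] (X Y : A ⊗[ℂ] A) (Z : A ⊗[ℂ] W) :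
    star A (A ⊗[ℂ] W) (X ⊗ₜ star A W (Y ⊗ₜ Z)) =
      (star A W).lTensor A (TensorProduct.assoc ℂ A (A ⊗[ℂ] A) (A ⊗[ℂ] W)
        (star A A (X ⊗ₜ Y) ⊗ₜ Z)) := by
  induction X using TensorProduct.induction_on with
  | zero => simp
  | add u v hu hv => simp only [TensorProduct.add_tmul, map_add, hu, hv]
  | tmul x x' =>
  exact tensor_ext₄ (star A (A ⊗[ℂ] W) ∘ₗ TensorProduct.mk ℂ _ _ (x ⊗ₜ x') ∘ₗ star A W)
    ((star A W).lTensor A ∘ₗ (TensorProduct.assoc ℂ A (A ⊗[ℂ] A) (A ⊗[ℂ] W)).toLinearMap ∘ₗ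
      (star A A ∘ₗ TensorProduct.mk ℂ _ _ (x ⊗ₜ x')).rTensor _)
    (fun y y' w w' => by simp) (Y ⊗ₜ Z)

theorem mu₃Bar_joinRight (w : δ.ESTensor) (x : δ.ES) :
    δ.mu₃Bar (joinRight (B := δ.coinv) (L := δ.ES) δ.source δ.target (w ⊗ₜ x)) =
      (star A A).lTensor A (TensorProduct.assoc ℂ A (A ⊗[ℂ] A) (A ⊗[ℂ] A)
        (δ.mu₂Bar w ⊗ₜ δ.inclES x)) :=
  δ.ESTensor_ext (δ.mu₃Bar ∘ₗ joinRight (B := δ.coinv) (L := δ.ES) δ.source δ.target ∘ₗ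
      (TensorProduct.mk ℂ _ _).flip x)
    ((star A A).lTensor A ∘ₗ (TensorProduct.assoc ℂ A (A ⊗[ℂ] A) (A ⊗[ℂ] A)).toLinearMap ∘ₗ
      (TensorProduct.mk ℂ _ _).flip (δ.inclES x) ∘ₗ δ.mu₂Bar)
    (fun _ _ => star_assoc _ _ _) w

theorem star_insOne (X Y : A ⊗[ℂ] A) :
    star A (A ⊗[ℂ] A) (X ⊗ₜ insOne A A Y) = (insOne A A).lTensor A (star A A (X ⊗ₜ Y)) :=
  tensor_ext₄ (star A (A ⊗[ℂ] A) ∘ₗ (insOne A A).lTensor _) ((insOne A A).lTensor A ∘ₗ star A A)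
    (fun x x' y y' => by simp) (X ⊗ₜ Y)

theorem star_insOne_left (X Y : A ⊗[ℂ] A) :
    (star A A).lTensor A (TensorProduct.assoc ℂ A (A ⊗[ℂ] A) (A ⊗[ℂ] A) (insOne A A X ⊗ₜ Y)) =
      insOne A (A ⊗[ℂ] A) (star A A (X ⊗ₜ Y)) :=
  tensor_ext₄ ((star A A).lTensor A ∘ₗ
      (TensorProduct.assoc ℂ A (A ⊗[ℂ] A) (A ⊗[ℂ] A)).toLinearMap ∘ₗ (insOne A A).rTensor _)
    (insOne A (A ⊗[ℂ] A) ∘ₗ star A A) (fun x x' y y' => by simp) (X ⊗ₜ Y)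

theorem insOne_insOne (X : A ⊗[ℂ] A) :
    insOne A (A ⊗[ℂ] A) (insOne A A X) = (insOne A A).lTensor A (insOne A A X) :=
  tensor_ext (insOne A (A ⊗[ℂ] A) ∘ₗ insOne A A) ((insOne A A).lTensor A ∘ₗ insOne A A)
    (fun x y => by simp) X

theorem counitES_eq_of_mul' {x y : δ.ES}
    (h : LinearMap.mul' ℂ A (δ.inclES x) = LinearMap.mul' ℂ A (δ.inclES y)) :
    δ.counitES x = δ.counitES y := Subtype.ext h

/-- For x ⊗ x' and y ⊗ y' all three expressions equal xyy'x'. -/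
theorem mul'_equiv_mul (x y : Env A) :
    LinearMap.mul' ℂ A (Env.equiv (x * y)) =
      LinearMap.mul' ℂ A (Env.equiv (x * Env.inl (LinearMap.mul' ℂ A (Env.equiv y)))) ∧
    LinearMap.mul' ℂ A (Env.equiv (x * y)) =
      LinearMap.mul' ℂ A (Env.equiv (x * Env.inr (.op (LinearMap.mul' ℂ A (Env.equiv y))))) := by
  have hl : ∀ a : A, (Env.inl a : Env A) = Env.equiv.symm (a ⊗ₜ 1) := fun _ => rfl
  have hr : ∀ a : A, (Env.inr (.op a) : Env A) = Env.equiv.symm (1 ⊗ₜ a) := fun _ => rfl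
  induction x using Env.ind with
  | h0 => simp
  | ha u v hu hv => simp only [add_mul, map_add, ← hu.1, ← hu.2, ← hv.1, ← hv.2, and_self]
  | ht x x' =>
  induction y using Env.ind with
  | h0 => simp
  | ha u v hu hv =>
    simp only [mul_add, map_add, MulOpposite.op_add, ← hu.1, ← hu.2, ← hv.1, ← hv.2, and_self]
  | ht y y' => simp [hl, hr, Env.mul_tmul, mul_assoc]

theorem isLeftBialgebroid (hE : δ.IsBalancedFaithful) :
    IsLeftBialgebroid (B := δ.coinv) (L := δ.ES) δ.source δ.target hE.comul δ.counitES where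
  commute b b' := Subtype.ext <| by
    have h1 : ((δ.source b : δ.ES) : Env A) = Env.equiv.symm ((b : A) ⊗ₜ 1) := rfl
    have h2 : ((δ.target b' : δ.ES) : Env A) = Env.equiv.symm (1 ⊗ₜ (b'.unop : A)) := rfl
    rw [MulMemClass.coe_mul, MulMemClass.coe_mul, h1, h2, Env.mul_tmul, Env.mul_tmul]
    simp
  comul_source b x z hz := by
    rw [hE.mk_eq_comul_iff] at hz
    symm
    rw [hE.mk_eq_comul_iff, mu₂_source_mul, hz, inclES_source_mul]
    exact tensor_ext ((LinearMap.mulLeft ℂ (b : A)).rTensor _ ∘ₗ insOne A A)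
      (insOne A A ∘ₗ (LinearMap.mulLeft ℂ (b : A)).rTensor _) (fun _ _ => by simp) _
  comul_target b x z hz := by
    obtain ⟨b, rfl⟩ := MulOpposite.op_surjective b
    rw [hE.mk_eq_comul_iff] at hz
    symm
    rw [hE.mk_eq_comul_iff, mu₂_target_mul, hz, inclES_target_mul]
    exact tensor_ext (((LinearMap.mulRight ℂ (b : A)).lTensor A).lTensor A ∘ₗ insOne A A)
      (insOne A A ∘ₗ (LinearMap.mulRight ℂ (b : A)).lTensor _) (fun _ _ => by simp) _
  coassoc x z hz := by
    rw [hE.mk_eq_comul_iff] at hz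
    apply hE.mu₃Bar_injective
    have h1 : δ.mu₃Bar (joinRight (B := δ.coinv) (L := δ.ES) δ.source δ.target
        (TensorProduct.map hE.comul LinearMap.id z)) = insOne A (A ⊗[ℂ] A) (δ.mu₂ z) :=
      tensor_ext (δ.mu₃Bar ∘ₗ joinRight (B := δ.coinv) (L := δ.ES) δ.source δ.target ∘ₗ
          TensorProduct.map hE.comul LinearMap.id) (insOne A (A ⊗[ℂ] A) ∘ₗ δ.mu₂)
        (fun x y => by
          simp only [LinearMap.comp_apply, TensorProduct.map_tmul, LinearMap.id_apply]
          rw [mu₃Bar_joinRight, hE.mu₂Bar_comul, star_insOne_left, mu₂_tmul]) z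
    have h2 : δ.mu₃Bar (joinLeft (B := δ.coinv) (L := δ.ES) δ.source δ.target
        (TensorProduct.map LinearMap.id hE.comul z)) = (insOne A A).lTensor A (δ.mu₂ z) :=
      tensor_ext (δ.mu₃Bar ∘ₗ joinLeft (B := δ.coinv) (L := δ.ES) δ.source δ.target ∘ₗ
          TensorProduct.map LinearMap.id hE.comul) ((insOne A A).lTensor A ∘ₗ δ.mu₂)
        (fun x y => by
          simp only [LinearMap.comp_apply, TensorProduct.map_tmul, LinearMap.id_apply]
          rw [mu₃Bar_joinLeft, hE.mu₂Bar_comul, star_insOne, mu₂_tmul]) z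
    -- Both iterated coproducts become a ⊗ 1 ⊗ 1 ⊗ a'.
    rw [h1, h2, hz, insOne_insOne]
  counit_source b x := Subtype.ext <| by
    simp only [counitES_coe, inclES_source_mul, MulMemClass.coe_mul]
    exact tensor_ext (LinearMap.mul' ℂ A ∘ₗ (LinearMap.mulLeft ℂ (b : A)).rTensor A)
      (LinearMap.mulLeft ℂ (b : A) ∘ₗ LinearMap.mul' ℂ A) (fun _ _ => by simp [mul_assoc]) _
  counit_target b x := Subtype.ext <| by
    simp only [counitES_coe, inclES_target_mul, MulMemClass.coe_mul]
    exact tensor_ext (LinearMap.mul' ℂ A ∘ₗ (LinearMap.mulRight ℂ (b : A)).lTensor A)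
      (LinearMap.mulRight ℂ (b : A) ∘ₗ LinearMap.mul' ℂ A) (fun _ _ => by simp [mul_assoc]) _
  counit_left x z hz := by
    rw [hE.mk_eq_comul_iff] at hz
    exact δ.inclES_injective (by rw [source_counitES_mul, hz, mulLeftTwo_insOne])
  counit_right x z hz := by
    rw [hE.mk_eq_comul_iff] at hz
    exact δ.inclES_injective (by rw [target_counitES_mul, hz, mulRightTwo_insOne])
  takeuchi x b := hE.mu₂Bar_injective <| by
    rw [mu₂Bar_mulFst, mu₂Bar_mulSnd, hE.mu₂Bar_comul, inclES_target, inclES_source,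
      actFst_one_tmul, actSnd_tmul_one, midLeft_insOne]
  comul_one := by
    symm
    rw [hE.mk_eq_comul_iff]
    simp [inclES_one]
  comul_mul x y z w hz hw := by
    rw [hE.mk_eq_comul_iff] at hz hw
    symm
    rw [hE.mk_eq_comul_iff]
    rw [mu₂_eq_star₂] at hz hw ⊢
    rw [map_mul, Env.star₂_mul, hz]
    exact Env.star₂_sec_insOne_mul hw
  counit_one := Subtype.ext (by simp [counitES_coe, inclES_one])
  counit_mul_source x y := δ.counitES_eq_of_mul' (mul'_equiv_mul (x : Env A) y).1.symm
  counit_mul_target x y := δ.counitES_eq_of_mul' (mul'_equiv_mul (x : Env A) y).2.symm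

end ComoduleAlgebra

/-! ### The flip as an invertible antipode -/

namespace ComoduleAlgebra

variable {H A : Type*} [Ring H] [HopfAlgebra ℂ H] [Ring A] [Algebra ℂ A] (δ : ComoduleAlgebra H A)

/-- The map `x ⊗ y ⊗ w ↦ w ⊗ x ⊗ y`. -/
def rotate : A ⊗[ℂ] (A ⊗[ℂ] A) →ₗ[ℂ] A ⊗[ℂ] (A ⊗[ℂ] A) :=
  (TensorProduct.comm ℂ (A ⊗[ℂ] A) A).toLinearMap ∘ₗ (TensorProduct.assoc ℂ A A A).symm.toLinearMap

/-- The map `x ⊗ y ⊗ w ↦ y ⊗ w ⊗ x`. -/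
def rotate' : A ⊗[ℂ] (A ⊗[ℂ] A) →ₗ[ℂ] A ⊗[ℂ] (A ⊗[ℂ] A) :=
  (TensorProduct.assoc ℂ A A A).toLinearMap ∘ₗ (TensorProduct.comm ℂ A (A ⊗[ℂ] A)).toLinearMap

section Flip

variable {δ} (hF : ∀ x : δ.ES, δ.diag (TensorProduct.comm ℂ A A (δ.inclES x)) =
  TensorProduct.comm ℂ A A (δ.inclES x) ⊗ₜ 1)

/-- The flip of the Ehresmann--Schauenburg algebra. -/
def flipMap : δ.ES →ₗ[ℂ] δ.ES :=
  (Env.equiv.symm.toLinearMap ∘ₗ (TensorProduct.comm ℂ A A).toLinearMap ∘ₗ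
    δ.inclES).codRestrict (Subalgebra.toSubmodule δ.ES) (fun x => by
      have h := hF x
      rw [Subalgebra.mem_toSubmodule, mem_ES]
      simpa using h)

theorem inclES_flipMap (x : δ.ES) :
    δ.inclES (flipMap hF x) = TensorProduct.comm ℂ A A (δ.inclES x) := by
  change Env.equiv (Env.equiv.symm _) = _
  rw [LinearEquiv.apply_symm_apply]
  rfl

/-- The flip as a linear automorphism. -/
def flipES : δ.ES ≃ₗ[ℂ] δ.ES :=
  LinearEquiv.ofInvolutive (flipMap hF) fun x => δ.inclES_injective <| by
    rw [inclES_flipMap, inclES_flipMap]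
    exact (TensorProduct.comm ℂ A A).symm_apply_apply _

theorem inclES_flipES (x : δ.ES) :
    δ.inclES (flipES hF x) = TensorProduct.comm ℂ A A (δ.inclES x) := inclES_flipMap hF x

theorem flipES_symm : (flipES hF).symm = flipES hF := rfl

theorem Env.comm_equiv_mul (x y : Env A) :
    TensorProduct.comm ℂ A A (Env.equiv (x * y)) =
      Env.equiv (Env.equiv.symm (TensorProduct.comm ℂ A A (Env.equiv y)) *
        Env.equiv.symm (TensorProduct.comm ℂ A A (Env.equiv x))) := by
  induction x using Env.ind with
  | h0 => simp
  | ha u v hu hv => simp only [add_mul, mul_add, map_add, hu, hv]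
  | ht x x' =>
  induction y using Env.ind with
  | h0 => simp
  | ha u v hu hv => simp only [add_mul, mul_add, map_add, hu, hv]
  | ht y y' => simp [Env.mul_tmul]

theorem coe_eq_symm_inclES (x : δ.ES) : (x : Env A) = Env.equiv.symm (δ.inclES x) := by
  simp [inclES_apply]

/-- Stability of C under the flip is kept as a hypothesis `hF` instead of being deduced from
commutativity of H, because the result is also applied to H_Θ, which may be noncommutative. -/
theorem flip_isInvertibleAntipode (hE : δ.IsBalancedFaithful) :
    IsInvertibleAntipode (B := δ.coinv) (L := δ.ES) δ.source δ.target hE.comul (flipES hF) where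
  map_one := δ.inclES_injective (by simp [inclES_flipES, inclES_one])
  map_mul x y := δ.inclES_injective <| by
    rw [inclES_flipES, inclES_apply, inclES_apply, MulMemClass.coe_mul, MulMemClass.coe_mul,
      Env.comm_equiv_mul, coe_eq_symm_inclES (flipES hF y), coe_eq_symm_inclES (flipES hF x),
      inclES_flipES, inclES_flipES]
    rfl
  target b := δ.inclES_injective (by
    rw [inclES_flipES, inclES_target, inclES_source, TensorProduct.comm_tmul])
  comul_symm h z hz := hE.mu₂Bar_injective <| by
    rw [hE.mk_eq_comul_iff] at hz
    rw [flipES_symm, mu₂Bar_mk, mu₂_tmul, inclES_flipES, inclES_one]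
    -- For x ⊗ x' and y ⊗ y' the flipped second factor has coproduct y' ⊗ 1 ⊗ y, and right
    -- multiplication by the first one on its second leg gives y' ⊗ x ⊗ x'y: a rotation of x ⊗ x'y ⊗
    -- y'.
    have h1 : δ.mu₂Bar (TensorProduct.lift
        ((mulSnd (B := δ.coinv) (L := δ.ES) δ.source δ.target).compl₂
          (hE.comul ∘ₗ (flipES hF).toLinearMap)) z) = rotate (δ.mu₂ z) :=
      tensor_ext (δ.mu₂Bar ∘ₗ TensorProduct.lift
        ((mulSnd (B := δ.coinv) (L := δ.ES) δ.source δ.target).compl₂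
          (hE.comul ∘ₗ (flipES hF).toLinearMap))) (rotate ∘ₗ δ.mu₂) (fun x y => by
          simp only [LinearMap.comp_apply, TensorProduct.lift.tmul, LinearMap.compl₂_apply,
            LinearEquiv.coe_coe]
          rw [mu₂Bar_mulSnd, hE.mu₂Bar_comul, inclES_flipES, mu₂_tmul]
          exact tensor_ext₄ (TensorProduct.lift ((actSnd (A := A)).compl₂
              (insOne A A ∘ₗ (TensorProduct.comm ℂ A A).toLinearMap))) (rotate ∘ₗ star A A)
            (fun x x' y y' => by simp [rotate]) (δ.inclES x ⊗ₜ δ.inclES y)) z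
    rw [h1, hz]
    exact tensor_ext (rotate ∘ₗ insOne A A) (star A A ∘ₗ
      (TensorProduct.mk ℂ _ _).flip (1 ⊗ₜ 1) ∘ₗ (TensorProduct.comm ℂ A A).toLinearMap)
      (fun x y => by simp [rotate]) (δ.inclES h)
  comul h z hz := hE.mu₂Bar_injective <| by
    rw [hE.mk_eq_comul_iff] at hz
    rw [mu₂Bar_mk, mu₂_tmul, inclES_flipES, inclES_one]
    -- Here x' ⊗ 1 ⊗ x is multiplied on its first leg by y ⊗ y', which gives x'y ⊗ y' ⊗ x, the
    -- opposite rotation.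
    have h1 : δ.mu₂Bar (TensorProduct.lift
        ((mulFst (B := δ.coinv) (L := δ.ES) δ.source δ.target).flip ∘ₗ hE.comul ∘ₗ
          (flipES hF).toLinearMap) z) = rotate' (δ.mu₂ z) :=
      tensor_ext (δ.mu₂Bar ∘ₗ TensorProduct.lift
        ((mulFst (B := δ.coinv) (L := δ.ES) δ.source δ.target).flip ∘ₗ hE.comul ∘ₗ
          (flipES hF).toLinearMap)) (rotate' ∘ₗ δ.mu₂) (fun x y => by
          simp only [LinearMap.comp_apply, TensorProduct.lift.tmul, LinearMap.flip_apply,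
            LinearEquiv.coe_coe]
          rw [mu₂Bar_mulFst, hE.mu₂Bar_comul, inclES_flipES, mu₂_tmul]
          exact tensor_ext₄ (TensorProduct.lift ((actFst (A := A)).flip ∘ₗ
              (insOne A A ∘ₗ (TensorProduct.comm ℂ A A).toLinearMap))) (rotate' ∘ₗ star A A)
            (fun x x' y y' => by simp [rotate']) (δ.inclES x ⊗ₜ δ.inclES y)) z
    rw [h1, hz]
    exact tensor_ext (rotate' ∘ₗ insOne A A) (star A A ∘ₗ
      TensorProduct.mk ℂ _ _ (1 ⊗ₜ 1) ∘ₗ (TensorProduct.comm ℂ A A).toLinearMap)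
      (fun x y => by simp [rotate']) (δ.inclES h)

end Flip

/-! ### Comparison with the embedding in `A ⊗ (A ⊗_B A) ⊗ A` -/

/-- The multiplication `A ⊗_B A → A`. -/
def mulAA : δ.AA →ₗ[ℂ] A :=
  Submodule.liftQ _ (LinearMap.mul' ℂ A) (balancedRel_le _ fun b m n => by simp [mul_assoc])

/-- The map `x ⊗ w ⊗ y ↦ x ⊗ mulAA w ⊗ y`. -/
def mulMid : (A ⊗[ℂ] δ.AA) ⊗[ℂ] A →ₗ[ℂ] A ⊗[ℂ] (A ⊗[ℂ] A) :=
  (TensorProduct.assoc ℂ A A A).toLinearMap ∘ₗ (δ.mulAA.lTensor A).rTensor A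

/-- Since `mu₂Bar` factors through `embed`, its injectivity implies that of `embed`. -/
theorem mulMid_embed (w : δ.ESTensor) : δ.mulMid (δ.embed w) = δ.mu₂Bar w :=
  δ.ESTensor_ext (δ.mulMid ∘ₗ δ.embed) δ.mu₂Bar (fun x y =>
    tensor_ext₄ (δ.mulMid ∘ₗ δ.join) (star A A)
      (fun x x' y y' => by
        simp [join, mulMid]
        rfl) (δ.inclES x ⊗ₜ δ.inclES y)) w

theorem embed_injective (hE : δ.IsBalancedFaithful) : Function.Injective δ.embed := by
  intro x y h
  apply hE.mu₂Bar_injective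
  rw [← mulMid_embed, ← mulMid_embed, h]

/-- The map `(a ⊗ h) ⊗ u ↦ a ⊗ (1 ⊗ h) * u`. -/
def mulCoact : (A ⊗[ℂ] H) ⊗[ℂ] (A ⊗[ℂ] H) →ₗ[ℂ] A ⊗[ℂ] (A ⊗[ℂ] H) :=
  (TensorProduct.lift ((LinearMap.mul ℂ (A ⊗[ℂ] H)) ∘ₗ
    (TensorProduct.mk ℂ A H 1))).lTensor A ∘ₗ (TensorProduct.assoc ℂ A H (A ⊗[ℂ] H)).toLinearMap

theorem mulCoact_tmul (a : A) (h : H) (u : A ⊗[ℂ] H) :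
    mulCoact ((a ⊗ₜ h) ⊗ₜ u) = a ⊗ₜ ((1 ⊗ₜ h) * u) := by
  simp [mulCoact]

theorem mulCoact_mul (v u w : A ⊗[ℂ] H) :
    mulCoact (v ⊗ₜ (u * w)) = (LinearMap.mulRight ℂ w).lTensor A (mulCoact (v ⊗ₜ u)) := by
  induction v using TensorProduct.induction_on with
  | zero => simp
  | add u v hu hv => simp only [TensorProduct.add_tmul, map_add, hu, hv]
  | tmul a h => simp [mulCoact_tmul, mul_assoc]

theorem assoc_diag (a b : A) :
    TensorProduct.assoc ℂ A A H (δ.diag (a ⊗ₜ b)) = mulCoact (δ.coact a ⊗ₜ δ.coact b) := by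
  simp only [diag, LinearMap.comp_apply, TensorProduct.map_tmul, AlgHom.toLinearMap_apply]
  exact tensor_ext₄ ((TensorProduct.assoc ℂ A A H).toLinearMap ∘ₗ
    (LinearMap.mul' ℂ H).lTensor (A ⊗[ℂ] A) ∘ₗ
    (TensorProduct.tensorTensorTensorComm ℂ A H A H).toLinearMap) mulCoact
    (fun a h b k => by simp [mulCoact_tmul]) _

theorem assoc_diag_mulRight (X : A ⊗[ℂ] A) (c : A) :
    TensorProduct.assoc ℂ A A H (δ.diag ((LinearMap.mulRight ℂ c).lTensor A X)) =
      (LinearMap.mulRight ℂ (δ.coact c)).lTensor A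
        (TensorProduct.assoc ℂ A A H (δ.diag X)) := by
  induction X using TensorProduct.induction_on with
  | zero => simp
  | add u v hu hv => simp only [map_add, hu, hv]
  | tmul a b =>
    rw [LinearMap.lTensor_tmul, LinearMap.mulRight_apply, assoc_diag, assoc_diag,
      map_mul δ.coact b c, mulCoact_mul]

/-- The map `a ⊗ b ⊗ c ↦ (a₀ ⊗ (b₀ ⊗ a₁ * b₁)) ⊗ c`. -/
def diagLeft : A ⊗[ℂ] (A ⊗[ℂ] A) →ₗ[ℂ] (A ⊗[ℂ] (A ⊗[ℂ] H)) ⊗[ℂ] A :=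
  ((TensorProduct.assoc ℂ A A H).toLinearMap ∘ₗ δ.diag).rTensor A ∘ₗ
    (TensorProduct.assoc ℂ A A A).symm.toLinearMap

theorem galois_mkAA (a b : A) : δ.galois (δ.mkAA (a ⊗ₜ b)) = (a ⊗ₜ 1) * δ.coact b := rfl

/-- Applying χ in the middle of x ⊗ (x' ⊗_B y) ⊗ y' gives x ⊗ (x'y₀ ⊗ y₁) ⊗ y'. As x ⊗ x' is
coinvariant, this equals x₀ ⊗ (x'₀y₀ ⊗ x₁x'₁y₁) ⊗ y', an expression in x ⊗ x'y ⊗ y'. -/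
theorem galois_join (x : δ.ES) (Y : A ⊗[ℂ] A) :
    (δ.galois.lTensor A).rTensor A (δ.join (δ.inclES x ⊗ₜ Y)) =
      δ.diagLeft (star A A (δ.inclES x ⊗ₜ Y)) := by
  induction Y using TensorProduct.induction_on with
  | zero => simp
  | add u v hu hv => simp only [TensorProduct.tmul_add, map_add, hu, hv]
  | tmul c c' =>
    have h1 : ∀ X : A ⊗[ℂ] A, δ.diagLeft (star A A (X ⊗ₜ (c ⊗ₜ c'))) =
        (TensorProduct.assoc ℂ A A H (δ.diag ((LinearMap.mulRight ℂ c).lTensor A X))) ⊗ₜ c' := by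
      intro X
      induction X using TensorProduct.induction_on with
      | zero => simp
      | add u v hu hv => simp only [TensorProduct.add_tmul, map_add, hu, hv]
      | tmul x x' => simp [diagLeft]
    rw [h1, assoc_diag_mulRight, diag_inclES]
    generalize δ.inclES x = X
    clear h1
    induction X using TensorProduct.induction_on with
    | zero => simp
    | add u v hu hv => simp only [TensorProduct.add_tmul, map_add, hu, hv]
    | tmul x x' =>
      simp [join]
      rfl

theorem galois_embed (w : δ.ESTensor) :
    (δ.galois.lTensor A).rTensor A (δ.embed w) = δ.diagLeft (δ.mu₂Bar w) := by
  obtain ⟨z, rfl⟩ := Submodule.mkQ_surjective _ w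
  induction z using TensorProduct.induction_on with
  | zero => simp
  | add u v hu hv => simp only [map_add, hu, hv]
  | tmul x y => exact δ.galois_join x (δ.inclES y)

/-- Because χ(τ(h)) = 1 ⊗ h, the required coproduct becomes a₀ ⊗ (1 ⊗ a₁) ⊗ b, which is the diagonal
coaction on the first two factors of a ⊗ 1 ⊗ b. -/
theorem galois_coprod (hG : δ.IsHopfGalois) (X : A ⊗[ℂ] A) :
    (δ.galois.lTensor A).rTensor A (δ.coprod hG X) = δ.diagLeft (insOne A A X) := by
  induction X using TensorProduct.induction_on with
  | zero => simp
  | add u v hu hv => simp only [map_add, hu, hv]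
  | tmul a b =>
    have h1 : ∀ h : H, δ.galois (δ.translation hG h) = 1 ⊗ₜ h := fun h =>
      (LinearEquiv.ofBijective δ.galois hG).apply_symm_apply _
    have h2 : TensorProduct.assoc ℂ A A H (δ.diag (a ⊗ₜ 1)) =
        (δ.galois.lTensor A) ((δ.translation hG).lTensor A (δ.coact a)) := by
      rw [assoc_diag, map_one δ.coact]
      exact tensor_ext (mulCoact ∘ₗ (TensorProduct.mk ℂ _ _).flip 1)
        (δ.galois.lTensor A ∘ₗ (δ.translation hG).lTensor A)
        (fun a h => by simp [mulCoact_tmul, h1]) _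
    simp [coprod, diagLeft, h2]

theorem isFlipHopfAlgebroid (hG : δ.IsHopfGalois) (hE : δ.IsBalancedFaithful)
    (hF : ∀ x : δ.ES, δ.diag (TensorProduct.comm ℂ A A (δ.inclES x)) =
      TensorProduct.comm ℂ A A (δ.inclES x) ⊗ₜ 1) :
    δ.IsFlipHopfAlgebroid hG hE.comul (flipES hF) where
  embed_injective := δ.embed_injective hE
  comul_eq x := by
    -- Tensoring over the field ℂ keeps χ injective, so the formula for Δ may be checked after χ is
    -- applied in the middle.
    have hinj : Function.Injective ((δ.galois.lTensor A).rTensor A) :=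
      Module.Flat.rTensor_preserves_injective_linearMap _
        (Module.Flat.lTensor_preserves_injective_linearMap _ hG.1)
    apply hinj
    rw [galois_embed, hE.mu₂Bar_comul, galois_coprod]
    rfl
  bialgebroid := δ.isLeftBialgebroid hE
  antipode_eq := inclES_flipES hF
  symm_eq := rfl
  antipode := flip_isInvertibleAntipode hF hE

end ComoduleAlgebra

/-! ## Comodules -/

section Hopf

open WithConv LinearMap in
/-- `(1 ⊗ h₁) * Δ (S h₂) = S h ⊗ 1` -/
theorem mul_comul_antipode {H : Type*} [Ring H] [HopfAlgebra ℂ H] (h : H) :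
    LinearMap.mul' ℂ (H ⊗[ℂ] H) (TensorProduct.map (TensorProduct.mk ℂ H H 1)
      (Coalgebra.comul ∘ₗ HopfAlgebra.antipode ℂ) (Coalgebra.comul h)) =
      HopfAlgebra.antipode ℂ h ⊗ₜ 1 := by
  let i₁ : H →ₗ[ℂ] H ⊗[ℂ] H := (Algebra.TensorProduct.includeLeft : H →ₐ[ℂ] H ⊗[ℂ] H).toLinearMap
  let i₂ : H →ₗ[ℂ] H ⊗[ℂ] H := (Algebra.TensorProduct.includeRight : H →ₐ[ℂ] H ⊗[ℂ] H).toLinearMap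
  -- In the convolution algebra of maps H → H ⊗ H one has i₁ * i₂ = Δ, with i₁ ∘ S a left inverse of
  -- i₁ and Δ ∘ S a right inverse of Δ. Hence i₂ = (i₁ ∘ S) * Δ and i₂ * (Δ ∘ S) = i₁ ∘ S, without
  -- any formula for Δ(S h).
  have h0 : toConv (i₁ ∘ₗ HopfAlgebra.antipode ℂ) * toConv i₁ = 1 := by
    have e := algHom_comp_convMul_distrib (R := ℂ) (Algebra.TensorProduct.includeLeft :
      H →ₐ[ℂ] H ⊗[ℂ] H) (toConv (HopfAlgebra.antipode ℂ)) (toConv (LinearMap.id : H →ₗ[ℂ] H))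
    rw [antipode_mul_id] at e
    refine WithConv.ext (e.symm.trans ?_)
    ext x
    simp [Algebra.TensorProduct.one_def, Algebra.algebraMap_eq_smul_one,
      TensorProduct.smul_tmul']
  have h1 : toConv i₁ * toConv i₂ = toConv (Coalgebra.comul : H →ₗ[ℂ] H ⊗[ℂ] H) := by
    ext x
    rw [LinearMap.convMul_apply]
    exact tensor_ext (LinearMap.mul' ℂ (H ⊗[ℂ] H) ∘ₗ TensorProduct.map i₁ i₂) .id
      (fun a b => by simp [i₁, i₂]) _
  have h2 : toConv i₂ = toConv (i₁ ∘ₗ HopfAlgebra.antipode ℂ) *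
      toConv (Coalgebra.comul : H →ₗ[ℂ] H ⊗[ℂ] H) := by
    rw [← h1, ← mul_assoc, h0, one_mul]
  have h3 : toConv i₂ * toConv (Coalgebra.comul ∘ₗ HopfAlgebra.antipode ℂ (A := H)) =
      toConv (i₁ ∘ₗ HopfAlgebra.antipode ℂ) := by
    rw [h2, mul_assoc, comul_right_inv, mul_one]
  have h4 := congrArg (fun f => f.ofConv h) h3
  simp only [LinearMap.convMul_apply] at h4
  exact h4

end Hopf

/-- The map `(v ⊗ h) ⊗ (w ⊗ k) ↦ (v ⊗ w) ⊗ h * k`. -/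
def mulTensor (V W K : Type*) [AddCommGroup V] [Module ℂ V] [AddCommGroup W] [Module ℂ W] [Ring K]
    [Algebra ℂ K] : (V ⊗[ℂ] K) ⊗[ℂ] (W ⊗[ℂ] K) →ₗ[ℂ] (V ⊗[ℂ] W) ⊗[ℂ] K :=
  (LinearMap.mul' ℂ K).lTensor (V ⊗[ℂ] W) ∘ₗ
    (TensorProduct.tensorTensorTensorComm ℂ V K W K).toLinearMap

@[simp] theorem mulTensor_tmul {V W K : Type*} [AddCommGroup V] [Module ℂ V] [AddCommGroup W]
    [Module ℂ W] [Ring K] [Algebra ℂ K] (v : V) (w : W) (h k : K) :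
    mulTensor V W K ((v ⊗ₜ h) ⊗ₜ (w ⊗ₜ k)) = (v ⊗ₜ w) ⊗ₜ (h * k) := by
  simp [mulTensor]

/-- A right comodule `V` over `H`, with coaction `v ↦ v₀ ⊗ v₁`. -/
structure Coaction (H V : Type*) [Ring H] [HopfAlgebra ℂ H] [AddCommGroup V] [Module ℂ V] where
  /-- the coaction -/
  coact : V →ₗ[ℂ] V ⊗[ℂ] H
  coassoc : ∀ v, TensorProduct.assoc ℂ V H H (coact.rTensor H (coact v)) =
    (Coalgebra.comul (R := ℂ) (A := H)).lTensor V (coact v)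
  counit : ∀ v, TensorProduct.rid ℂ V
    ((Coalgebra.counit (R := ℂ) (A := H)).lTensor V (coact v)) = v

namespace Coaction

variable {H V W : Type*} [Ring H] [HopfAlgebra ℂ H] [AddCommGroup V] [Module ℂ V]
  [AddCommGroup W] [Module ℂ W]

theorem coassoc_symm (ρ : Coaction H V) (v : V) : ρ.coact.rTensor H (ρ.coact v) =
    (TensorProduct.assoc ℂ V H H).symm
      ((Coalgebra.comul (R := ℂ) (A := H)).lTensor V (ρ.coact v)) := by
  rw [LinearEquiv.eq_symm_apply, ρ.coassoc]

/-- The codiagonal coaction on `V ⊗ W`, as a linear map. -/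
def tensorCoact (ρ : Coaction H V) (σ : Coaction H W) : V ⊗[ℂ] W →ₗ[ℂ] (V ⊗[ℂ] W) ⊗[ℂ] H :=
  mulTensor V W H ∘ₗ TensorProduct.map ρ.coact σ.coact

theorem tensorCoact_tmul (ρ : Coaction H V) (σ : Coaction H W) (v : V) (w : W) :
    ρ.tensorCoact σ (v ⊗ₜ w) = mulTensor V W H (ρ.coact v ⊗ₜ σ.coact w) := rfl

/-- The codiagonal coaction on `V ⊗ W`. -/
def tensor (ρ : Coaction H V) (σ : Coaction H W) : Coaction H (V ⊗[ℂ] W) where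
  coact := ρ.tensorCoact σ
  coassoc x := by
    induction x using TensorProduct.induction_on with
    | zero => simp
    | add u v hu hv => simp only [map_add, hu, hv]
    | tmul v w =>
    have h0 : ∀ (s : V ⊗[ℂ] H) (t : W ⊗[ℂ] H) (h k : H),
        TensorProduct.assoc ℂ (V ⊗[ℂ] W) H H (mulTensor V W H (s ⊗ₜ t) ⊗ₜ (h * k)) =
        mulTensor V W (H ⊗[ℂ] H) (TensorProduct.assoc ℂ V H H (s ⊗ₜ h) ⊗ₜ
          TensorProduct.assoc ℂ W H H (t ⊗ₜ k)) := fun s t h k =>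
      tensor_ext₄ ((TensorProduct.assoc ℂ (V ⊗[ℂ] W) H H).toLinearMap ∘ₗ
          (TensorProduct.mk ℂ _ _).flip (h * k) ∘ₗ mulTensor V W H)
        (mulTensor V W (H ⊗[ℂ] H) ∘ₗ TensorProduct.map
          ((TensorProduct.assoc ℂ V H H).toLinearMap ∘ₗ (TensorProduct.mk ℂ _ _).flip h)
          ((TensorProduct.assoc ℂ W H H).toLinearMap ∘ₗ (TensorProduct.mk ℂ _ _).flip k))
        (fun _ _ _ _ => by simp) (s ⊗ₜ t)
    have h1 : ∀ s t, TensorProduct.assoc ℂ (V ⊗[ℂ] W) H H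
        ((ρ.tensorCoact σ).rTensor H (mulTensor V W H (s ⊗ₜ t))) =
        mulTensor V W (H ⊗[ℂ] H) (TensorProduct.assoc ℂ V H H (ρ.coact.rTensor H s) ⊗ₜ
          TensorProduct.assoc ℂ W H H (σ.coact.rTensor H t)) := fun s t =>
      tensor_ext₄ ((TensorProduct.assoc ℂ (V ⊗[ℂ] W) H H).toLinearMap ∘ₗ
          (ρ.tensorCoact σ).rTensor H ∘ₗ mulTensor V W H)
        (mulTensor V W (H ⊗[ℂ] H) ∘ₗ TensorProduct.map
          ((TensorProduct.assoc ℂ V H H).toLinearMap ∘ₗ ρ.coact.rTensor H)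
          ((TensorProduct.assoc ℂ W H H).toLinearMap ∘ₗ σ.coact.rTensor H))
        (fun _ _ _ _ => by simp [tensorCoact_tmul, h0]) (s ⊗ₜ t)
    have h2 : ∀ s t, (Coalgebra.comul (R := ℂ) (A := H)).lTensor (V ⊗[ℂ] W)
        (mulTensor V W H (s ⊗ₜ t)) =
        mulTensor V W (H ⊗[ℂ] H) ((Coalgebra.comul (R := ℂ) (A := H)).lTensor V s ⊗ₜ
          (Coalgebra.comul (R := ℂ) (A := H)).lTensor W t) := fun s t =>
      tensor_ext₄ ((Coalgebra.comul (R := ℂ) (A := H)).lTensor (V ⊗[ℂ] W) ∘ₗ mulTensor V W H)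
        (mulTensor V W (H ⊗[ℂ] H) ∘ₗ TensorProduct.map
          ((Coalgebra.comul (R := ℂ) (A := H)).lTensor V)
          ((Coalgebra.comul (R := ℂ) (A := H)).lTensor W))
        (fun _ _ _ _ => by simp) (s ⊗ₜ t)
    rw [tensorCoact_tmul, h1, h2, ρ.coassoc, σ.coassoc]
  counit x := by
    induction x using TensorProduct.induction_on with
    | zero => simp
    | add u v hu hv => simp only [map_add, hu, hv]
    | tmul v w =>
    have h1 : ∀ s t, TensorProduct.rid ℂ (V ⊗[ℂ] W)
        ((Coalgebra.counit (R := ℂ) (A := H)).lTensor (V ⊗[ℂ] W) (mulTensor V W H (s ⊗ₜ t))) =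
        (TensorProduct.rid ℂ V ((Coalgebra.counit (R := ℂ) (A := H)).lTensor V s)) ⊗ₜ
          (TensorProduct.rid ℂ W ((Coalgebra.counit (R := ℂ) (A := H)).lTensor W t)) := fun s t =>
      tensor_ext₄ ((TensorProduct.rid ℂ (V ⊗[ℂ] W)).toLinearMap ∘ₗ
          (Coalgebra.counit (R := ℂ) (A := H)).lTensor (V ⊗[ℂ] W) ∘ₗ mulTensor V W H)
        (TensorProduct.map
          ((TensorProduct.rid ℂ V).toLinearMap ∘ₗ (Coalgebra.counit (R := ℂ) (A := H)).lTensor V)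
          ((TensorProduct.rid ℂ W).toLinearMap ∘ₗ (Coalgebra.counit (R := ℂ) (A := H)).lTensor W))
        (fun _ _ _ _ => by simp [TensorProduct.smul_tmul', TensorProduct.tmul_smul, smul_smul,
          mul_comm]) (s ⊗ₜ t)
    rw [tensorCoact_tmul, h1, ρ.counit, σ.counit]

/-- The map `v ↦ S v₁ ⊗ v₀`. -/
def antipodeCoact (ρ : Coaction H V) : V →ₗ[ℂ] H ⊗[ℂ] V :=
  (TensorProduct.comm ℂ V H).toLinearMap ∘ₗ (HopfAlgebra.antipode ℂ).lTensor V ∘ₗ ρ.coact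

theorem counit_antipodeCoact (ρ : Coaction H V) (v : V) :
    TensorProduct.lid ℂ V ((Coalgebra.counit (R := ℂ) (A := H)).rTensor V (ρ.antipodeCoact v)) =
      v := by
  conv_rhs => rw [← ρ.counit v]
  exact tensor_ext ((TensorProduct.lid ℂ V).toLinearMap ∘ₗ
      (Coalgebra.counit (R := ℂ) (A := H)).rTensor V ∘ₗ
      (TensorProduct.comm ℂ V H).toLinearMap ∘ₗ (HopfAlgebra.antipode ℂ).lTensor V)
    ((TensorProduct.rid ℂ V).toLinearMap ∘ₗ (Coalgebra.counit (R := ℂ) (A := H)).lTensor V)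
    (fun _ _ => by simp) (ρ.coact v)

end Coaction

/-! ### Coinvariants of `H ⊗ V` for commutative `H` -/

section Commutative

variable {H V : Type*} [CommRing H] [HopfAlgebra ℂ H] [AddCommGroup V] [Module ℂ V]
  (ρ : Coaction H V)

/-- The map `v ⊗ h ↦ S v₁ * h ⊗ v₀`. -/
def Coaction.untwist : V ⊗[ℂ] H →ₗ[ℂ] H ⊗[ℂ] V :=
  TensorProduct.lift (((LinearMap.rTensorHom V ∘ₗ LinearMap.mul ℂ H).flip ∘ₗ ρ.antipodeCoact).compr₂ .id)

theorem Coaction.untwist_tmul (v : V) (h : H) :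
    ρ.untwist (v ⊗ₜ h) = (LinearMap.mulLeft ℂ h).rTensor V (ρ.antipodeCoact v) := rfl

/-- By coassociativity the left side is S(v₁)v₂ ⊗ v₀, and the antipode and counit axioms reduce it
to 1 ⊗ v. Commutativity puts S(v₁) to the left of v₂. -/
theorem Coaction.untwist_coact (v : V) : ρ.untwist (ρ.coact v) = 1 ⊗ₜ v := by
  let f : (V ⊗[ℂ] H) ⊗[ℂ] H →ₗ[ℂ] H ⊗[ℂ] V :=
    (TensorProduct.comm ℂ V H).toLinearMap ∘ₗ (LinearMap.mul' ℂ H ∘ₗ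
      (HopfAlgebra.antipode ℂ).rTensor H).lTensor V ∘ₗ (TensorProduct.assoc ℂ V H H).toLinearMap
  have h1 : ∀ z, ρ.untwist z = f (ρ.coact.rTensor H z) := fun z =>
    tensor_ext ρ.untwist (f ∘ₗ ρ.coact.rTensor H) (fun v h => by
      rw [untwist_tmul]
      exact tensor_ext ((LinearMap.mulLeft ℂ h).rTensor V ∘ₗ (TensorProduct.comm ℂ V H).toLinearMap ∘ₗ
        (HopfAlgebra.antipode ℂ).lTensor V) (f ∘ₗ (TensorProduct.mk ℂ _ _).flip h)
        (fun w k => by simp [f, mul_comm]) (ρ.coact v)) z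
  have h2 : ∀ z, f ((TensorProduct.assoc ℂ V H H).symm
      ((Coalgebra.comul (R := ℂ) (A := H)).lTensor V z)) =
      1 ⊗ₜ TensorProduct.rid ℂ V ((Coalgebra.counit (R := ℂ) (A := H)).lTensor V z) := fun z =>
    tensor_ext (f ∘ₗ (TensorProduct.assoc ℂ V H H).symm.toLinearMap ∘ₗ
        (Coalgebra.comul (R := ℂ) (A := H)).lTensor V)
      (TensorProduct.mk ℂ H V 1 ∘ₗ (TensorProduct.rid ℂ V).toLinearMap ∘ₗ
        (Coalgebra.counit (R := ℂ) (A := H)).lTensor V)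
      (fun w k => by
        simp [f, HopfAlgebra.mul_antipode_rTensor_comul_apply, Algebra.algebraMap_eq_smul_one,
          TensorProduct.tmul_smul, TensorProduct.smul_tmul']) z
  rw [h1, ρ.coassoc_symm, h2, ρ.counit]

/-- The map `h ⊗ v ↦ h₁ ⊗ (v₀ ⊗ h₂ * v₁)`. -/
def Coaction.regular : H ⊗[ℂ] V →ₗ[ℂ] H ⊗[ℂ] (V ⊗[ℂ] H) :=
  (TensorProduct.assoc ℂ H V H).toLinearMap ∘ₗ mulTensor H V H ∘ₗ
    TensorProduct.map Coalgebra.comul ρ.coact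

/-- The map `(v ⊗ h) ⊗ t ↦ t₁ ⊗ (v ⊗ h * t₂)`. -/
def actMid (H V : Type*) [Ring H] [Algebra ℂ H] [AddCommGroup V] [Module ℂ V] :
    (V ⊗[ℂ] H) ⊗[ℂ] (H ⊗[ℂ] H) →ₗ[ℂ] H ⊗[ℂ] (V ⊗[ℂ] H) :=
  (TensorProduct.leftComm ℂ V H H).toLinearMap ∘ₗ
    (LinearMap.mul' ℂ (H ⊗[ℂ] H) ∘ₗ (TensorProduct.mk ℂ H H 1).rTensor _).lTensor V ∘ₗ
    (TensorProduct.assoc ℂ V H (H ⊗[ℂ] H)).toLinearMap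

theorem actMid_tmul (v : V) (h : H) (t : H ⊗[ℂ] H) : actMid H V ((v ⊗ₜ h) ⊗ₜ t) =
    TensorProduct.leftComm ℂ V H H (v ⊗ₜ ((1 ⊗ₜ h) * t)) := by
  simp [actMid]

/-- Commutativity moves v₁ to the left of h₂, the order in which `mul_comul_antipode` applies. -/
theorem Coaction.regular_tmul (h : H) (v : V) :
    ρ.regular (h ⊗ₜ v) = actMid H V (ρ.coact v ⊗ₜ Coalgebra.comul h) := by
  simp only [regular, LinearMap.comp_apply, TensorProduct.map_tmul]
  exact tensor_ext₄ ((TensorProduct.assoc ℂ H V H).toLinearMap ∘ₗ mulTensor H V H)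
    (actMid H V ∘ₗ (TensorProduct.comm ℂ (H ⊗[ℂ] H) (V ⊗[ℂ] H)).toLinearMap)
    (fun a b c d => by simp [actMid_tmul, mul_comm]) _

/-- The map `(v ⊗ h) ⊗ k ↦ (S k)₁ ⊗ (v ⊗ h * (S k)₂)`. -/
def actAntipode (H V : Type*) [Ring H] [HopfAlgebra ℂ H] [AddCommGroup V] [Module ℂ V] :
    (V ⊗[ℂ] H) ⊗[ℂ] H →ₗ[ℂ] H ⊗[ℂ] (V ⊗[ℂ] H) :=
  actMid H V ∘ₗ (Coalgebra.comul ∘ₗ HopfAlgebra.antipode ℂ).lTensor (V ⊗[ℂ] H)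

theorem actAntipode_comul (z : V ⊗[ℂ] H) : actAntipode H V ((TensorProduct.assoc ℂ V H H).symm
      ((Coalgebra.comul (R := ℂ) (A := H)).lTensor V z)) =
      ((TensorProduct.mk ℂ V H).flip 1).lTensor H
        (TensorProduct.comm ℂ V H ((HopfAlgebra.antipode ℂ).lTensor V z)) := by
  induction z using TensorProduct.induction_on with
  | zero => simp
  | add u v hu hv => simp only [map_add, hu, hv]
  | tmul w k =>
    have h : ∀ t : H ⊗[ℂ] H, actAntipode H V ((TensorProduct.assoc ℂ V H H).symm (w ⊗ₜ t)) =
        TensorProduct.leftComm ℂ V H H (w ⊗ₜ (LinearMap.mul' ℂ (H ⊗[ℂ] H)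
          (TensorProduct.map (TensorProduct.mk ℂ H H 1)
            (Coalgebra.comul ∘ₗ HopfAlgebra.antipode ℂ) t))) := by
      intro t
      induction t using TensorProduct.induction_on with
      | zero => simp
      | add u v hu hv => simp only [map_add, TensorProduct.tmul_add, hu, hv]
      | tmul a b => simp [actAntipode, actMid_tmul]
    rw [LinearMap.lTensor_tmul, h, mul_comul_antipode]
    simp

/-- The elements S(v₁) ⊗ v₀ are coinvariant for the codiagonal coaction on H ⊗ V: coassociativity
reduces the claim to `mul_comul_antipode` with h = v₁. -/
theorem Coaction.regular_antipodeCoact (v : V) :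
    ρ.regular (ρ.antipodeCoact v) =
      ((TensorProduct.mk ℂ V H).flip 1).lTensor H (ρ.antipodeCoact v) := by
  have h1 : ∀ z, ρ.regular (TensorProduct.comm ℂ V H ((HopfAlgebra.antipode ℂ).lTensor V z)) =
      actAntipode H V (ρ.coact.rTensor H z) := by
    intro z
    induction z using TensorProduct.induction_on with
    | zero => simp
    | add u v hu hv => simp only [map_add, hu, hv]
    | tmul w k => simp [regular_tmul, actAntipode]
  rw [antipodeCoact, LinearMap.comp_apply, LinearMap.comp_apply, LinearEquiv.coe_coe, h1,
    ρ.coassoc_symm, actAntipode_comul]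

end Commutative

/-! ## Faithfully flat descent -/

section Rep

variable {B N N' : Type*} [Ring B] [Algebra ℂ B] [AddCommGroup N] [Module ℂ N]
  [AddCommGroup N'] [Module ℂ N']

/-- The restriction of a representation to an invariant subspace. -/
def subRep (σ : B →ₐ[ℂ] Module.End ℂ N) (R : Submodule ℂ N) (h : ∀ b, ∀ x ∈ R, σ b x ∈ R) :
    B →ₐ[ℂ] Module.End ℂ R :=
  AlgHom.ofLinearMap
    { toFun := fun b => (σ b).restrict (h b)
      map_add' := fun a b => by ext; simp
      map_smul' := fun a b => by ext; simp }
    (by ext; simp) (fun a b => by ext; simp)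

/-- The representation on the quotient by an invariant subspace. -/
def quotRep (σ : B →ₐ[ℂ] Module.End ℂ N) (R : Submodule ℂ N) (h : ∀ b, ∀ x ∈ R, σ b x ∈ R) :
    B →ₐ[ℂ] Module.End ℂ (N ⧸ R) :=
  AlgHom.ofLinearMap
    { toFun := fun b => R.mapQ R (σ b) (h b)
      map_add' := fun a b => by ext; simp
      map_smul' := fun a b => by ext; simp }
    (by ext; simp) (fun a b => by ext; simp)

end Rep

namespace ComoduleAlgebra

/-! ### The functor `A ⊗_B -`, and `A ⊗_B (A ⊗ V)` as `A ⊗ H ⊗ V` -/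

section General

variable {H A : Type*} [Ring H] [HopfAlgebra ℂ H] [Ring A] [Algebra ℂ A] (δ : ComoduleAlgebra H A)
  {N N' N'' V W : Type*} [AddCommGroup N] [Module ℂ N] [AddCommGroup N'] [Module ℂ N']
  [AddCommGroup N''] [Module ℂ N''] [AddCommGroup V] [Module ℂ V] [AddCommGroup W] [Module ℂ W]

/-- `A ⊗_B N`, for a left `B`-module `N`. -/
abbrev Ind (σ : δ.coinv →ₐ[ℂ] Module.End ℂ N) : Type _ :=
  Balanced (fun b a => a * b : δ.coinv → A → A) (fun b n => σ b n : δ.coinv → N → N)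

/-- The projection `A ⊗ N → A ⊗_B N`. -/
abbrev mkInd (σ : δ.coinv →ₐ[ℂ] Module.End ℂ N) : A ⊗[ℂ] N →ₗ[ℂ] δ.Ind σ := Balanced.mk _ _

theorem mkInd_balanced (σ : δ.coinv →ₐ[ℂ] Module.End ℂ N) (b : δ.coinv) (a : A) (n : N) :
    δ.mkInd σ ((a * b) ⊗ₜ n) = δ.mkInd σ (a ⊗ₜ σ b n) := by
  rw [← sub_eq_zero, ← map_sub]
  exact (Submodule.Quotient.mk_eq_zero _).2 (Submodule.subset_span ⟨b, a, n, rfl⟩)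

theorem Ind_ext {σ : δ.coinv →ₐ[ℂ] Module.End ℂ N} (f g : δ.Ind σ →ₗ[ℂ] V)
    (h : ∀ a n, f (δ.mkInd σ (a ⊗ₜ n)) = g (δ.mkInd σ (a ⊗ₜ n))) (w : δ.Ind σ) : f w = g w := by
  obtain ⟨z, rfl⟩ := Submodule.mkQ_surjective _ w
  exact tensor_ext (f ∘ₗ δ.mkInd σ) (g ∘ₗ δ.mkInd σ) h z

/-- The map `id ⊗_B F`. -/
abbrev mapInd {σ : δ.coinv →ₐ[ℂ] Module.End ℂ N} {σ' : δ.coinv →ₐ[ℂ] Module.End ℂ N'}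
    (F : N →ₗ[ℂ] N') (hF : ∀ b n, F (σ b n) = σ' b (F n)) : δ.Ind σ →ₗ[ℂ] δ.Ind σ' :=
  Balanced.map id LinearMap.id F (fun _ _ => rfl) hF

theorem mapInd_mk {σ : δ.coinv →ₐ[ℂ] Module.End ℂ N} {σ' : δ.coinv →ₐ[ℂ] Module.End ℂ N'}
    (F : N →ₗ[ℂ] N') (hF : ∀ b n, F (σ b n) = σ' b (F n)) (z : A ⊗[ℂ] N) :
    δ.mapInd F hF (δ.mkInd σ z) = δ.mkInd σ' (F.lTensor A z) := rfl

/-- The functor `A ⊗_B -` is right exact. -/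
theorem exists_mapInd_eq {σ : δ.coinv →ₐ[ℂ] Module.End ℂ N} {σ' : δ.coinv →ₐ[ℂ] Module.End ℂ N'}
    {σ'' : δ.coinv →ₐ[ℂ] Module.End ℂ N''} (i : N →ₗ[ℂ] N') (hi : ∀ b n, i (σ b n) = σ' b (i n))
    (π : N' →ₗ[ℂ] N'') (hπ : ∀ b n, π (σ' b n) = σ'' b (π n)) (he : Function.Exact i π)
    (hs : Function.Surjective π) {w : δ.Ind σ'} (hw : δ.mapInd π hπ w = 0) :
    ∃ k, δ.mapInd i hi k = w := by
  obtain ⟨z, rfl⟩ := Submodule.mkQ_surjective _ w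
  have hz : π.lTensor A z ∈ balancedRel (fun b a => a * b : δ.coinv → A → A)
      (fun b n => σ'' b n : δ.coinv → N'' → N'') := (Submodule.Quotient.mk_eq_zero _).1 hw
  -- As π is onto, every relation of A ⊗_B N'' lifts to a relation of A ⊗_B N'. Correcting z by such
  -- a lift gives an element of the kernel of id ⊗ π, where exactness over ℂ applies.
  have hle : balancedRel (fun b a => a * b : δ.coinv → A → A)
      (fun b n => σ'' b n : δ.coinv → N'' → N'') ≤
      (balancedRel (fun b a => a * b : δ.coinv → A → A)
        (fun b n => σ' b n : δ.coinv → N' → N')).map (π.lTensor A) := by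
    rw [balancedRel, Submodule.span_le]
    rintro _ ⟨b, a, q, rfl⟩
    obtain ⟨n, rfl⟩ := hs q
    exact ⟨(a * b) ⊗ₜ n - a ⊗ₜ σ' b n, Submodule.subset_span ⟨b, a, n, rfl⟩, by simp [hπ]⟩
  obtain ⟨r, hr, hrz⟩ := hle hz
  obtain ⟨k, hk⟩ := (lTensor_exact A he hs (z - r)).1 (by rw [map_sub, hrz, sub_self])
  refine ⟨δ.mkInd σ k, ?_⟩
  have hr0 : δ.mkInd σ' r = 0 := (Submodule.Quotient.mk_eq_zero _).2 hr
  rw [mapInd_mk, hk, map_sub, hr0, sub_zero]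

/-- Left multiplication by `A` on `A ⊗ V`. -/
def lmulLeft (A V : Type*) [Ring A] [Algebra ℂ A] [AddCommGroup V] [Module ℂ V] :
    A →ₐ[ℂ] Module.End ℂ (A ⊗[ℂ] V) :=
  (Module.End.rTensorAlgHom ℂ A V).comp (Algebra.lmul ℂ A)

@[simp] theorem lmulLeft_tmul (a a' : A) (v : V) :
    lmulLeft A V a (a' ⊗ₜ v) = (a * a') ⊗ₜ v := rfl

theorem lmulLeft_eq (a : A) : lmulLeft A V a = (LinearMap.mulLeft ℂ a).rTensor V := rfl

/-- The left `B`-module `A ⊗ V`. -/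
def repLeft (V : Type*) [AddCommGroup V] [Module ℂ V] : δ.coinv →ₐ[ℂ] Module.End ℂ (A ⊗[ℂ] V) :=
  (lmulLeft A V).comp δ.coinv.val

theorem repLeft_apply (b : δ.coinv) (m : A ⊗[ℂ] V) :
    δ.repLeft V b m = lmulLeft A V (b : A) m := rfl

/-- The `A`-linear extension `A ⊗_B N → A ⊗ V` of a map `N → A ⊗ V` of left `B`-modules. -/
def extend {σ : δ.coinv →ₐ[ℂ] Module.End ℂ N} (ν : N →ₗ[ℂ] A ⊗[ℂ] V)
    (hν : ∀ b n, ν (σ b n) = δ.repLeft V b (ν n)) : δ.Ind σ →ₗ[ℂ] A ⊗[ℂ] V :=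
  Submodule.liftQ _ (TensorProduct.lift ((lmulLeft A V).toLinearMap.compl₂ ν)) <|
    balancedRel_le _ fun b a n => by simp [hν, repLeft_apply]

theorem extend_mk {σ : δ.coinv →ₐ[ℂ] Module.End ℂ N} (ν : N →ₗ[ℂ] A ⊗[ℂ] V)
    (hν : ∀ b n, ν (σ b n) = δ.repLeft V b (ν n)) (a : A) (n : N) :
    δ.extend ν hν (δ.mkInd σ (a ⊗ₜ n)) = lmulLeft A V a (ν n) := rfl

/-- The multiplication `A ⊗_B (A ⊗ V) → A ⊗ V`. -/
def multInd (V : Type*) [AddCommGroup V] [Module ℂ V] : δ.Ind (δ.repLeft V) →ₗ[ℂ] A ⊗[ℂ] V :=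
  δ.extend LinearMap.id (fun _ _ => rfl)

/-- The A-linear extension factors through A ⊗_B ν, so its injectivity forces that of A ⊗_B ν. -/
theorem multInd_mapInd {σ : δ.coinv →ₐ[ℂ] Module.End ℂ N} (ν : N →ₗ[ℂ] A ⊗[ℂ] V)
    (hν : ∀ b n, ν (σ b n) = δ.repLeft V b (ν n)) (w : δ.Ind σ) :
    δ.multInd V (δ.mapInd ν hν w) = δ.extend ν hν w :=
  δ.Ind_ext (δ.multInd V ∘ₗ δ.mapInd ν hν) (δ.extend ν hν) (fun _ _ => rfl) w

/-- The map `A ⊗_B (A ⊗ V) → (A ⊗ H) ⊗ V`, `a' ⊗_B (a ⊗ v) ↦ (a' * a₀ ⊗ a₁) ⊗ v`. -/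
def theta (V : Type*) [AddCommGroup V] [Module ℂ V] :
    δ.Ind (δ.repLeft V) →ₗ[ℂ] (A ⊗[ℂ] H) ⊗[ℂ] V :=
  Submodule.liftQ _ ((δ.galois ∘ₗ δ.mkAA).rTensor V ∘ₗ
    (TensorProduct.assoc ℂ A A V).symm.toLinearMap) <| balancedRel_le _ fun b a m => by
      induction m using TensorProduct.induction_on with
      | zero => simp
      | add u v hu hv => simp only [map_add, TensorProduct.tmul_add, hu, hv]
      | tmul a' v =>
        have hb := δ.mem_coinv.1 b.2
        have h : δ.galois (δ.mkAA ((a * b) ⊗ₜ a')) = δ.galois (δ.mkAA (a ⊗ₜ (b * a'))) := by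
          rw [galois_mkAA, galois_mkAA, map_mul δ.coact, hb, ← mul_assoc,
            Algebra.TensorProduct.tmul_mul_tmul, mul_one]
        change δ.galois (δ.mkAA ((a * b) ⊗ₜ a')) ⊗ₜ[ℂ] v = δ.galois (δ.mkAA (a ⊗ₜ (b * a'))) ⊗ₜ[ℂ] v
        rw [h]

theorem theta_mk (a a' : A) (v : V) : δ.theta V (δ.mkInd (δ.repLeft V) (a ⊗ₜ (a' ⊗ₜ v))) =
    ((a ⊗ₜ 1) * δ.coact a') ⊗ₜ v := rfl

/-- The map `A ⊗_B A → Hom (V, A ⊗_B (A ⊗ V))`. -/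
def curryAA (V : Type*) [AddCommGroup V] [Module ℂ V] :
    δ.AA →ₗ[ℂ] V →ₗ[ℂ] δ.Ind (δ.repLeft V) :=
  Submodule.liftQ _ (TensorProduct.curry (δ.mkInd (δ.repLeft V) ∘ₗ
    (TensorProduct.assoc ℂ A A V).toLinearMap)) <| balancedRel_le _ fun b a a' => by
      ext v
      exact δ.mkInd_balanced (δ.repLeft V) b a (a' ⊗ₜ v)

theorem theta_curryAA (w : δ.AA) (v : V) : δ.theta V (δ.curryAA V w v) = δ.galois w ⊗ₜ v := by
  obtain ⟨z, rfl⟩ := Submodule.mkQ_surjective _ w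
  induction z using TensorProduct.induction_on with
  | zero => simp
  | add u v hu hv => simp only [map_add, TensorProduct.add_tmul, LinearMap.add_apply, hu, hv]
  | tmul a a' => rfl

/-- Under A ⊗_B (A ⊗ V) = (A ⊗_B A) ⊗ V the map is χ ⊗ V; its inverse is assembled from χ⁻¹ and
`curryAA`. -/
theorem theta_bijective (hG : δ.IsHopfGalois) : Function.Bijective (δ.theta V) := by
  let g := LinearEquiv.ofBijective δ.galois hG
  let inv : (A ⊗[ℂ] H) ⊗[ℂ] V →ₗ[ℂ] δ.Ind (δ.repLeft V) :=
    TensorProduct.lift (δ.curryAA V ∘ₗ g.symm.toLinearMap)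
  refine Function.bijective_iff_has_inverse.2 ⟨inv, fun w => ?_, fun z => ?_⟩
  · refine δ.Ind_ext (inv ∘ₗ δ.theta V) LinearMap.id (fun a m => ?_) w
    refine tensor_ext (inv ∘ₗ δ.theta V ∘ₗ δ.mkInd (δ.repLeft V) ∘ₗ TensorProduct.mk ℂ _ _ a)
      (δ.mkInd (δ.repLeft V) ∘ₗ TensorProduct.mk ℂ _ _ a) (fun a' v => ?_) m
    have h : g.symm ((a ⊗ₜ 1) * δ.coact a') = δ.mkAA (a ⊗ₜ a') := by
      rw [LinearEquiv.symm_apply_eq]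
      rfl
    change inv (((a ⊗ₜ 1) * δ.coact a') ⊗ₜ v) = _
    simp only [inv, TensorProduct.lift.tmul, LinearMap.comp_apply, LinearEquiv.coe_coe, h]
    rfl
  · refine tensor_ext (δ.theta V ∘ₗ inv) LinearMap.id (fun u v => ?_) z
    simp only [inv, TensorProduct.lift.tmul, LinearMap.comp_apply, LinearEquiv.coe_coe,
      theta_curryAA]
    rw [show δ.galois (g.symm u) = u from g.apply_symm_apply u]
    rfl

/-- The map `(a ⊗ h) ⊗ v ↦ ε h • a ⊗ v`. -/
def counitMid (A H V : Type*) [Ring H] [HopfAlgebra ℂ H] [Ring A] [Algebra ℂ A] [AddCommGroup V]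
    [Module ℂ V] : (A ⊗[ℂ] H) ⊗[ℂ] V →ₗ[ℂ] A ⊗[ℂ] V :=
  ((TensorProduct.rid ℂ A).toLinearMap ∘ₗ
    (Coalgebra.counit (R := ℂ) (A := H)).lTensor A).rTensor V

/-- The counit turns a'a₀ ⊗ a₁ into a'a. -/
theorem counitMid_theta (w : δ.Ind (δ.repLeft V)) :
    counitMid A H V (δ.theta V w) = δ.multInd V w := by
  refine δ.Ind_ext (counitMid A H V ∘ₗ δ.theta V) (δ.multInd V) (fun a m => ?_) w
  refine tensor_ext (counitMid A H V ∘ₗ δ.theta V ∘ₗ δ.mkInd (δ.repLeft V) ∘ₗ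
    TensorProduct.mk ℂ _ _ a) (δ.multInd V ∘ₗ δ.mkInd (δ.repLeft V) ∘ₗ TensorProduct.mk ℂ _ _ a)
    (fun a' v => ?_) m
  have h : ∀ z : A ⊗[ℂ] H, TensorProduct.rid ℂ A
      ((Coalgebra.counit (R := ℂ) (A := H)).lTensor A ((a ⊗ₜ 1) * z)) =
      a * TensorProduct.rid ℂ A ((Coalgebra.counit (R := ℂ) (A := H)).lTensor A z) := fun z =>
    tensor_ext ((TensorProduct.rid ℂ A).toLinearMap ∘ₗ
      (Coalgebra.counit (R := ℂ) (A := H)).lTensor A ∘ₗ LinearMap.mulLeft ℂ (a ⊗ₜ 1))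
      (LinearMap.mulLeft ℂ a ∘ₗ (TensorProduct.rid ℂ A).toLinearMap ∘ₗ
      (Coalgebra.counit (R := ℂ) (A := H)).lTensor A) (fun _ _ => by simp) z
  change counitMid A H V (((a ⊗ₜ 1) * δ.coact a') ⊗ₜ v) = (a * a') ⊗ₜ v
  simp only [counitMid, LinearMap.rTensor_tmul, LinearMap.comp_apply, LinearEquiv.coe_coe, h,
    δ.counit]

end General

/-! ### Consequences of faithful flatness -/

section Flat

variable {H A : Type u} [Ring H] [HopfAlgebra ℂ H] [Ring A] [Algebra ℂ A] {δ : ComoduleAlgebra H A}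
  (hflat : δ.IsFaithfullyFlat)
include hflat

/-- Passes from B-modules to representations of B on complex vector spaces, the form in which all
B-actions occur here. -/
theorem IsFaithfullyFlat.injective_iff {N N' : Type u} [AddCommGroup N] [Module ℂ N]
    [AddCommGroup N'] [Module ℂ N'] {σ : δ.coinv →ₐ[ℂ] Module.End ℂ N}
    {σ' : δ.coinv →ₐ[ℂ] Module.End ℂ N'} (F : N →ₗ[ℂ] N') (hF : ∀ b n, F (σ b n) = σ' b (F n)) :
    Function.Injective F ↔ Function.Injective (δ.mapInd F hF) := by
  let _ : Module δ.coinv N := Module.compHom N σ.toRingHom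
  let _ : Module δ.coinv N' := Module.compHom N' σ'.toRingHom
  have _ : IsScalarTower ℂ δ.coinv N := ⟨fun r b n => by
    change σ (r • b) n = r • σ b n
    simp⟩
  have _ : IsScalarTower ℂ δ.coinv N' := ⟨fun r b n => by
    change σ' (r • b) n = r • σ' b n
    simp⟩
  exact hflat N N' { F with map_smul' := hF }

/-- A map of left `B`-modules is surjective if it becomes so after applying `A ⊗_B -`. -/
theorem IsFaithfullyFlat.surjective {N N' : Type u} [AddCommGroup N] [Module ℂ N]
    [AddCommGroup N'] [Module ℂ N'] {σ : δ.coinv →ₐ[ℂ] Module.End ℂ N}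
    {σ' : δ.coinv →ₐ[ℂ] Module.End ℂ N'} (F : N →ₗ[ℂ] N') (hF : ∀ b n, F (σ b n) = σ' b (F n))
    (hs : Function.Surjective (δ.mapInd F hF)) : Function.Surjective F := by
  have hR : ∀ b, ∀ x ∈ LinearMap.range F, σ' b x ∈ LinearMap.range F := by
    rintro b _ ⟨n, rfl⟩
    exact ⟨σ b n, hF b n⟩
  let σ'' := quotRep σ' (LinearMap.range F) hR
  -- The cokernel of F is killed by A ⊗_B -. Its zero endomorphism therefore becomes injective,
  -- hence is injective already, and the cokernel vanishes.
  have h0 : ∀ w : δ.Ind σ'', w = 0 := by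
    intro w
    obtain ⟨z, rfl⟩ := Submodule.mkQ_surjective _ w
    obtain ⟨y, rfl⟩ := LinearMap.lTensor_surjective A
      (Submodule.mkQ_surjective (LinearMap.range F)) z
    obtain ⟨x, hx⟩ := hs (δ.mkInd σ' y)
    obtain ⟨x, rfl⟩ := Submodule.mkQ_surjective _ x
    have h1 : δ.mapInd (σ := σ') (σ' := σ'') (LinearMap.range F).mkQ (fun _ _ => rfl)
        (δ.mapInd F hF (δ.mkInd σ x)) = 0 :=
      tensor_ext (δ.mapInd (σ := σ') (σ' := σ'') (LinearMap.range F).mkQ (fun _ _ => rfl) ∘ₗ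
        δ.mapInd F hF ∘ₗ δ.mkInd σ) 0 (fun a n => by
          have h : (LinearMap.range F).mkQ (F n) = 0 :=
            (Submodule.Quotient.mk_eq_zero _).2 (LinearMap.mem_range_self F n)
          change δ.mkInd σ'' (a ⊗ₜ (LinearMap.range F).mkQ (F n)) = 0
          rw [h, TensorProduct.tmul_zero, map_zero]) x
    exact (congrArg _ hx).symm.trans h1
  have hinj : Function.Injective (0 : (N' ⧸ LinearMap.range F) →ₗ[ℂ] (N' ⧸ LinearMap.range F)) :=
    (hflat.injective_iff (σ := σ'') (σ' := σ'') 0 (fun _ _ => by simp)).2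
      (fun x y _ => by rw [h0 x, h0 y])
  intro n
  have : (LinearMap.range F).mkQ n = 0 := hinj rfl
  exact (Submodule.Quotient.mk_eq_zero _).1 this

/-- The functor `A ⊗_B -` is exact. -/
theorem IsFaithfullyFlat.exists_mapInd_eq {N N' N'' : Type u} [AddCommGroup N] [Module ℂ N]
    [AddCommGroup N'] [Module ℂ N'] [AddCommGroup N''] [Module ℂ N'']
    {σ : δ.coinv →ₐ[ℂ] Module.End ℂ N} {σ' : δ.coinv →ₐ[ℂ] Module.End ℂ N'}
    {σ'' : δ.coinv →ₐ[ℂ] Module.End ℂ N''} (i : N →ₗ[ℂ] N') (hi : ∀ b n, i (σ b n) = σ' b (i n))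
    (F : N' →ₗ[ℂ] N'') (hF : ∀ b n, F (σ' b n) = σ'' b (F n)) (he : Function.Exact i F)
    {w : δ.Ind σ'} (hw : δ.mapInd F hF w = 0) : ∃ k, δ.mapInd i hi k = w := by
  have hR : ∀ b, ∀ x ∈ LinearMap.ker F, σ' b x ∈ LinearMap.ker F := by
    intro b x hx
    rw [LinearMap.mem_ker] at hx ⊢
    rw [hF, hx, map_zero]
  -- F is the projection onto N'/ker F, for which right exactness suffices, followed by an
  -- injection, which stays injective by flatness.
  let τ := quotRep σ' (LinearMap.ker F) hR
  let G : (N' ⧸ LinearMap.ker F) →ₗ[ℂ] N'' := (LinearMap.ker F).liftQ F le_rfl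
  have hG : ∀ b q, G (τ b q) = σ'' b (G q) := by
    intro b q
    obtain ⟨n, rfl⟩ := Submodule.mkQ_surjective _ q
    exact hF b n
  have hGi : Function.Injective G := by
    rw [← LinearMap.ker_eq_bot]
    exact Submodule.ker_liftQ_eq_bot _ _ _ le_rfl
  refine δ.exists_mapInd_eq i hi (σ'' := τ) (LinearMap.ker F).mkQ (fun _ _ => rfl) ?_
    (Submodule.mkQ_surjective _) ?_
  · intro x
    rw [← he x, Submodule.mkQ_apply, Submodule.Quotient.mk_eq_zero, LinearMap.mem_ker]
  · apply (hflat.injective_iff G hG).1 hGi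
    rw [map_zero, ← hw]
    obtain ⟨z, rfl⟩ := Submodule.mkQ_surjective _ w
    exact tensor_ext (δ.mapInd G hG ∘ₗ δ.mapInd (σ := σ') (σ' := τ) (LinearMap.ker F).mkQ
      (fun _ _ => rfl) ∘ₗ δ.mkInd σ') (δ.mapInd F hF ∘ₗ δ.mkInd σ') (fun _ _ => rfl) z

end Flat

end ComoduleAlgebra

/-! ### The structure theorem for relative Hopf modules -/

namespace ComoduleAlgebra

section Schneider

variable {H A V : Type*} [CommRing H] [HopfAlgebra ℂ H] [Ring A] [Algebra ℂ A]
  (δ : ComoduleAlgebra H A) [AddCommGroup V] [Module ℂ V] (ρ : Coaction H V)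

/-- The coaction of a comodule algebra, as a comodule. -/
def toCoaction {H A : Type*} [Ring H] [HopfAlgebra ℂ H] [Ring A] [Algebra ℂ A]
    (δ : ComoduleAlgebra H A) : Coaction H A := ⟨δ.coact.toLinearMap, δ.coassoc, δ.counit⟩

/-- The map `a ⊗ v ↦ (a ⊗ S v₁) ⊗ v₀`. -/
def antipodeRight (A : Type*) [Ring A] [Algebra ℂ A] (ρ : Coaction H V) :
    A ⊗[ℂ] V →ₗ[ℂ] (A ⊗[ℂ] H) ⊗[ℂ] V :=
  (TensorProduct.assoc ℂ A H V).symm.toLinearMap ∘ₗ ρ.antipodeCoact.lTensor A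

theorem antipodeRight_tmul (a : A) (v : V) : antipodeRight A ρ (a ⊗ₜ v) =
    (TensorProduct.assoc ℂ A H V).symm (a ⊗ₜ ρ.antipodeCoact v) := rfl

theorem counitMid_antipodeRight (m : A ⊗[ℂ] V) : counitMid A H V (antipodeRight A ρ m) = m :=
  tensor_ext (counitMid A H V ∘ₗ antipodeRight A ρ) .id (fun a v => by
    have h : ∀ t, counitMid A H V ((TensorProduct.assoc ℂ A H V).symm (a ⊗ₜ t)) =
        a ⊗ₜ TensorProduct.lid ℂ V ((Coalgebra.counit (R := ℂ) (A := H)).rTensor V t) := fun t =>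
      tensor_ext (counitMid A H V ∘ₗ (TensorProduct.assoc ℂ A H V).symm.toLinearMap ∘ₗ
        TensorProduct.mk ℂ _ _ a) (TensorProduct.mk ℂ _ _ a ∘ₗ
          (TensorProduct.lid ℂ V).toLinearMap ∘ₗ (Coalgebra.counit (R := ℂ) (A := H)).rTensor V)
        (fun h v => by simp [counitMid, TensorProduct.smul_tmul']) t
    rw [LinearMap.comp_apply, antipodeRight_tmul, h, ρ.counit_antipodeCoact]
    rfl) m

/-- The map `(a ⊗ v) ⊗ h ↦ (a ⊗ S v₁ * h) ⊗ v₀`. -/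
def untwistRight (A : Type*) [Ring A] [Algebra ℂ A] (ρ : Coaction H V) :
    (A ⊗[ℂ] V) ⊗[ℂ] H →ₗ[ℂ] (A ⊗[ℂ] H) ⊗[ℂ] V :=
  (TensorProduct.assoc ℂ A H V).symm.toLinearMap ∘ₗ ρ.untwist.lTensor A ∘ₗ
    (TensorProduct.assoc ℂ A V H).toLinearMap

theorem untwistRight_tmul_one (m : A ⊗[ℂ] V) :
    untwistRight A ρ (m ⊗ₜ 1) = antipodeRight A ρ m :=
  tensor_ext (untwistRight A ρ ∘ₗ (TensorProduct.mk ℂ _ _).flip 1) (antipodeRight A ρ)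
    (fun a v => by simp [untwistRight, antipodeRight, Coaction.untwist_tmul]) m

/-- Multiplying a codiagonal coaction by the antipode of v₁ cancels the part that comes from V. -/
theorem untwistRight_mulTensor (u : A ⊗[ℂ] H) (v : V) :
    untwistRight A ρ (mulTensor A V H (u ⊗ₜ ρ.coact v)) = u ⊗ₜ v :=
  tensor_ext (untwistRight A ρ ∘ₗ mulTensor A V H ∘ₗ (TensorProduct.mk ℂ _ _).flip (ρ.coact v))
    ((TensorProduct.mk ℂ _ _).flip v) (fun a h => by
      have e : ∀ s, untwistRight A ρ (mulTensor A V H ((a ⊗ₜ h) ⊗ₜ s)) =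
          (TensorProduct.assoc ℂ A H V).symm
            (a ⊗ₜ (LinearMap.mulLeft ℂ h).rTensor V (ρ.untwist s)) := by
        intro s
        induction s using TensorProduct.induction_on with
        | zero => simp
        | add u v hu hv => simp only [map_add, TensorProduct.tmul_add, hu, hv]
        | tmul w k =>
          simp only [mulTensor_tmul, untwistRight, LinearMap.comp_apply, LinearEquiv.coe_coe,
            TensorProduct.assoc_tmul, LinearMap.lTensor_tmul, Coaction.untwist_tmul]
          rw [← LinearMap.rTensor_comp_apply, ← LinearMap.mulLeft_mul]
      simp only [LinearMap.comp_apply, LinearMap.flip_apply, TensorProduct.mk_apply, e,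
        ρ.untwist_coact]
      simp) u

/-- Untwisting both sides of a₀ ⊗ v₀ ⊗ a₁v₁ = a ⊗ v ⊗ 1 gives a₀ ⊗ a₁ ⊗ v = a ⊗ S(v₁) ⊗ v₀. On
coinvariants the coaction of A is thus determined by that of V. -/
theorem rTensor_coact_eq {m : A ⊗[ℂ] V} (hm : δ.toCoaction.tensorCoact ρ m = m ⊗ₜ 1) :
    δ.coact.toLinearMap.rTensor V m = antipodeRight A ρ m := by
  rw [← untwistRight_tmul_one, ← hm]
  exact tensor_ext (δ.coact.toLinearMap.rTensor V)
    (untwistRight A ρ ∘ₗ δ.toCoaction.tensorCoact ρ)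
    (fun a v => (untwistRight_mulTensor ρ (δ.coact a) v).symm) m

theorem theta_mk' (a : A) (m : A ⊗[ℂ] V) : δ.theta V (δ.mkInd (δ.repLeft V) (a ⊗ₜ m)) =
    (LinearMap.mulLeft ℂ (a ⊗ₜ (1 : H))).rTensor V (δ.coact.toLinearMap.rTensor V m) :=
  tensor_ext (δ.theta V ∘ₗ δ.mkInd (δ.repLeft V) ∘ₗ TensorProduct.mk ℂ _ _ a)
    ((LinearMap.mulLeft ℂ (a ⊗ₜ (1 : H))).rTensor V ∘ₗ δ.coact.toLinearMap.rTensor V)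
    (fun _ _ => rfl) m

theorem assoc_symm_mulLeft (a a' : A) (t : H ⊗[ℂ] V) :
    (TensorProduct.assoc ℂ A H V).symm ((a * a') ⊗ₜ t) =
      (LinearMap.mulLeft ℂ (a ⊗ₜ (1 : H))).rTensor V
        ((TensorProduct.assoc ℂ A H V).symm (a' ⊗ₜ t)) := by
  induction t using TensorProduct.induction_on with
  | zero => simp
  | add u v hu hv => simp only [map_add, TensorProduct.tmul_add, hu, hv]
  | tmul h v => simp

theorem antipodeRight_lmulLeft (a : A) (m : A ⊗[ℂ] V) :
    antipodeRight A ρ (lmulLeft A V a m) =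
      (LinearMap.mulLeft ℂ (a ⊗ₜ (1 : H))).rTensor V (antipodeRight A ρ m) := by
  induction m using TensorProduct.induction_on with
  | zero => simp
  | add u v hu hv => simp only [map_add, hu, hv]
  | tmul a' v => rw [lmulLeft_tmul, antipodeRight_tmul, antipodeRight_tmul, assoc_symm_mulLeft]

/-- The map `a ⊗ v ↦ a₀ ⊗ (v₀ ⊗ a₁ * v₁) - a ⊗ (v ⊗ 1)`. -/
def coactSub : A ⊗[ℂ] V →ₗ[ℂ] A ⊗[ℂ] (V ⊗[ℂ] H) :=
  (TensorProduct.assoc ℂ A V H).toLinearMap ∘ₗ δ.toCoaction.tensorCoact ρ -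
    ((TensorProduct.mk ℂ V H).flip 1).lTensor A

theorem lTensor_flip_mk (m : A ⊗[ℂ] V) :
    ((TensorProduct.mk ℂ V H).flip 1).lTensor A m = TensorProduct.assoc ℂ A V H (m ⊗ₜ 1) :=
  tensor_ext (((TensorProduct.mk ℂ V H).flip 1).lTensor A)
    ((TensorProduct.assoc ℂ A V H).toLinearMap ∘ₗ (TensorProduct.mk ℂ (A ⊗[ℂ] V) H).flip 1)
    (fun _ _ => by simp) m

theorem coactSub_apply (m : A ⊗[ℂ] V) : δ.coactSub ρ m =
    TensorProduct.assoc ℂ A V H (δ.toCoaction.tensorCoact ρ m) -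
      TensorProduct.assoc ℂ A V H (m ⊗ₜ 1) := by
  rw [← lTensor_flip_mk]
  rfl

theorem coactSub_eq_zero {m : A ⊗[ℂ] V} :
    δ.coactSub ρ m = 0 ↔ δ.toCoaction.tensorCoact ρ m = m ⊗ₜ 1 := by
  rw [coactSub_apply, sub_eq_zero, EquivLike.apply_eq_iff_eq]

theorem assoc_mulTensor_mulLeft (b : A) (u : A ⊗[ℂ] H) (s : V ⊗[ℂ] H) :
    TensorProduct.assoc ℂ A V H (mulTensor A V H (((b ⊗ₜ 1) * u) ⊗ₜ s)) =
      lmulLeft A (V ⊗[ℂ] H) b (TensorProduct.assoc ℂ A V H (mulTensor A V H (u ⊗ₜ s))) :=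
  tensor_ext₄ ((TensorProduct.assoc ℂ A V H).toLinearMap ∘ₗ mulTensor A V H ∘ₗ
      (LinearMap.mulLeft ℂ (b ⊗ₜ 1)).rTensor _)
    (lmulLeft A (V ⊗[ℂ] H) b ∘ₗ (TensorProduct.assoc ℂ A V H).toLinearMap ∘ₗ mulTensor A V H)
    (fun _ _ _ _ => by simp) (u ⊗ₜ s)

theorem coactSub_rep (b : δ.coinv) (m : A ⊗[ℂ] V) :
    δ.coactSub ρ (δ.repLeft V b m) = δ.repLeft (V ⊗[ℂ] H) b (δ.coactSub ρ m) := by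
  induction m using TensorProduct.induction_on with
  | zero => simp
  | add u v hu hv => simp only [map_add, hu, hv]
  | tmul a v =>
    have h : δ.toCoaction.coact ((b : A) * a) = ((b : A) ⊗ₜ 1) * δ.toCoaction.coact a := by
      refine (map_mul δ.coact _ _).trans ?_
      rw [δ.mem_coinv.1 b.2]
      rfl
    simp only [repLeft_apply, lmulLeft_tmul, coactSub_apply, Coaction.tensorCoact_tmul, h, map_sub,
      assoc_mulTensor_mulLeft, TensorProduct.assoc_tmul]

/-- The map `(a ⊗ h) ⊗ v ↦ (a ⊗ h₁) ⊗ (v₀ ⊗ h₂ * v₁) - (a ⊗ h) ⊗ (v ⊗ 1)`. -/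
def regularSub (A : Type*) [Ring A] [Algebra ℂ A] (ρ : Coaction H V) :
    (A ⊗[ℂ] H) ⊗[ℂ] V →ₗ[ℂ] (A ⊗[ℂ] H) ⊗[ℂ] (V ⊗[ℂ] H) :=
  (TensorProduct.assoc ℂ A H (V ⊗[ℂ] H)).symm.toLinearMap ∘ₗ
    (ρ.regular - ((TensorProduct.mk ℂ V H).flip 1).lTensor H).lTensor A ∘ₗ
    (TensorProduct.assoc ℂ A H V).toLinearMap

theorem regularSub_antipodeRight (m : A ⊗[ℂ] V) : regularSub A ρ (antipodeRight A ρ m) = 0 := by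
  induction m using TensorProduct.induction_on with
  | zero => simp
  | add u v hu hv => simp only [map_add, hu, hv, add_zero]
  | tmul a v =>
    simp [regularSub, antipodeRight_tmul, ρ.regular_antipodeCoact]

theorem regularSub_mulLeft (a : A) (z : (A ⊗[ℂ] H) ⊗[ℂ] V) :
    regularSub A ρ ((LinearMap.mulLeft ℂ (a ⊗ₜ (1 : H))).rTensor V z) =
      (LinearMap.mulLeft ℂ (a ⊗ₜ (1 : H))).rTensor (V ⊗[ℂ] H) (regularSub A ρ z) := by
  induction z using TensorProduct.induction_on with
  | zero => simp
  | add u v hu hv => simp only [map_add, hu, hv]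
  | tmul u v =>
  induction u using TensorProduct.induction_on with
  | zero => simp
  | add u v hu hv => simp only [TensorProduct.add_tmul, map_add, hu, hv]
  | tmul a' h =>
    simp only [regularSub, LinearMap.rTensor_tmul, LinearMap.mulLeft_apply,
      Algebra.TensorProduct.tmul_mul_tmul, one_mul, LinearMap.comp_apply, LinearEquiv.coe_coe,
      TensorProduct.assoc_tmul, LinearMap.lTensor_tmul, assoc_symm_mulLeft]

/-- Coassociativity turns the codiagonal coaction on A ⊗ V, once δ has been applied to A, into the
one on H ⊗ V with A inert. -/
theorem rTensor_coact_coactSub (a : A) (v : V) :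
    δ.coact.toLinearMap.rTensor (V ⊗[ℂ] H) (δ.coactSub ρ (a ⊗ₜ v)) =
      regularSub A ρ (δ.coact a ⊗ₜ v) := by
  have h1 : ∀ (u : A ⊗[ℂ] H) (s : V ⊗[ℂ] H), δ.coact.toLinearMap.rTensor (V ⊗[ℂ] H)
      (TensorProduct.assoc ℂ A V H (mulTensor A V H (u ⊗ₜ s))) =
      TensorProduct.assoc ℂ (A ⊗[ℂ] H) V H
        (mulTensor (A ⊗[ℂ] H) V H (δ.coact.toLinearMap.rTensor H u ⊗ₜ s)) := fun u s =>
    tensor_ext₄ (δ.coact.toLinearMap.rTensor (V ⊗[ℂ] H) ∘ₗ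
        (TensorProduct.assoc ℂ A V H).toLinearMap ∘ₗ mulTensor A V H)
      ((TensorProduct.assoc ℂ (A ⊗[ℂ] H) V H).toLinearMap ∘ₗ mulTensor (A ⊗[ℂ] H) V H ∘ₗ
        (δ.coact.toLinearMap.rTensor H).rTensor _) (fun _ _ _ _ => by simp) (u ⊗ₜ s)
  have h2 : ∀ (a : A) (t : H ⊗[ℂ] H) (s : V ⊗[ℂ] H), TensorProduct.assoc ℂ (A ⊗[ℂ] H) V H
      (mulTensor (A ⊗[ℂ] H) V H ((TensorProduct.assoc ℂ A H H).symm (a ⊗ₜ t) ⊗ₜ s)) =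
      (TensorProduct.assoc ℂ A H (V ⊗[ℂ] H)).symm
        (a ⊗ₜ TensorProduct.assoc ℂ H V H (mulTensor H V H (t ⊗ₜ s))) := fun a t s =>
    tensor_ext₄ ((TensorProduct.assoc ℂ (A ⊗[ℂ] H) V H).toLinearMap ∘ₗ
        mulTensor (A ⊗[ℂ] H) V H ∘ₗ
        ((TensorProduct.assoc ℂ A H H).symm.toLinearMap ∘ₗ TensorProduct.mk ℂ _ _ a).rTensor _)
      ((TensorProduct.assoc ℂ A H (V ⊗[ℂ] H)).symm.toLinearMap ∘ₗ TensorProduct.mk ℂ _ _ a ∘ₗ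
        (TensorProduct.assoc ℂ H V H).toLinearMap ∘ₗ mulTensor H V H)
      (fun _ _ _ _ => by simp) (t ⊗ₜ s)
  have h3 : ∀ u : A ⊗[ℂ] H, TensorProduct.assoc ℂ (A ⊗[ℂ] H) V H
      (mulTensor (A ⊗[ℂ] H) V H ((TensorProduct.assoc ℂ A H H).symm
        ((Coalgebra.comul (R := ℂ) (A := H)).lTensor A u) ⊗ₜ ρ.coact v)) - u ⊗ₜ (v ⊗ₜ 1) =
      regularSub A ρ (u ⊗ₜ v) := by
    intro u
    induction u using TensorProduct.induction_on with
    | zero => simp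
    | add u v hu hv =>
      simp only [TensorProduct.add_tmul, map_add, ← hu, ← hv]
      abel
    | tmul a h =>
      simp [h2, regularSub, Coaction.regular]
  have h4 := δ.toCoaction.coassoc_symm a
  rw [coactSub_apply, Coaction.tensorCoact_tmul, map_sub, h1, ← h3]
  refine congrArg₂ (· - ·) (congrArg (fun u => TensorProduct.assoc ℂ (A ⊗[ℂ] H) V H
    (mulTensor (A ⊗[ℂ] H) V H (u ⊗ₜ ρ.coact v))) h4) ?_
  simp

/-- Flatness identifies A ⊗_B (coinvariants) with the kernel of A ⊗_B `coactSub`; `theta` translates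
this into the kernel of the explicit map `regularSub`. -/
theorem theta_mapInd_coactSub (w : δ.Ind (δ.repLeft V)) :
    δ.theta (V ⊗[ℂ] H) (δ.mapInd (δ.coactSub ρ) (δ.coactSub_rep ρ) w) =
      regularSub A ρ (δ.theta V w) := by
  refine δ.Ind_ext (δ.theta (V ⊗[ℂ] H) ∘ₗ δ.mapInd (δ.coactSub ρ) (δ.coactSub_rep ρ))
    (regularSub A ρ ∘ₗ δ.theta V) (fun a m => ?_) w
  rw [LinearMap.comp_apply, LinearMap.comp_apply, mapInd_mk, LinearMap.lTensor_tmul, theta_mk',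
    theta_mk', regularSub_mulLeft]
  congr 1
  induction m using TensorProduct.induction_on with
  | zero => simp
  | add u v hu hv => simp only [map_add, hu, hv]
  | tmul a' v => exact δ.rTensor_coact_coactSub ρ a' v

/-- By `rTensor_coact_eq`, `theta` sends a' ⊗_B (a ⊗ v) with a ⊗ v coinvariant to a'a ⊗ S(v₁) ⊗ v₀.
-/
theorem theta_mapInd {N : Type*} [AddCommGroup N] [Module ℂ N]
    {σ : δ.coinv →ₐ[ℂ] Module.End ℂ N} (i : N →ₗ[ℂ] A ⊗[ℂ] V)
    (hi : ∀ b n, i (σ b n) = δ.repLeft V b (i n))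
    (hr : ∀ n, δ.toCoaction.tensorCoact ρ (i n) = i n ⊗ₜ 1) (w : δ.Ind σ) :
    δ.theta V (δ.mapInd i hi w) = antipodeRight A ρ (δ.extend i hi w) := by
  refine δ.Ind_ext (δ.theta V ∘ₗ δ.mapInd i hi) (antipodeRight A ρ ∘ₗ δ.extend i hi)
    (fun a n => ?_) w
  rw [LinearMap.comp_apply, LinearMap.comp_apply, mapInd_mk, LinearMap.lTensor_tmul, theta_mk',
    extend_mk, antipodeRight_lmulLeft, δ.rTensor_coact_eq ρ (hr n)]

end Schneider

/-- The structure theorem for relative Hopf modules: `A ⊗_B (A ⊗ V)^{co H} = A ⊗ V`. -/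
theorem IsFaithfullyFlat.extend_bijective {H A V N : Type u} [CommRing H] [HopfAlgebra ℂ H]
    [Ring A] [Algebra ℂ A] {δ : ComoduleAlgebra H A} [AddCommGroup V] [Module ℂ V]
    [AddCommGroup N] [Module ℂ N] (hflat : δ.IsFaithfullyFlat) (hG : δ.IsHopfGalois)
    (ρ : Coaction H V) {σ : δ.coinv →ₐ[ℂ] Module.End ℂ N} (i : N →ₗ[ℂ] A ⊗[ℂ] V)
    (hi : ∀ b n, i (σ b n) = δ.repLeft V b (i n)) (hinj : Function.Injective i)
    (hrange : ∀ m, δ.toCoaction.tensorCoact ρ m = m ⊗ₜ 1 ↔ m ∈ Set.range i) :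
    Function.Bijective (δ.extend i hi) := by
  have hr : ∀ n, δ.toCoaction.tensorCoact ρ (i n) = i n ⊗ₜ 1 := fun n => (hrange _).2 ⟨n, rfl⟩
  constructor
  -- The composite of `theta` with A ⊗_B i is injective by flatness, and by `theta_mapInd` it
  -- factors through the extension.
  · rw [← LinearMap.ker_eq_bot, Submodule.eq_bot_iff]
    intro w hw
    apply (hflat.injective_iff i hi).1 hinj
    apply (δ.theta_bijective hG).1
    rw [δ.theta_mapInd ρ i hi hr, LinearMap.mem_ker.1 hw, map_zero, map_zero, map_zero]
  · intro m
    -- The preimage of m is prescribed by its `theta`-image a ⊗ S(v₁) ⊗ v₀. That image is killed by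
    -- `regularSub`, so w comes from A ⊗_B (coinvariants), and the counit recovers m from it.
    obtain ⟨w, hw⟩ := (δ.theta_bijective hG).2 (antipodeRight A ρ m)
    have h0 : δ.mapInd (δ.coactSub ρ) (δ.coactSub_rep ρ) w = 0 := by
      apply (δ.theta_bijective hG).1
      rw [theta_mapInd_coactSub, hw, regularSub_antipodeRight, map_zero]
    obtain ⟨k, hk⟩ := hflat.exists_mapInd_eq i hi (δ.coactSub ρ) (δ.coactSub_rep ρ)
      (fun m => (δ.coactSub_eq_zero ρ).trans (hrange m)) h0
    refine ⟨k, ?_⟩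
    rw [← multInd_mapInd, hk, ← counitMid_theta, hw, counitMid_antipodeRight]

end ComoduleAlgebra

/-! ### Extension of `C ⊗_B N` to `A` -/

namespace ComoduleAlgebra

section Induction

variable {H A N W : Type*} [Ring H] [HopfAlgebra ℂ H] [Ring A] [Algebra ℂ A]
  (δ : ComoduleAlgebra H A) [AddCommGroup N] [Module ℂ N] [AddCommGroup W] [Module ℂ W]

/-- The left `B`-module `C`. -/
def repES : δ.coinv →ₐ[ℂ] Module.End ℂ δ.ES := (Algebra.lmul ℂ δ.ES).comp δ.source

theorem inclES_repES (b : δ.coinv) (x : δ.ES) :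
    δ.inclES (δ.repES b x) = δ.repLeft A b (δ.inclES x) := δ.inclES_source_mul b x

theorem source_mul_target_mul (b b' : δ.coinv) (x : δ.ES) :
    δ.source b * (δ.target (.op b') * x) = δ.target (.op b') * (δ.source b * x) := by
  apply δ.inclES_injective
  simp only [inclES_source_mul, inclES_target_mul]
  exact tensor_ext ((LinearMap.mulLeft ℂ (b : A)).rTensor A ∘ₗ
      (LinearMap.mulRight ℂ (b' : A)).lTensor A)
    ((LinearMap.mulRight ℂ (b' : A)).lTensor A ∘ₗ (LinearMap.mulLeft ℂ (b : A)).rTensor A)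
    (fun _ _ => rfl) _

variable (σ : δ.coinv →ₐ[ℂ] Module.End ℂ N)

/-- `C ⊗_B N`, for a left `B`-module `N`. -/
abbrev TensES : Type _ :=
  Balanced (fun b x => δ.target (.op b) * x : δ.coinv → δ.ES → δ.ES)
    (fun b n => σ b n : δ.coinv → N → N)

/-- The projection `C ⊗ N → C ⊗_B N`. -/
abbrev mkTens : δ.ES ⊗[ℂ] N →ₗ[ℂ] δ.TensES σ := Balanced.mk _ _

/-- The left `B`-module `C ⊗_B N`. -/
def repTens : δ.coinv →ₐ[ℂ] Module.End ℂ (δ.TensES σ) :=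
  quotRep ((Module.End.rTensorAlgHom ℂ δ.ES N).comp δ.repES) (balancedRel _ _) <| by
    intro b z hz
    induction hz using Submodule.span_induction with
    | zero => simp
    | add x y _ _ hx hy => rw [map_add]; exact add_mem hx hy
    | smul r x _ hx => rw [map_smul]; exact Submodule.smul_mem _ _ hx
    | mem z hz =>
      obtain ⟨b', x, n, rfl⟩ := hz
      refine Submodule.subset_span ⟨b', δ.source b * x, n, ?_⟩
      exact (map_sub _ _ _).trans
        (congrArg (fun y => y ⊗ₜ n - _) (δ.source_mul_target_mul b b' x))

theorem repTens_mk (b : δ.coinv) (x : δ.ES) (n : N) :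
    δ.repTens σ b (δ.mkTens σ (x ⊗ₜ n)) = δ.mkTens σ ((δ.source b * x) ⊗ₜ n) := rfl

variable {σ} (ν : N →ₗ[ℂ] A ⊗[ℂ] W) (hν : ∀ b n, ν (σ b n) = δ.repLeft W b (ν n))

/-- The map `(x ⊗ x') ⊗_B n ↦ x ⊗ x' * ν n`. -/
def tensInd : δ.TensES σ →ₗ[ℂ] A ⊗[ℂ] (A ⊗[ℂ] W) :=
  Submodule.liftQ _ (star A W ∘ₗ TensorProduct.map δ.inclES ν) <| balancedRel_le _ fun b x n => by
    simp only [LinearMap.comp_apply, TensorProduct.map_tmul, inclES_target_mul, star_balanced, hν]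
    rfl

theorem tensInd_mk (x : δ.ES) (n : N) :
    δ.tensInd ν hν (δ.mkTens σ (x ⊗ₜ n)) = star A W (δ.inclES x ⊗ₜ ν n) := rfl

theorem tensInd_rep (b : δ.coinv) (z : δ.TensES σ) :
    δ.tensInd ν hν (δ.repTens σ b z) = δ.repLeft (A ⊗[ℂ] W) b (δ.tensInd ν hν z) := by
  obtain ⟨z, rfl⟩ := Submodule.mkQ_surjective _ z
  refine tensor_ext (δ.tensInd ν hν ∘ₗ δ.repTens σ b ∘ₗ δ.mkTens σ)
    (δ.repLeft (A ⊗[ℂ] W) b ∘ₗ δ.tensInd ν hν ∘ₗ δ.mkTens σ) (fun x n => ?_) z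
  simp only [LinearMap.comp_apply, repTens_mk, tensInd_mk, inclES_source_mul, star_left]
  rfl

theorem star_tmul_left (x x' : A) (Y : A ⊗[ℂ] W) :
    star A W ((x ⊗ₜ x') ⊗ₜ Y) = x ⊗ₜ lmulLeft A W x' Y :=
  tensor_ext (star A W ∘ₗ TensorProduct.mk ℂ _ _ (x ⊗ₜ x'))
    (TensorProduct.mk ℂ _ _ x ∘ₗ lmulLeft A W x') (fun _ _ => by simp) Y

variable (σ) in
/-- The map `A ⊗_B C → Hom (N, A ⊗_B (C ⊗_B N))`. -/
def curryTens : δ.Ind δ.repES →ₗ[ℂ] N →ₗ[ℂ] δ.Ind (δ.repTens σ) :=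
  Submodule.liftQ _ (TensorProduct.curry (δ.mkInd (δ.repTens σ) ∘ₗ (δ.mkTens σ).lTensor A ∘ₗ
    (TensorProduct.assoc ℂ A δ.ES N).toLinearMap)) <| balancedRel_le _ fun b a x => by
      ext n
      exact δ.mkInd_balanced (δ.repTens σ) b a (δ.mkTens σ (x ⊗ₜ n))

theorem curryTens_mk (a : A) (x : δ.ES) (n : N) :
    δ.curryTens σ (δ.mkInd δ.repES (a ⊗ₜ x)) n =
      δ.mkInd (δ.repTens σ) (a ⊗ₜ δ.mkTens σ (x ⊗ₜ n)) := rfl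

theorem extend_tensInd_curryTens (w : δ.Ind δ.repES) (n : N) :
    δ.extend (δ.tensInd ν hν) (δ.tensInd_rep ν hν) (δ.curryTens σ w n) =
      star A W (δ.extend δ.inclES δ.inclES_repES w ⊗ₜ ν n) := by
  refine δ.Ind_ext (δ.extend (δ.tensInd ν hν) (δ.tensInd_rep ν hν) ∘ₗ (δ.curryTens σ).flip n)
    (star A W ∘ₗ (TensorProduct.mk ℂ _ _).flip (ν n) ∘ₗ δ.extend δ.inclES δ.inclES_repES)
    (fun a x => ?_) w
  simp only [LinearMap.comp_apply, LinearMap.flip_apply, TensorProduct.mk_apply, curryTens_mk,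
    extend_mk, tensInd_mk, lmulLeft_eq, star_left]

/-- Right multiplication by `B` on the second tensor factor of `A ⊗ A`, on `A ⊗_B C`. -/
theorem exists_curryTens_balanced (b : δ.coinv) (w : δ.Ind δ.repES) :
    ∃ w', δ.extend δ.inclES δ.inclES_repES w' =
        (LinearMap.mulRight ℂ (b : A)).lTensor A (δ.extend δ.inclES δ.inclES_repES w) ∧
      ∀ n, δ.curryTens σ w' n = δ.curryTens σ w (σ b n) := by
  have hc : ∀ b' x, LinearMap.mulLeft ℂ (δ.target (.op b)) (δ.repES b' x) =
      δ.repES b' (LinearMap.mulLeft ℂ (δ.target (.op b)) x) := fun b' x =>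
    (δ.source_mul_target_mul b' b x).symm
  refine ⟨δ.mapInd (LinearMap.mulLeft ℂ (δ.target (.op b))) hc w, ?_, fun n => ?_⟩
  · refine δ.Ind_ext (δ.extend δ.inclES δ.inclES_repES ∘ₗ
        δ.mapInd (LinearMap.mulLeft ℂ (δ.target (.op b))) hc)
      ((LinearMap.mulRight ℂ (b : A)).lTensor A ∘ₗ δ.extend δ.inclES δ.inclES_repES)
      (fun a x => ?_) w
    rw [LinearMap.comp_apply, LinearMap.comp_apply, mapInd_mk, LinearMap.lTensor_tmul, extend_mk,
      extend_mk, LinearMap.mulLeft_apply, inclES_target_mul]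
    exact tensor_ext (lmulLeft A A a ∘ₗ (LinearMap.mulRight ℂ (b : A)).lTensor A)
      ((LinearMap.mulRight ℂ (b : A)).lTensor A ∘ₗ lmulLeft A A a) (fun _ _ => rfl) _
  · refine δ.Ind_ext ((δ.curryTens σ).flip n ∘ₗ
        δ.mapInd (LinearMap.mulLeft ℂ (δ.target (.op b))) hc)
      ((δ.curryTens σ).flip (σ b n)) (fun a x => ?_) w
    have h : δ.mkTens σ ((δ.target (.op b) * x) ⊗ₜ n) = δ.mkTens σ (x ⊗ₜ σ b n) := by
      rw [← sub_eq_zero, ← map_sub]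
      exact (Submodule.Quotient.mk_eq_zero _).2 (Submodule.subset_span ⟨b, x, n, rfl⟩)
    exact congrArg (fun y => δ.mkInd (δ.repTens σ) (a ⊗ₜ y)) h

/-- The map `y ⊗_B n ↦ (x ↦ γ (x ⊗ y) n)`. -/
def liftSnd {P : Type*} [AddCommGroup P] [Module ℂ P] (γ : A ⊗[ℂ] A →ₗ[ℂ] N →ₗ[ℂ] P)
    (h : ∀ (b : δ.coinv) x y n, γ (x ⊗ₜ (y * b)) n = γ (x ⊗ₜ y) (σ b n)) :
    δ.Ind σ →ₗ[ℂ] A →ₗ[ℂ] P :=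
  Submodule.liftQ _ (TensorProduct.lift
    ((LinearMap.lflip (R₀ := ℂ)).toLinearMap ∘ₗ (TensorProduct.curry γ).flip)) <|
      balancedRel_le _ fun b y n => by
        ext x
        exact h b x y n

/-- If `A ⊗_B N = A ⊗ W` and `A ⊗_B C = A ⊗ A`, then `A ⊗_B (C ⊗_B N) = A ⊗ (A ⊗ W)`. -/
theorem extend_tensInd_bijective
    (hκ : Function.Bijective (δ.extend δ.inclES δ.inclES_repES))
    (hb : Function.Bijective (δ.extend ν hν)) :
    Function.Bijective (δ.extend (δ.tensInd ν hν) (δ.tensInd_rep ν hν)) := by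
  let κ := LinearEquiv.ofBijective _ hκ
  let e := LinearEquiv.ofBijective _ hb
  -- The inverse follows A ⊗_B (C ⊗_B N) = (A ⊗_B C) ⊗_B N = (A ⊗ A) ⊗_B N = A ⊗ (A ⊗_B N) = A ⊗ (A
  -- ⊗ W), read from right to left; γ performs the step A ⊗ A = A ⊗_B C.
  let γ : A ⊗[ℂ] A →ₗ[ℂ] N →ₗ[ℂ] δ.Ind (δ.repTens σ) := δ.curryTens σ ∘ₗ κ.symm.toLinearMap
  -- Right multiplication by b on the second factor of A ⊗ A corresponds to the action of t(b) on C,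
  -- over which C ⊗_B N is balanced.
  have hbal : ∀ b x y n, γ (x ⊗ₜ (y * (b : δ.coinv))) n = γ (x ⊗ₜ y) (σ b n) := by
    intro b x y n
    obtain ⟨w', h1, h2⟩ := δ.exists_curryTens_balanced (σ := σ) b (κ.symm (x ⊗ₜ y))
    rw [show δ.extend δ.inclES δ.inclES_repES (κ.symm (x ⊗ₜ y)) = x ⊗ₜ y from
      κ.apply_symm_apply _] at h1
    have h4 : w' = κ.symm (x ⊗ₜ (y * b)) := κ.injective (by rw [κ.apply_symm_apply]; exact h1)
    change δ.curryTens σ (κ.symm (x ⊗ₜ (y * b))) n = δ.curryTens σ (κ.symm (x ⊗ₜ y)) (σ b n)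
    rw [← h4, h2]
  let γ' := δ.liftSnd γ hbal
  have hγ' : ∀ x y n, γ' (δ.mkInd σ (y ⊗ₜ n)) x = γ (x ⊗ₜ y) n := fun _ _ _ => rfl
  let R : A ⊗[ℂ] (A ⊗[ℂ] W) →ₗ[ℂ] δ.Ind (δ.repTens σ) :=
    TensorProduct.lift γ'.flip ∘ₗ e.symm.toLinearMap.lTensor A
  have hR : ∀ x w, R (x ⊗ₜ e w) = γ' w x := fun x w => by simp [R]
  have hRs : ∀ X n, R (star A W (X ⊗ₜ ν n)) = γ X n := fun X n =>
    tensor_ext (R ∘ₗ star A W ∘ₗ (TensorProduct.mk ℂ _ _).flip (ν n)) (γ.flip n) (fun x x' => by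
      simp only [LinearMap.comp_apply, LinearMap.flip_apply, TensorProduct.mk_apply,
        star_tmul_left]
      exact hR x (δ.mkInd σ (x' ⊗ₜ n))) X
  have hE : ∀ X n, δ.extend (δ.tensInd ν hν) (δ.tensInd_rep ν hν) (γ X n) =
      star A W (X ⊗ₜ ν n) := fun X n => by
    refine (δ.extend_tensInd_curryTens ν hν (κ.symm X) n).trans ?_
    rw [show δ.extend δ.inclES δ.inclES_repES (κ.symm X) = X from κ.apply_symm_apply X]
  refine Function.bijective_iff_has_inverse.2 ⟨R, fun w => ?_, fun z => ?_⟩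
  · refine δ.Ind_ext (R ∘ₗ δ.extend (δ.tensInd ν hν) (δ.tensInd_rep ν hν)) LinearMap.id
      (fun a z => ?_) w
    obtain ⟨z, rfl⟩ := Submodule.mkQ_surjective _ z
    refine tensor_ext (R ∘ₗ δ.extend (δ.tensInd ν hν) (δ.tensInd_rep ν hν) ∘ₗ
        δ.mkInd (δ.repTens σ) ∘ₗ TensorProduct.mk ℂ _ _ a ∘ₗ δ.mkTens σ)
      (δ.mkInd (δ.repTens σ) ∘ₗ TensorProduct.mk ℂ _ _ a ∘ₗ δ.mkTens σ) (fun x n => ?_) z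
    have h := δ.extend_tensInd_curryTens ν hν (δ.mkInd δ.repES (a ⊗ₜ x)) n
    rw [curryTens_mk] at h
    simp only [LinearMap.comp_apply, TensorProduct.mk_apply, h, hRs]
    exact congrArg (fun w => δ.curryTens σ w n) (κ.symm_apply_apply _)
  · refine tensor_ext (δ.extend (δ.tensInd ν hν) (δ.tensInd_rep ν hν) ∘ₗ R) LinearMap.id
      (fun x Y => ?_) z
    obtain ⟨w, rfl⟩ := e.surjective Y
    rw [LinearMap.comp_apply, hR]
    refine δ.Ind_ext (δ.extend (δ.tensInd ν hν) (δ.tensInd_rep ν hν) ∘ₗ γ'.flip x)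
      (TensorProduct.mk ℂ _ _ x ∘ₗ e.toLinearMap) (fun y n => ?_) w
    rw [LinearMap.comp_apply, LinearMap.flip_apply, hγ', hE, star_tmul_left]
    rfl

end Induction

end ComoduleAlgebra

/-! ### The diagonal coaction on `A ⊗ A ⊗ A` -/

namespace ComoduleAlgebra

section Diagonal

variable {H A : Type*} [Ring H] [HopfAlgebra ℂ H] [Ring A] [Algebra ℂ A] (δ : ComoduleAlgebra H A)

/-- The diagonal coaction on `A ⊗ (A ⊗ A)`. -/
def diag₃ : A ⊗[ℂ] (A ⊗[ℂ] A) →ₗ[ℂ] (A ⊗[ℂ] (A ⊗[ℂ] A)) ⊗[ℂ] H :=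
  δ.toCoaction.tensorCoact (δ.toCoaction.tensor δ.toCoaction)

theorem diag_tmul (x y : A) : δ.diag (x ⊗ₜ y) = mulTensor A A H (δ.coact x ⊗ₜ δ.coact y) := rfl

theorem diag₃_tmul (x y w : A) : δ.diag₃ (x ⊗ₜ (y ⊗ₜ w)) =
    mulTensor A (A ⊗[ℂ] A) H (δ.coact x ⊗ₜ mulTensor A A H (δ.coact y ⊗ₜ δ.coact w)) := rfl

theorem mulTensor_mul (p p' q q' : A ⊗[ℂ] H) :
    mulTensor A (A ⊗[ℂ] A) H (p ⊗ₜ mulTensor A A H ((p' * q) ⊗ₜ q')) =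
      (star A A).rTensor H (mulTensor (A ⊗[ℂ] A) (A ⊗[ℂ] A) H
        (mulTensor A A H (p ⊗ₜ p') ⊗ₜ mulTensor A A H (q ⊗ₜ q'))) := by
  refine tensor_ext₄ (mulTensor A (A ⊗[ℂ] A) H ∘ₗ (mulTensor A A H ∘ₗ
      (TensorProduct.mk ℂ _ _).flip q' ∘ₗ LinearMap.mulRight ℂ q).lTensor _)
    ((star A A).rTensor H ∘ₗ mulTensor (A ⊗[ℂ] A) (A ⊗[ℂ] A) H ∘ₗ
      (TensorProduct.mk ℂ _ _).flip (mulTensor A A H (q ⊗ₜ q')) ∘ₗ mulTensor A A H)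
    (fun x h x' h' => ?_) (p ⊗ₜ p')
  refine tensor_ext₄ (mulTensor A (A ⊗[ℂ] A) H ∘ₗ TensorProduct.mk ℂ _ _ (x ⊗ₜ h) ∘ₗ
      mulTensor A A H ∘ₗ (LinearMap.mulLeft ℂ (x' ⊗ₜ h')).rTensor _)
    ((star A A).rTensor H ∘ₗ mulTensor (A ⊗[ℂ] A) (A ⊗[ℂ] A) H ∘ₗ
      TensorProduct.mk ℂ _ _ (mulTensor A A H ((x ⊗ₜ h) ⊗ₜ (x' ⊗ₜ h'))) ∘ₗ mulTensor A A H)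
    (fun y k y' k' => ?_) (q ⊗ₜ q')
  simp [mul_assoc]

/-- Multiplicativity of δ gives x₁x'₁y₁y'₁ in H on both sides, in the same order. Consequently `mu₂`
takes coinvariant values. -/
theorem diag₃_star (X Y : A ⊗[ℂ] A) : δ.diag₃ (star A A (X ⊗ₜ Y)) =
    (star A A).rTensor H (mulTensor (A ⊗[ℂ] A) (A ⊗[ℂ] A) H (δ.diag X ⊗ₜ δ.diag Y)) :=
  tensor_ext₄ (δ.diag₃ ∘ₗ star A A) ((star A A).rTensor H ∘ₗ
      mulTensor (A ⊗[ℂ] A) (A ⊗[ℂ] A) H ∘ₗ TensorProduct.map δ.diag δ.diag)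
    (fun x x' y y' => by
      rw [LinearMap.comp_apply, star_tmul, diag₃_tmul, map_mul δ.coact, mulTensor_mul]
      rfl) (X ⊗ₜ Y)

theorem diag₃_mu₂ (z : δ.ES ⊗[ℂ] δ.ES) : δ.diag₃ (δ.mu₂ z) = δ.mu₂ z ⊗ₜ 1 :=
  tensor_ext (δ.diag₃ ∘ₗ δ.mu₂) ((TensorProduct.mk ℂ _ _).flip 1 ∘ₗ δ.mu₂) (fun x y => by
    simp [diag₃_star, diag_inclES]) z

theorem diag₃_insOne {X : A ⊗[ℂ] A} (hX : δ.diag X = X ⊗ₜ 1) :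
    δ.diag₃ (insOne A A X) = insOne A A X ⊗ₜ 1 := by
  have h : δ.diag₃ (insOne A A X) = (insOne A A).rTensor H (δ.diag X) :=
    tensor_ext (δ.diag₃ ∘ₗ insOne A A) ((insOne A A).rTensor H ∘ₗ δ.diag) (fun x y => by
      rw [LinearMap.comp_apply, insOne_tmul, diag₃_tmul, map_one, LinearMap.comp_apply, diag_tmul,
        Algebra.TensorProduct.one_def]
      exact tensor_ext₄ (mulTensor A (A ⊗[ℂ] A) H ∘ₗ (mulTensor A A H ∘ₗ
          TensorProduct.mk ℂ _ _ (1 ⊗ₜ 1)).lTensor _)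
        ((insOne A A).rTensor H ∘ₗ mulTensor A A H) (fun _ _ _ _ => by simp) (δ.coact x ⊗ₜ δ.coact y)) X
  rw [h, hX]
  rfl

/-- Identifies the threefold product with C ⊗_B (C ⊗_B C), the form for which descent yields
injectivity of `mu₃`. -/
theorem balancedRel_le_ker_joinLeft :
    balancedRel (fun b x => δ.target (.op b) * x : δ.coinv → δ.ES → δ.ES)
      (fun b q => δ.repTens δ.repES b q : δ.coinv → δ.TensES δ.repES → δ.TensES δ.repES) ≤
    LinearMap.ker (joinLeft (B := δ.coinv) (L := δ.ES) δ.source δ.target) := by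
  refine balancedRel_le _ fun b x q => ?_
  obtain ⟨z, rfl⟩ := Submodule.mkQ_surjective _ q
  let J := joinLeft (B := δ.coinv) (L := δ.ES) δ.source δ.target
  refine tensor_ext (J ∘ₗ TensorProduct.mk ℂ _ _ (δ.target (.op b) * x) ∘ₗ δ.mkES)
    (J ∘ₗ TensorProduct.mk ℂ _ _ x ∘ₗ δ.repTens δ.repES b ∘ₗ δ.mkTens δ.repES)
    (fun y w => ?_) z
  refine sub_eq_zero.1 ?_
  change (balancedRel₃ (B := δ.coinv) (L := δ.ES) δ.source δ.target).mkQ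
      ((δ.target (.op b) * x) ⊗ₜ (y ⊗ₜ w)) -
    (balancedRel₃ (B := δ.coinv) (L := δ.ES) δ.source δ.target).mkQ
      (x ⊗ₜ ((δ.source b * y) ⊗ₜ w)) = 0
  rw [← map_sub]
  exact (Submodule.Quotient.mk_eq_zero _).2 (Submodule.subset_span (Or.inl ⟨b, x, y, w, rfl⟩))

end Diagonal

/-- The left `B`-module of coinvariants of `A ⊗ V`. -/
def repCoinv {H A V : Type*} [CommRing H] [HopfAlgebra ℂ H] [Ring A] [Algebra ℂ A]
    (δ : ComoduleAlgebra H A) [AddCommGroup V] [Module ℂ V] (ρ : Coaction H V) :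
    δ.coinv →ₐ[ℂ] Module.End ℂ (LinearMap.ker (δ.coactSub ρ)) :=
  subRep (δ.repLeft V) (LinearMap.ker (δ.coactSub ρ)) (fun b m hm => by
    rw [LinearMap.mem_ker] at hm ⊢
    rw [coactSub_rep, hm, map_zero])

theorem subtype_repCoinv {H A V : Type*} [CommRing H] [HopfAlgebra ℂ H] [Ring A] [Algebra ℂ A]
    (δ : ComoduleAlgebra H A) [AddCommGroup V] [Module ℂ V] (ρ : Coaction H V) (b : δ.coinv)
    (m : LinearMap.ker (δ.coactSub ρ)) : (LinearMap.ker (δ.coactSub ρ)).subtype (δ.repCoinv ρ b m) =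
      δ.repLeft V b ((LinearMap.ker (δ.coactSub ρ)).subtype m) := rfl

/-! ### Descent for `mu₂` and `mu₃` -/

section Flat

variable {H A : Type u} [CommRing H] [HopfAlgebra ℂ H] [Ring A] [Algebra ℂ A]
  {δ : ComoduleAlgebra H A} (hflat : δ.IsFaithfullyFlat) (hG : δ.IsHopfGalois)
include hflat

theorem IsFaithfullyFlat.injective_of_extend {N W : Type u} [AddCommGroup N] [Module ℂ N]
    [AddCommGroup W] [Module ℂ W] {σ : δ.coinv →ₐ[ℂ] Module.End ℂ N} (ν : N →ₗ[ℂ] A ⊗[ℂ] W)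
    (hν : ∀ b n, ν (σ b n) = δ.repLeft W b (ν n)) (h : Function.Injective (δ.extend ν hν)) :
    Function.Injective ν := by
  refine (hflat.injective_iff ν hν).2 (Function.Injective.of_comp (f := δ.multInd W) ?_)
  convert h using 1
  ext w
  exact δ.multInd_mapInd ν hν w


/-- The extension of ν is that of i after A ⊗_B F. The former is onto and the latter is injective,
so A ⊗_B F is onto, and surjectivity descends to F. -/
theorem IsFaithfullyFlat.surjective_of_extend {N E V : Type u} [AddCommGroup N] [Module ℂ N]
    [AddCommGroup E] [Module ℂ E] [AddCommGroup V] [Module ℂ V]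
    {σ : δ.coinv →ₐ[ℂ] Module.End ℂ N} {τ : δ.coinv →ₐ[ℂ] Module.End ℂ E}
    (i : E →ₗ[ℂ] A ⊗[ℂ] V) (hi : ∀ b n, i (τ b n) = δ.repLeft V b (i n))
    (hinj : Function.Injective (δ.extend i hi)) (F : N →ₗ[ℂ] E)
    (hF : ∀ b n, F (σ b n) = τ b (F n)) (ν : N →ₗ[ℂ] A ⊗[ℂ] V)
    (hν : ∀ b n, ν (σ b n) = δ.repLeft V b (ν n)) (h : ∀ n, i (F n) = ν n)
    (hs : Function.Surjective (δ.extend ν hν)) : Function.Surjective F := by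
  refine hflat.surjective F hF (fun w => ?_)
  obtain ⟨k, hk⟩ := hs (δ.extend i hi w)
  refine ⟨k, hinj (Eq.trans ?_ hk)⟩
  refine δ.Ind_ext (δ.extend i hi ∘ₗ δ.mapInd F hF) (δ.extend ν hν) (fun a n => ?_) k
  rw [LinearMap.comp_apply, mapInd_mk, LinearMap.lTensor_tmul, extend_mk, extend_mk, h]

include hG

/-- The structure theorem for V = A, where the coinvariants are C. -/
theorem IsFaithfullyFlat.extend_inclES_bijective :
    Function.Bijective (δ.extend δ.inclES δ.inclES_repES) :=
  hflat.extend_bijective hG δ.toCoaction δ.inclES δ.inclES_repES δ.inclES_injective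
    (fun _ => ⟨fun h => δ.exists_inclES_eq h, fun ⟨x, hx⟩ => hx ▸ δ.diag_inclES x⟩)

theorem IsFaithfullyFlat.extend_subtype_bijective {V : Type u} [AddCommGroup V] [Module ℂ V]
    (ρ : Coaction H V) : Function.Bijective
      (δ.extend (N := LinearMap.ker (δ.coactSub ρ)) (σ := δ.repCoinv ρ) (LinearMap.ker (δ.coactSub ρ)).subtype
        (δ.subtype_repCoinv ρ)) :=
  hflat.extend_bijective hG ρ _ _ Subtype.val_injective (fun m => by
    rw [← δ.coactSub_eq_zero ρ]
    exact ⟨fun h => ⟨⟨m, h⟩, rfl⟩, fun ⟨n, hn⟩ => hn ▸ n.2⟩)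

/-- After A ⊗_B - both C ⊗_B C and the coinvariants of A ⊗ A ⊗ A become A ⊗ A ⊗ A. So `mu₂` reaches
every coinvariant, in particular a ⊗ 1 ⊗ a'. -/
theorem IsFaithfullyFlat.exists_mu₂_eq (x : δ.ES) :
    ∃ z, δ.mu₂ z = insOne A A (δ.inclES x) := by
  let ρ := δ.toCoaction.tensor δ.toCoaction
  have hmem : ∀ m, m ∈ LinearMap.ker (δ.coactSub ρ) ↔ δ.diag₃ m = m ⊗ₜ 1 := fun m =>
    LinearMap.mem_ker.trans (δ.coactSub_eq_zero ρ)
  have hν : ∀ w, δ.tensInd δ.inclES δ.inclES_repES w ∈ LinearMap.ker (δ.coactSub ρ) := by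
    intro w
    obtain ⟨z, rfl⟩ := Submodule.mkQ_surjective _ w
    exact (hmem _).2 (δ.diag₃_mu₂ z)
  have hs := hflat.surjective_of_extend _ (δ.subtype_repCoinv ρ)
    (hflat.extend_subtype_bijective hG ρ).1
    ((δ.tensInd δ.inclES δ.inclES_repES).codRestrict _ hν)
    (fun b n => Subtype.ext (δ.tensInd_rep δ.inclES δ.inclES_repES b n)) _
    (δ.tensInd_rep δ.inclES δ.inclES_repES) (fun _ => rfl) (δ.extend_tensInd_bijective δ.inclES δ.inclES_repES (hflat.extend_inclES_bijective hG)
      (hflat.extend_inclES_bijective hG)).2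
  obtain ⟨w, hw⟩ := hs ⟨insOne A A (δ.inclES x), (hmem _).2 (δ.diag₃_insOne (δ.diag_inclES x))⟩
  obtain ⟨z, rfl⟩ := Submodule.mkQ_surjective _ w
  exact ⟨z, congrArg Subtype.val hw⟩

/-- From A ⊗_B C = A ⊗ A, two applications of `extend_tensInd_bijective` make the extensions of
`mu₂` and `mu₃` bijective; injectivity then descends. -/
theorem IsFaithfullyFlat.isBalancedFaithful : δ.IsBalancedFaithful := by
  have hκ := hflat.extend_inclES_bijective hG
  have h2 := δ.extend_tensInd_bijective δ.inclES δ.inclES_repES hκ hκ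
  have h3 := δ.extend_tensInd_bijective (δ.tensInd δ.inclES δ.inclES_repES)
    (δ.tensInd_rep δ.inclES δ.inclES_repES) hκ h2
  have i2 := hflat.injective_of_extend _ _ h2.1
  have i3 := hflat.injective_of_extend _ _ h3.1
  refine ⟨fun z hz => i2 (hz.trans (map_zero _).symm), fun z hz => ?_,
    hflat.exists_mu₂_eq hG⟩
  have h0 : (δ.mkTens δ.repES).lTensor δ.ES z ∈ balancedRel
      (fun b x => δ.target (.op b) * x : δ.coinv → δ.ES → δ.ES)
      (fun b q => δ.repTens δ.repES b q : δ.coinv → δ.TensES δ.repES → δ.TensES δ.repES) := by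
    refine (Submodule.Quotient.mk_eq_zero _).1 (i3 (Eq.trans ?_ (map_zero _).symm))
    refine Eq.trans ?_ hz
    exact tensor_ext (δ.tensInd (δ.tensInd δ.inclES δ.inclES_repES)
        (δ.tensInd_rep δ.inclES δ.inclES_repES) ∘ₗ δ.mkTens (δ.repTens δ.repES) ∘ₗ
        (δ.mkTens δ.repES).lTensor δ.ES) δ.mu₃ (fun _ _ => rfl) z
  have h1 := δ.balancedRel_le_ker_joinLeft h0
  refine (Submodule.Quotient.mk_eq_zero _).1 (Eq.trans ?_ h1)
  exact tensor_ext (balancedRel₃ (B := δ.coinv) (L := δ.ES) δ.source δ.target).mkQ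
    (joinLeft (B := δ.coinv) (L := δ.ES) δ.source δ.target ∘ₗ (δ.mkTens δ.repES).lTensor δ.ES)
    (fun _ _ => rfl) z

end Flat

end ComoduleAlgebra

/-! ## Direct sum decompositions -/

/-- A decomposition of a vector space as a direct sum indexed by `I`, given by the map that sends an
element to the family of its components. -/
structure Splitting (I M : Type*) [AddCommGroup M] [Module ℂ M] where
  /-- the components of an element -/
  dec : M →ₗ[ℂ] I →₀ M
  sum_dec : ∀ m, Finsupp.lsum ℂ (fun _ : I => (LinearMap.id : M →ₗ[ℂ] M)) (dec m) = m
  dec_dec : ∀ m i, dec (dec m i) = Finsupp.single i (dec m i)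

namespace Splitting

variable {I J K M N P : Type*} [AddCommGroup M] [Module ℂ M] [AddCommGroup N] [Module ℂ N]
  [AddCommMonoid P] [Module ℂ P]

/-- The homogeneous elements of degree `i`. -/
def piece (S : Splitting I M) (i : I) : Submodule ℂ M :=
  LinearMap.eqLocus S.dec (Finsupp.lsingle i)

theorem mem_piece {S : Splitting I M} {i : I} {m : M} :
    m ∈ S.piece i ↔ S.dec m = Finsupp.single i m := Iff.rfl

theorem dec_mem (S : Splitting I M) (m : M) (i : I) : S.dec m i ∈ S.piece i := S.dec_dec m i

/-- A linear identity can be checked on homogeneous elements. -/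
theorem ext (S : Splitting I M) (f g : M →ₗ[ℂ] P) (h : ∀ i, ∀ m ∈ S.piece i, f m = g m) (m : M) :
    f m = g m := by
  rw [← S.sum_dec m, Finsupp.lsum_apply, Finsupp.sum, map_sum, map_sum]
  exact Finset.sum_congr rfl fun i _ => h i _ (S.dec_mem m i)

theorem ext₂ (S : Splitting I M) (T : Splitting J N) (f g : M ⊗[ℂ] N →ₗ[ℂ] P)
    (h : ∀ i, ∀ m ∈ S.piece i, ∀ j, ∀ n ∈ T.piece j, f (m ⊗ₜ n) = g (m ⊗ₜ n)) (z : M ⊗[ℂ] N) :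
    f z = g z :=
  tensor_ext f g (fun m n => S.ext (f ∘ₗ (TensorProduct.mk ℂ _ _).flip n)
    (g ∘ₗ (TensorProduct.mk ℂ _ _).flip n) (fun i m hm => T.ext (f ∘ₗ TensorProduct.mk ℂ _ _ m)
      (g ∘ₗ TensorProduct.mk ℂ _ _ m) (h i m hm) n) m) z

theorem ext₄ {I' J' M' N' : Type*} [AddCommGroup M'] [Module ℂ M'] [AddCommGroup N'] [Module ℂ N']
    (S : Splitting I M) (T : Splitting J N) (S' : Splitting I' M') (T' : Splitting J' N')
    (f g : (M ⊗[ℂ] N) ⊗[ℂ] (M' ⊗[ℂ] N') →ₗ[ℂ] P)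
    (h : ∀ i, ∀ m ∈ S.piece i, ∀ j, ∀ n ∈ T.piece j, ∀ i', ∀ m' ∈ S'.piece i', ∀ j',
      ∀ n' ∈ T'.piece j', f ((m ⊗ₜ n) ⊗ₜ (m' ⊗ₜ n')) = g ((m ⊗ₜ n) ⊗ₜ (m' ⊗ₜ n')))
    (z : (M ⊗[ℂ] N) ⊗[ℂ] (M' ⊗[ℂ] N')) : f z = g z :=
  tensor_ext f g (fun x y => S.ext₂ T (f ∘ₗ (TensorProduct.mk ℂ _ _).flip y)
    (g ∘ₗ (TensorProduct.mk ℂ _ _).flip y) (fun i m hm j n hn => S'.ext₂ T'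
      (f ∘ₗ TensorProduct.mk ℂ _ _ (m ⊗ₜ n)) (g ∘ₗ TensorProduct.mk ℂ _ _ (m ⊗ₜ n))
      (h i m hm j n hn) y) x) z

/-- The operator that multiplies the homogeneous elements of degree `i` by `c i`. -/
def scale (S : Splitting I M) (c : I → ℂ) : M →ₗ[ℂ] M :=
  Finsupp.lsum ℂ (fun i => c i • (LinearMap.id : M →ₗ[ℂ] M)) ∘ₗ S.dec

theorem scale_of_mem {S : Splitting I M} (c : I → ℂ) {i : I} {m : M} (hm : m ∈ S.piece i) :
    S.scale c m = c i • m := by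
  simp [scale, mem_piece.1 hm]

theorem scale_scale (S : Splitting I M) (c d : I → ℂ) (m : M) :
    S.scale c (S.scale d m) = S.scale (fun i => c i * d i) m :=
  S.ext (S.scale c ∘ₗ S.scale d) (S.scale fun i => c i * d i) (fun i m hm => by
    simp [scale_of_mem _ hm, smul_smul, mul_comm]) m

theorem scale_eq_self (S : Splitting I M) {c : I → ℂ} (hc : ∀ i, c i = 1) (m : M) :
    S.scale c m = m :=
  S.ext (S.scale c) LinearMap.id (fun i m hm => by simp [scale_of_mem _ hm, hc]) m

theorem scale_bijective (S : Splitting I M) {c : I → ℂ} (hc : ∀ i, c i ≠ 0) :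
    Function.Bijective (S.scale c) :=
  Function.bijective_iff_has_inverse.2 ⟨S.scale (fun i => (c i)⁻¹),
    fun m => by rw [scale_scale]; exact S.scale_eq_self (fun i => inv_mul_cancel₀ (hc i)) m,
    fun m => by rw [scale_scale]; exact S.scale_eq_self (fun i => mul_inv_cancel₀ (hc i)) m⟩

theorem scale_map (S : Splitting I M) (T : Splitting J N) (F : M →ₗ[ℂ] N) (f : I → J)
    (hF : ∀ i, ∀ m ∈ S.piece i, F m ∈ T.piece (f i)) (c : J → ℂ) (m : M) :
    T.scale c (F m) = F (S.scale (fun i => c (f i)) m) :=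
  S.ext (T.scale c ∘ₗ F) (F ∘ₗ S.scale fun i => c (f i)) (fun i m hm => by
    simp [scale_of_mem _ hm, scale_of_mem _ (hF i m hm)]) m

theorem dec_map (S : Splitting I M) (T : Splitting J N) (F : M →ₗ[ℂ] N) (f : I → J)
    (hF : ∀ i, ∀ m ∈ S.piece i, F m ∈ T.piece (f i)) (m : M) :
    T.dec (F m) = Finsupp.mapRange.linearMap F (Finsupp.lmapDomain M ℂ f (S.dec m)) :=
  S.ext (T.dec ∘ₗ F) (Finsupp.mapRange.linearMap F ∘ₗ Finsupp.lmapDomain M ℂ f ∘ₗ S.dec)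
    (fun i m hm => by simp [mem_piece.1 hm, mem_piece.1 (hF i m hm)]) m

/-- The decomposition with index set `J` obtained from one with index set `I` and `f : I → J`. -/
def coarsen (S : Splitting I M) (f : I → J) : Splitting J M where
  dec := Finsupp.lmapDomain M ℂ f ∘ₗ S.dec
  sum_dec m := S.ext (Finsupp.lsum ℂ (fun _ : J => (LinearMap.id : M →ₗ[ℂ] M)) ∘ₗ
    Finsupp.lmapDomain M ℂ f ∘ₗ S.dec) LinearMap.id (fun i m hm => by simp [mem_piece.1 hm]) m
  dec_dec m j := S.ext (Finsupp.lmapDomain M ℂ f ∘ₗ S.dec ∘ₗ Finsupp.lapply j ∘ₗ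
      Finsupp.lmapDomain M ℂ f ∘ₗ S.dec) (Finsupp.lsingle j ∘ₗ Finsupp.lapply j ∘ₗ
      Finsupp.lmapDomain M ℂ f ∘ₗ S.dec) (fun i m hm => by
    classical
    simp only [LinearMap.comp_apply, mem_piece.1 hm, Finsupp.lmapDomain_apply,
      Finsupp.mapDomain_single, Finsupp.lapply_apply, Finsupp.single_apply]
    split_ifs with h
    · simp [mem_piece.1 hm, h]
    · simp) m

theorem mem_coarsen {S : Splitting I M} {i : I} {m : M} (hm : m ∈ S.piece i) (f : I → J) :
    m ∈ (S.coarsen f).piece (f i) := by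
  simp [mem_piece, coarsen, mem_piece.1 hm]

/-- Only fine degrees over j occur in m, so weights need to be compared there alone. This suits
elements of C, for which only the first degrees and the sum of the second ones are fixed. -/
theorem scale_of_mem_coarsen (S : Splitting I M) (f : I → J) {c c' : I → ℂ} {j : J} {d : ℂ}
    (hc : ∀ i, f i = j → c i = d * c' i) {m : M} (hm : m ∈ (S.coarsen f).piece j) :
    S.scale c m = d • S.scale c' m := by
  classical
  have h := S.ext (S.scale c ∘ₗ Finsupp.lapply j ∘ₗ (S.coarsen f).dec)
    (d • S.scale c' ∘ₗ Finsupp.lapply j ∘ₗ (S.coarsen f).dec) (fun i m hm => by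
      simp only [LinearMap.comp_apply, LinearMap.smul_apply, mem_piece.1 (mem_coarsen hm f),
        Finsupp.lapply_apply, Finsupp.single_apply]
      split_ifs with h
      · rw [scale_of_mem _ hm, scale_of_mem _ hm, hc i h, smul_smul]
      · simp) m
  simpa [mem_piece.1 hm] using h

theorem map_mem_coarsen (S : Splitting I M) (T : Splitting K N) (F : M →ₗ[ℂ] N) (f : I → J)
    (h : J → K) (hF : ∀ i, ∀ m ∈ S.piece i, F m ∈ T.piece (h (f i))) {j : J} {m : M}
    (hm : m ∈ (S.coarsen f).piece j) : F m ∈ T.piece (h j) := by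
  have e := S.dec_map T F (h ∘ f) hF m
  rw [Finsupp.lmapDomain_apply, Finsupp.mapDomain_comp,
    show Finsupp.mapDomain f (S.dec m) = Finsupp.single j m from hm] at e
  simpa [mem_piece] using e

theorem mem_piece_of_coarsen (S : Splitting I M) {f : I → J} (hf : Function.Injective f) {i : I}
    {m : M} (hm : m ∈ (S.coarsen f).piece (f i)) : m ∈ S.piece i := by
  have h := mem_piece.1 hm
  rw [← Finsupp.mapDomain_single] at h
  exact Finsupp.mapDomain_injective hf h

theorem eq_zero_of_coarsen (S : Splitting I M) {f : I → J} {j : J} (hj : ∀ i, f i ≠ j) {m : M}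
    (hm : m ∈ (S.coarsen f).piece j) : m = 0 := by
  have h := DFunLike.congr_fun (mem_piece.1 hm) j
  rw [Finsupp.single_eq_same] at h
  rw [← h]
  exact Finsupp.mapDomain_of_notMem_range _ _ (fun ⟨i, hi⟩ => hj i hi)

/-- The decomposition of `M ⊗ N` induced by decompositions of `M` and `N`. -/
def tensor (S : Splitting I M) (T : Splitting J N) : Splitting (I × J) (M ⊗[ℂ] N) where
  dec := (finsuppTensorFinsupp ℂ ℂ M N I J).toLinearMap ∘ₗ TensorProduct.map S.dec T.dec
  sum_dec z := S.ext₂ T (Finsupp.lsum ℂ (fun _ : I × J => LinearMap.id) ∘ₗ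
      (finsuppTensorFinsupp ℂ ℂ M N I J).toLinearMap ∘ₗ TensorProduct.map S.dec T.dec)
    LinearMap.id (fun i m hm j n hn => by simp [mem_piece.1 hm, mem_piece.1 hn]) z
  dec_dec z k := S.ext₂ T (((finsuppTensorFinsupp ℂ ℂ M N I J).toLinearMap ∘ₗ
      TensorProduct.map S.dec T.dec) ∘ₗ Finsupp.lapply k ∘ₗ
      (finsuppTensorFinsupp ℂ ℂ M N I J).toLinearMap ∘ₗ TensorProduct.map S.dec T.dec)
    (Finsupp.lsingle k ∘ₗ Finsupp.lapply k ∘ₗ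
      (finsuppTensorFinsupp ℂ ℂ M N I J).toLinearMap ∘ₗ TensorProduct.map S.dec T.dec)
    (fun i m hm j n hn => by
      classical
      simp only [LinearMap.comp_apply, TensorProduct.map_tmul, mem_piece.1 hm, mem_piece.1 hn,
        LinearEquiv.coe_coe, finsuppTensorFinsupp_single, Finsupp.lapply_apply,
        Finsupp.single_apply]
      split_ifs with h
      · simp [mem_piece.1 hm, mem_piece.1 hn, h]
      · simp) z

theorem tmul_mem {S : Splitting I M} {T : Splitting J N} {i : I} {j : J} {m : M} {n : N}
    (hm : m ∈ S.piece i) (hn : n ∈ T.piece j) : m ⊗ₜ n ∈ (S.tensor T).piece (i, j) := by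
  simp [mem_piece, tensor, mem_piece.1 hm, mem_piece.1 hn]

/-- A homogeneous tensor need not be pure. The identity relating the components of z to those of F z
is linear in z, so it may be checked on pure homogeneous tensors and then evaluated at z. -/
theorem map_mem_tensor (S : Splitting I M) (T : Splitting J N) {Q : Type*} [AddCommGroup Q]
    [Module ℂ Q] (U : Splitting K Q) (F : M ⊗[ℂ] N →ₗ[ℂ] Q) (f : I × J → K)
    (hF : ∀ i, ∀ m ∈ S.piece i, ∀ j, ∀ n ∈ T.piece j, F (m ⊗ₜ n) ∈ U.piece (f (i, j)))
    (k : I × J) (z : M ⊗[ℂ] N) (hz : z ∈ (S.tensor T).piece k) : F z ∈ U.piece (f k) := by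
  have h := S.ext₂ T (U.dec ∘ₗ F) (Finsupp.mapRange.linearMap F ∘ₗ
    Finsupp.lmapDomain (M ⊗[ℂ] N) ℂ f ∘ₗ (S.tensor T).dec) (fun i m hm j n hn => by
      simp [mem_piece.1 (tmul_mem hm hn), mem_piece.1 (hF i m hm j n hn)]) z
  simpa [mem_piece, mem_piece.1 hz] using h

theorem map_mem_tensor₄ {I' J' M' N' : Type*} [AddCommGroup M'] [Module ℂ M'] [AddCommGroup N']
    [Module ℂ N'] (S : Splitting I M) (T : Splitting J N) (S' : Splitting I' M')
    (T' : Splitting J' N') {Q : Type*} [AddCommGroup Q] [Module ℂ Q] (U : Splitting K Q)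
    (F : (M ⊗[ℂ] N) ⊗[ℂ] (M' ⊗[ℂ] N') →ₗ[ℂ] Q) (f : (I × J) × (I' × J') → K)
    (hF : ∀ i, ∀ m ∈ S.piece i, ∀ j, ∀ n ∈ T.piece j, ∀ i', ∀ m' ∈ S'.piece i', ∀ j',
      ∀ n' ∈ T'.piece j', F ((m ⊗ₜ n) ⊗ₜ (m' ⊗ₜ n')) ∈ U.piece (f ((i, j), (i', j'))))
    (k : (I × J) × (I' × J')) (z : (M ⊗[ℂ] N) ⊗[ℂ] (M' ⊗[ℂ] N'))
    (hz : z ∈ ((S.tensor T).tensor (S'.tensor T')).piece k) : F z ∈ U.piece (f k) := by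
  have h := S.ext₄ T S' T' (U.dec ∘ₗ F) (Finsupp.mapRange.linearMap F ∘ₗ
    Finsupp.lmapDomain _ ℂ f ∘ₗ ((S.tensor T).tensor (S'.tensor T')).dec)
    (fun i m hm j n hn i' m' hm' j' n' hn' => by
      simp [mem_piece.1 (tmul_mem (tmul_mem hm hn) (tmul_mem hm' hn')),
        mem_piece.1 (hF i m hm j n hn i' m' hm' j' n' hn')]) z
  simpa [mem_piece, mem_piece.1 hz] using h

theorem tmul_mem_coarsen_fst {S : Splitting I M} (T : Splitting J N) (f : I → K) {i : I} {m : M}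
    (hm : m ∈ S.piece i) (n : N) :
    m ⊗ₜ n ∈ ((S.tensor T).coarsen fun i => f i.1).piece (f i) :=
  T.ext (((S.tensor T).coarsen fun i => f i.1).dec ∘ₗ TensorProduct.mk ℂ M N m)
    (Finsupp.lsingle (f i) ∘ₗ TensorProduct.mk ℂ M N m)
    (fun _ _ hn => mem_coarsen (tmul_mem hm hn) fun i => f i.1) n

theorem scale_lTensor (S : Splitting I M) (T : Splitting J N) (c : J → ℂ) (z : M ⊗[ℂ] N) :
    (T.scale c).lTensor M z = (S.tensor T).scale (fun i => c i.2) z :=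
  S.ext₂ T ((T.scale c).lTensor M) ((S.tensor T).scale fun i => c i.2) (fun i m hm j n hn => by
    simp [scale_of_mem _ hn, scale_of_mem _ (tmul_mem hm hn)]) z

theorem tmul_mem_coarsen {I' J' : Type*} {S : Splitting I M} {T : Splitting J N} (f : I → I')
    (g : J → J') {i : I'} {j : J'} {m : M} {n : N} (hm : m ∈ (S.coarsen f).piece i)
    (hn : n ∈ (T.coarsen g).piece j) :
    m ⊗ₜ n ∈ ((S.tensor T).coarsen (Prod.map f g)).piece (i, j) := by
  have h : ((S.tensor T).coarsen (Prod.map f g)).dec (m ⊗ₜ n) =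
      ((S.coarsen f).tensor (T.coarsen g)).dec (m ⊗ₜ n) :=
    S.ext₂ T ((S.tensor T).coarsen (Prod.map f g)).dec
      ((S.coarsen f).tensor (T.coarsen g)).dec (fun i m hm j n hn => by
        rw [mem_piece.1 (mem_coarsen (tmul_mem hm hn) _),
          mem_piece.1 (tmul_mem (mem_coarsen hm f) (mem_coarsen hn g))]
        rfl) _
  rw [mem_piece, h, mem_piece.1 (tmul_mem hm hn)]

theorem mapRange_injective {ι : N →ₗ[ℂ] M} (hι : Function.Injective ι) :
    Function.Injective (Finsupp.mapRange.linearMap (α := I) ι) :=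
  Finsupp.mapRange_injective ι (map_zero ι) hι

theorem exists_mapRange_eq (S : Splitting I M) {ι : N →ₗ[ℂ] M} (hι : Function.Injective ι) {n : N}
    (h : ∀ i, ∃ n', ι n' = S.dec (ι n) i) : ∃ f, Finsupp.mapRange.linearMap ι f = S.dec (ι n) := by
  choose f hf using h
  refine ⟨Finsupp.onFinset (S.dec (ι n)).support f (fun i hi => ?_), Finsupp.ext hf⟩
  rw [Finsupp.mem_support_iff, ← hf]
  exact fun h0 => hi (hι (h0.trans (map_zero ι).symm))

/-- The components of the elements of a subspace that contains them. -/
def restrictDec (S : Splitting I M) (ι : N →ₗ[ℂ] M) (hι : Function.Injective ι)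
    (h : ∀ n i, ∃ n', ι n' = S.dec (ι n) i) : N →ₗ[ℂ] I →₀ N :=
  (LinearEquiv.ofInjective _ (mapRange_injective hι)).symm.toLinearMap ∘ₗ
    (S.dec ∘ₗ ι).codRestrict (LinearMap.range (Finsupp.mapRange.linearMap ι))
      (fun n => S.exists_mapRange_eq hι (h n))

theorem mapRange_restrictDec (S : Splitting I M) (ι : N →ₗ[ℂ] M) (hι : Function.Injective ι)
    (h : ∀ n i, ∃ n', ι n' = S.dec (ι n) i) (n : N) :
    Finsupp.mapRange.linearMap ι (S.restrictDec ι hι h n) = S.dec (ι n) :=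
  congrArg Subtype.val
    ((LinearEquiv.ofInjective _ (mapRange_injective (I := I) hι)).apply_symm_apply _)

/-- The decomposition of a subspace that contains the components of its elements. -/
def restrict (S : Splitting I M) (ι : N →ₗ[ℂ] M) (hι : Function.Injective ι)
    (h : ∀ n i, ∃ n', ι n' = S.dec (ι n) i) : Splitting I N where
  dec := S.restrictDec ι hι h
  sum_dec n := hι <| by
    have e : ∀ f : I →₀ N, ι (Finsupp.lsum ℂ (fun _ : I => (LinearMap.id : N →ₗ[ℂ] N)) f) =
        Finsupp.lsum ℂ (fun _ : I => (LinearMap.id : M →ₗ[ℂ] M))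
          (Finsupp.mapRange.linearMap ι f) := fun f =>
      LinearMap.congr_fun (f := ι ∘ₗ Finsupp.lsum ℂ (fun _ : I => (LinearMap.id : N →ₗ[ℂ] N)))
        (g := Finsupp.lsum ℂ (fun _ : I => (LinearMap.id : M →ₗ[ℂ] M)) ∘ₗ
          Finsupp.mapRange.linearMap ι) (Finsupp.lhom_ext fun _ _ => by simp) f
    rw [e, mapRange_restrictDec, S.sum_dec]
  dec_dec n i := mapRange_injective hι <| by
    have e : ι (S.restrictDec ι hι h n i) = S.dec (ι n) i :=
      DFunLike.congr_fun (S.mapRange_restrictDec ι hι h n) i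
    rw [mapRange_restrictDec, e, S.dec_dec, Finsupp.mapRange.linearMap_apply,
      Finsupp.mapRange_single, e]

theorem mem_restrict (S : Splitting I M) {ι : N →ₗ[ℂ] M} (hι : Function.Injective ι)
    (h : ∀ n i, ∃ n', ι n' = S.dec (ι n) i) {n : N} {i : I} :
    n ∈ (S.restrict ι hι h).piece i ↔ ι n ∈ S.piece i := by
  rw [mem_piece, mem_piece, ← (mapRange_injective hι).eq_iff]
  change Finsupp.mapRange.linearMap ι (S.restrictDec ι hι h n) = _ ↔ _
  rw [mapRange_restrictDec, Finsupp.mapRange.linearMap_apply, Finsupp.mapRange_single]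

/-- The decomposition with one homogeneous component. -/
def trivial (i : I) : Splitting I M where
  dec := Finsupp.lsingle i
  sum_dec m := by simp
  dec_dec m j := by
    by_cases h : i = j
    · rw [h]
      rfl
    · simp [Finsupp.lsingle_apply, Finsupp.single_eq_of_ne' h]

theorem mem_trivial (i : I) (m : M) : m ∈ (trivial i : Splitting I M).piece i := rfl

/-- An internal direct sum, as a splitting. -/
def ofDecomposition [DecidableEq I] (ℳ : I → Submodule ℂ M) [DirectSum.Decomposition ℳ] :
    Splitting I M where
  dec := DirectSum.toModule ℂ I (I →₀ M) (fun i => Finsupp.lsingle i ∘ₗ (ℳ i).subtype) ∘ₗ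
    (DirectSum.decomposeLinearEquiv ℳ).toLinearMap
  sum_dec m := by
    induction m using DirectSum.Decomposition.inductionOn ℳ with
    | zero => simp
    | add a b ha hb => rw [map_add, map_add, ha, hb]
    | homogeneous m => simp
  dec_dec m i := by
    induction m using DirectSum.Decomposition.inductionOn ℳ with
    | zero => simp
    | add a b ha hb => simp only [map_add, Finsupp.add_apply, ha, hb, Finsupp.single_add]
    | @homogeneous j m =>
      simp only [LinearMap.comp_apply, LinearEquiv.coe_coe,
        DirectSum.decomposeLinearEquiv_apply_coe, DirectSum.toModule_lof, Submodule.subtype_apply,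
        Finsupp.lsingle_apply, Finsupp.single_apply]
      split_ifs with h
      · simp [h]
      · simp

theorem mem_ofDecomposition [DecidableEq I] (ℳ : I → Submodule ℂ M) [DirectSum.Decomposition ℳ]
    {i : I} {m : M} : m ∈ (ofDecomposition ℳ).piece i ↔ m ∈ ℳ i := by
  rw [mem_piece]
  constructor
  · intro h
    have h1 : ∀ m j, (ofDecomposition ℳ).dec m j ∈ ℳ j := by
      intro m j
      induction m using DirectSum.Decomposition.inductionOn ℳ with
      | zero => simp
      | add a b ha hb => rw [map_add, Finsupp.add_apply]; exact add_mem ha hb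
      | @homogeneous k m =>
        simp only [ofDecomposition, LinearMap.comp_apply, LinearEquiv.coe_coe,
          DirectSum.decomposeLinearEquiv_apply_coe, DirectSum.toModule_lof,
          Submodule.subtype_apply, Finsupp.lsingle_apply, Finsupp.single_apply]
        split_ifs with h
        · exact h ▸ m.2
        · exact zero_mem _
    have h2 := h1 m i
    rwa [h, Finsupp.single_eq_same] at h2
  · intro h
    lift m to ℳ i using h
    simp [ofDecomposition]

/-- Let `F, F₂ : M → P` be linear maps with a common retraction, such that `F` preserves the degree
and `F₂` changes it by `f`. Then the components of an element on which `F` and `F₂` agree are such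
elements too, and those in the degrees outside of the range of `f` vanish. -/
theorem dec_eq_mapDomain (S : Splitting I M) {Q : Type*} [AddCommGroup Q] [Module ℂ Q]
    (T : Splitting I Q) (F F₂ : M →ₗ[ℂ] Q) (f : I → I) (R : Q →ₗ[ℂ] M) (hF : ∀ m, R (F m) = m)
    (hF₂ : ∀ m, R (F₂ m) = m) (h : ∀ i, ∀ m ∈ S.piece i, F m ∈ T.piece i)
    (h₂ : ∀ i, ∀ m ∈ S.piece i, F₂ m ∈ T.piece (f i)) {m : M} (hm : F m = F₂ m) :
    S.dec m = Finsupp.mapDomain f (S.dec m) ∧ ∀ i, F (S.dec m i) = F₂ (S.dec m i) := by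
  have e1 := S.dec_map T F id h m
  have e2 := S.dec_map T F₂ f h₂ m
  rw [hm, e2] at e1
  -- In degree i, the left side of F m = F₂ m contributes the component of m of degree i, the right
  -- side those whose degree f sends to i. The common retraction then equates the arguments.
  have e3 : ∀ i, F (S.dec m i) = F₂ (Finsupp.mapDomain f (S.dec m) i) := fun i => by
    have := DFunLike.congr_fun e1 i
    simpa using this.symm
  have e4 : S.dec m = Finsupp.mapDomain f (S.dec m) := by
    ext i
    have := congrArg R (e3 i)
    rwa [hF, hF₂] at this
  exact ⟨e4, fun i => by rw [e3, ← e4]⟩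

end Splitting

/-! ## Twisting a graded comodule algebra -/

/-- `exp (π i x)` -/
def expPi (x : ℝ) : ℂ := Complex.exp (Real.pi * Complex.I * (x : ℂ))

theorem expPi_add (x y : ℝ) : expPi (x + y) = expPi x * expPi y := by
  simp [expPi, mul_add, Complex.exp_add]

theorem expPi_zero : expPi 0 = 1 := by simp [expPi]

theorem expPi_ne_zero (x : ℝ) : expPi x ≠ 0 := Complex.exp_ne_zero _

namespace ComoduleAlgebra

/-- The comodule algebra `δ'` is obtained from `δ` by twisting the products of `A` and `H`, which are
bigraded by `S` and `T`, by the bicharacters of the alternating forms `(q, p)` and `(-p, p)`. -/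
structure IsTwist {D H A H' A' : Type*} [AddCommGroup D] [Ring H] [HopfAlgebra ℂ H] [Ring A]
    [Algebra ℂ A] [Ring H'] [HopfAlgebra ℂ H'] [Ring A'] [Algebra ℂ A'] (q p : D →+ D →+ ℝ)
    (S : Splitting (D × D) A) (T : Splitting (D × D) H) (δ : ComoduleAlgebra H A)
    (δ' : ComoduleAlgebra H' A') (e : A ≃ₗ[ℂ] A') (g : H ≃ₗ[ℂ] H') : Prop where
  p_self : ∀ r, p r r = 0
  q_self : ∀ r, q r r = 0
  one_mem : (1 : A) ∈ S.piece 0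
  mul_mem : ∀ r, ∀ a ∈ S.piece r, ∀ l, ∀ b ∈ S.piece l, a * b ∈ S.piece (r + l)
  one_mem_hopf : (1 : H) ∈ T.piece 0
  mul_mem_hopf : ∀ r, ∀ h ∈ T.piece r, ∀ l, ∀ k ∈ T.piece l, h * k ∈ T.piece (r + l)
  map_one : e 1 = 1
  map_one_hopf : g 1 = 1
  map_mul : ∀ r, ∀ a ∈ S.piece r, ∀ l, ∀ b ∈ S.piece l,
    e a * e b = expPi (q r.1 l.1 + p r.2 l.2) • e (a * b)
  map_mul_hopf : ∀ r, ∀ h ∈ T.piece r, ∀ l, ∀ k ∈ T.piece l,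
    g h * g k = expPi (-p r.1 l.1 + p r.2 l.2) • g (h * k)
  coact_mem : ∀ r l, ∀ a ∈ S.piece (r, l),
    δ.coact a ∈ ⨆ s, tensorSub (S.piece (r, s)) (T.piece (s, l))
  coact_map : ∀ a, δ'.coact (e a) = TensorProduct.map e.toLinearMap g.toLinearMap (δ.coact a)

namespace IsTwist

variable {D H A H' A' : Type*} [AddCommGroup D] [Ring H] [HopfAlgebra ℂ H] [Ring A]
  [Algebra ℂ A] [Ring H'] [HopfAlgebra ℂ H'] [Ring A'] [Algebra ℂ A'] {q p : D →+ D →+ ℝ}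
  {S : Splitting (D × D) A} {T : Splitting (D × D) H} {δ : ComoduleAlgebra H A}
  {δ' : ComoduleAlgebra H' A'} {e : A ≃ₗ[ℂ] A'} {g : H ≃ₗ[ℂ] H'}
  (t : IsTwist q p S T δ δ' e g)
include t

/-- Polarization of p(r + l, r + l) = 0. -/
theorem p_skew (r l : D) : p r l = -p l r := by
  have h := t.p_self (r + l)
  simp only [_root_.map_add, AddMonoidHom.add_apply, t.p_self] at h
  linarith

/-- A linear identity on the coaction of a homogeneous element can be checked on products of
homogeneous elements. -/
theorem coact_ext {P : Type*} [AddCommMonoid P] [Module ℂ P] {i : D × D} {a : A}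
    (ha : a ∈ S.piece i) (f f' : A ⊗[ℂ] H →ₗ[ℂ] P)
    (h : ∀ s, ∀ x ∈ S.piece (i.1, s), ∀ k ∈ T.piece (s, i.2), f (x ⊗ₜ k) = f' (x ⊗ₜ k)) :
    f (δ.coact a) = f' (δ.coact a) := by
  have hz := t.coact_mem i.1 i.2 a ha
  generalize δ.coact a = z at hz ⊢
  induction hz using Submodule.iSup_induction' with
  | zero => simp
  | add x y _ _ hx hy => rw [_root_.map_add, _root_.map_add, hx, hy]
  | mem s z hz =>
    obtain ⟨z, rfl⟩ := hz
    exact tensor_ext (f ∘ₗ TensorProduct.map (S.piece (i.1, s)).subtype (T.piece (s, i.2)).subtype)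
      (f' ∘ₗ TensorProduct.map (S.piece (i.1, s)).subtype (T.piece (s, i.2)).subtype)
      (fun x k => h s x x.2 k k.2) z

theorem coact_mem_coarsen (i : D × D) (a : A) (ha : a ∈ S.piece i) :
    δ.coact a ∈ ((S.tensor T).coarsen fun i => (i.1.1, i.2.2)).piece i :=
  t.coact_ext ha ((S.tensor T).coarsen fun i => (i.1.1, i.2.2)).dec (Finsupp.lsingle i)
    (fun _ _ hx _ hk => Splitting.mem_coarsen (Splitting.tmul_mem hx hk) _)

/-- With respect to the first degree of A and the second degree of H, δ preserves (r, l) while a ↦ a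
⊗ 1 sends it to (r, 0), and id ⊗ ε is a retraction of both. So B is graded and concentrated in
second degree 0. -/
theorem dec_coinv {b : A} (hb : b ∈ δ.coinv) :
    S.dec b = Finsupp.mapDomain (fun i => (i.1, 0)) (S.dec b) ∧ ∀ i, S.dec b i ∈ δ.coinv :=
  S.dec_eq_mapDomain ((S.tensor T).coarsen fun i => (i.1.1, i.2.2)) δ.coact.toLinearMap
    ((TensorProduct.mk ℂ A H).flip 1) (fun i => (i.1, 0))
    ((TensorProduct.rid ℂ A).toLinearMap ∘ₗ (Coalgebra.counit (R := ℂ) (A := H)).lTensor A)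
    δ.counit (fun m => by simp) t.coact_mem_coarsen
    (fun _ _ hm => Splitting.mem_coarsen (Splitting.tmul_mem hm t.one_mem_hopf) _) hb

/-- The grading of the algebra of coinvariants. -/
def splitCoinv : Splitting (D × D) δ.coinv :=
  S.restrict δ.coinv.val.toLinearMap Subtype.val_injective
    (fun b i => ⟨⟨S.dec b i, (t.dec_coinv b.2).2 i⟩, rfl⟩)

theorem mem_splitCoinv {b : δ.coinv} {i : D × D} :
    b ∈ t.splitCoinv.piece i ↔ (b : A) ∈ S.piece i := S.mem_restrict _ _

theorem eq_zero_of_mem_splitCoinv {b : δ.coinv} {i : D × D} (hb : b ∈ t.splitCoinv.piece i)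
    (hi : i.2 ≠ 0) : b = 0 := by
  have h1 := Splitting.mem_piece.1 (t.mem_splitCoinv.1 hb)
  have h2 := DFunLike.congr_fun (t.dec_coinv b.2).1 i
  rw [h1, Finsupp.single_eq_same, ← h1, Finsupp.mapDomain_of_notMem_range] at h2
  · exact Subtype.ext h2
  · rintro ⟨j, rfl⟩
    exact hi rfl

/-- A linear identity on coinvariants can be checked on homogeneous ones. -/
theorem coinv_ext {P : Type*} [AddCommMonoid P] [Module ℂ P] (f f' : δ.coinv →ₗ[ℂ] P)
    (h : ∀ r, ∀ b : δ.coinv, (b : A) ∈ S.piece (r, 0) → f b = f' b) (b : δ.coinv) : f b = f' b := by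
  refine t.splitCoinv.ext f f' (fun i b hb => ?_) b
  by_cases hi : i.2 = 0
  · refine h i.1 b ?_
    rw [← hi]
    exact t.mem_splitCoinv.1 hb
  · rw [t.eq_zero_of_mem_splitCoinv hb hi, _root_.map_zero, _root_.map_zero]

omit t in
/-- The grading of `A ⊗ A` by the first degrees and the sum of the second degrees. -/
abbrev splitPair (S : Splitting (D × D) A) : Splitting ((D × D) × D) (A ⊗[ℂ] A) :=
  (S.tensor S).coarsen fun i => ((i.1.1, i.2.1), i.1.2 + i.2.2)

omit t in
/-- The grading of `A ⊗ A ⊗ H` by the first degrees of `A ⊗ A` and the second degree of `H`. -/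
abbrev splitPairCoact (S : Splitting (D × D) A) (T : Splitting (D × D) H) :
    Splitting ((D × D) × D) ((A ⊗[ℂ] A) ⊗[ℂ] H) :=
  ((S.tensor S).tensor T).coarsen fun i => ((i.1.1.1, i.1.2.1), i.2.2)

/-- The second degrees of a and b reappear in a₁ and b₁ and are added in the product a₁b₁; this is
why A ⊗ A is graded by their sum. -/
theorem diag_mem (i : (D × D) × D) (X : A ⊗[ℂ] A) (hX : X ∈ (splitPair S).piece i) :
    δ.diag X ∈ (splitPairCoact S T).piece i := by
  refine (S.tensor S).map_mem_coarsen _ δ.diag _ id ?_ hX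
  refine Splitting.map_mem_tensor _ _ _ _ _ fun i a ha j b hb => ?_
  refine t.coact_ext ha ((splitPairCoact S T).dec ∘ₗ mulTensor A A H ∘ₗ
      (TensorProduct.mk ℂ _ _).flip (δ.coact b))
    (Finsupp.lsingle ((i.1, j.1), i.2 + j.2) ∘ₗ mulTensor A A H ∘ₗ
      (TensorProduct.mk ℂ _ _).flip (δ.coact b)) (fun s x hx h hh => ?_)
  refine t.coact_ext hb ((splitPairCoact S T).dec ∘ₗ mulTensor A A H ∘ₗ
      TensorProduct.mk ℂ _ _ (x ⊗ₜ h))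
    (Finsupp.lsingle ((i.1, j.1), i.2 + j.2) ∘ₗ mulTensor A A H ∘ₗ
      TensorProduct.mk ℂ _ _ (x ⊗ₜ h)) (fun s' y hy k hk => ?_)
  simp only [LinearMap.comp_apply, TensorProduct.mk_apply, mulTensor_tmul]
  exact Splitting.mem_coarsen (Splitting.tmul_mem (Splitting.tmul_mem hx hy)
    (t.mul_mem_hopf _ h hh _ k hk)) _

theorem tmul_one_mem (i : (D × D) × D) (X : A ⊗[ℂ] A) (hX : X ∈ (splitPair S).piece i) :
    X ⊗ₜ 1 ∈ (splitPairCoact S T).piece (i.1, 0) := by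
  have h : ∀ i, ∀ X ∈ (S.tensor S).piece i, (TensorProduct.mk ℂ (A ⊗[ℂ] A) H).flip 1 X ∈
      (splitPairCoact S T).piece ((i.1.1, i.2.1), 0) := fun i X hX =>
    Splitting.mem_coarsen (Splitting.tmul_mem hX t.one_mem_hopf)
      (fun i => ((i.1.1.1, i.1.2.1), i.2.2))
  exact (S.tensor S).map_mem_coarsen (splitPairCoact S T)
    ((TensorProduct.mk ℂ (A ⊗[ℂ] A) H).flip 1) (fun i => ((i.1.1, i.2.1), i.1.2 + i.2.2))
    (fun i => (i.1, 0)) h hX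

omit t in
theorem counit_diag (X : A ⊗[ℂ] A) : TensorProduct.rid ℂ (A ⊗[ℂ] A)
    ((Coalgebra.counit (R := ℂ) (A := H)).lTensor (A ⊗[ℂ] A) (δ.diag X)) = X :=
  (δ.toCoaction.tensor δ.toCoaction).counit X

/-- The argument of `dec_coinv` for the diagonal coaction: C is graded, with second degrees of total
0. -/
theorem dec_inclES (x : δ.ES) : (splitPair S).dec (δ.inclES x) =
      Finsupp.mapDomain (fun i => (i.1, 0)) ((splitPair S).dec (δ.inclES x)) ∧
    ∀ i, δ.diag ((splitPair S).dec (δ.inclES x) i) =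
      (TensorProduct.mk ℂ (A ⊗[ℂ] A) H).flip 1 ((splitPair S).dec (δ.inclES x) i) :=
  (splitPair S).dec_eq_mapDomain (splitPairCoact S T) δ.diag
    ((TensorProduct.mk ℂ (A ⊗[ℂ] A) H).flip 1) (fun i => (i.1, 0))
    ((TensorProduct.rid ℂ (A ⊗[ℂ] A)).toLinearMap ∘ₗ
      (Coalgebra.counit (R := ℂ) (A := H)).lTensor (A ⊗[ℂ] A))
    counit_diag (fun m => by simp) t.diag_mem t.tmul_one_mem (δ.diag_inclES x)

/-- The grading of the Ehresmann--Schauenburg algebra. -/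
def splitES : Splitting ((D × D) × D) δ.ES :=
  (splitPair S).restrict δ.inclES δ.inclES_injective
    (fun x i => δ.exists_inclES_eq ((t.dec_inclES x).2 i))

theorem mem_splitES {x : δ.ES} {i : (D × D) × D} :
    x ∈ t.splitES.piece i ↔ δ.inclES x ∈ (splitPair S).piece i := Splitting.mem_restrict _ _ _

theorem eq_zero_of_mem_splitES {x : δ.ES} {i : (D × D) × D} (hx : x ∈ t.splitES.piece i)
    (hi : i.2 ≠ 0) : x = 0 := by
  have h1 := Splitting.mem_piece.1 (t.mem_splitES.1 hx)
  have h2 := DFunLike.congr_fun (t.dec_inclES x).1 i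
  rw [h1, Finsupp.single_eq_same, ← h1, Finsupp.mapDomain_of_notMem_range] at h2
  · exact δ.inclES_injective (h2.trans (_root_.map_zero _).symm)
  · rintro ⟨j, rfl⟩
    exact hi rfl

/-- A linear identity on the Ehresmann--Schauenburg algebra can be checked on homogeneous
elements. -/
theorem ES_ext {P : Type*} [AddCommMonoid P] [Module ℂ P] (f f' : δ.ES →ₗ[ℂ] P)
    (h : ∀ i, ∀ x ∈ t.splitES.piece (i, 0), f x = f' x) (x : δ.ES) : f x = f' x := by
  refine t.splitES.ext f f' (fun i x hx => ?_) x
  by_cases hi : i.2 = 0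
  · refine h i.1 x ?_
    rw [← hi]
    exact hx
  · rw [t.eq_zero_of_mem_splitES hx hi, _root_.map_zero, _root_.map_zero]

end IsTwist

end ComoduleAlgebra

/-! ### Coinvariants, `C` and the Galois map under a twist -/

namespace ComoduleAlgebra

namespace IsTwist

variable {D H A H' A' : Type*} [AddCommGroup D] [Ring H] [HopfAlgebra ℂ H] [Ring A]
  [Algebra ℂ A] [Ring H'] [HopfAlgebra ℂ H'] [Ring A'] [Algebra ℂ A'] {q p : D →+ D →+ ℝ}
  {S : Splitting (D × D) A} {T : Splitting (D × D) H} {δ : ComoduleAlgebra H A}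
  {δ' : ComoduleAlgebra H' A'} {e : A ≃ₗ[ℂ] A'} {g : H ≃ₗ[ℂ] H'}

/-- The operator on `A ⊗ A` that multiplies by `exp (π i p(k, l))` in the second degrees `k` and
`l`. -/
def pairScale (S : Splitting (D × D) A) (p : D →+ D →+ ℝ) : A ⊗[ℂ] A →ₗ[ℂ] A ⊗[ℂ] A :=
  (S.tensor S).scale fun i => expPi (p i.1.2 i.2.2)

theorem pairScale_neg (X : A ⊗[ℂ] A) : pairScale S (-p) (pairScale S p X) = X := by
  rw [pairScale, pairScale, Splitting.scale_scale]
  exact Splitting.scale_eq_self _ (fun i => by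
    rw [← expPi_add, AddMonoidHom.neg_apply, AddMonoidHom.neg_apply, neg_add_cancel, expPi_zero]) _

theorem pairScale_neg' (X : A ⊗[ℂ] A) : pairScale S p (pairScale S (-p) X) = X := by
  have h := pairScale_neg (S := S) (p := -p) X
  rwa [neg_neg] at h

theorem pairScale_tmul (p : D →+ D →+ ℝ) {i : D × D} {a : A} (ha : a ∈ S.piece i) {j : D × D}
    {b : A} (hb : b ∈ S.piece j) : pairScale S p (a ⊗ₜ b) = expPi (p i.2 j.2) • (a ⊗ₜ b) := by
  rw [pairScale, Splitting.scale_of_mem _ (Splitting.tmul_mem ha hb)]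

variable (t : IsTwist q p S T δ δ' e g)
include t

theorem coinv_iff (a : A) : e a ∈ δ'.coinv ↔ a ∈ δ.coinv := by
  have h : TensorProduct.map e.toLinearMap g.toLinearMap (a ⊗ₜ 1) = e a ⊗ₜ 1 := by
    simp [t.map_one_hopf]
  rw [mem_coinv, mem_coinv, t.coact_map, ← h]
  exact (TensorProduct.congr e g).injective.eq_iff

/-- The isomorphism of the algebras of coinvariants, as vector spaces. -/
def mapCoinv (b : δ.coinv) : δ'.coinv := ⟨e b, (t.coinv_iff b).2 b.2⟩

/-- For a₁ and b₁ of degrees (κ, k) and (μ, l) the product in H' carries the exponent -p(κ, μ) +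
p(k, l). Here k and l are the second degrees of a and b, while κ and μ are those of a₀ and b₀: a
rescaling before and an inverse one after the coaction. -/
theorem diag_congr (X : A ⊗[ℂ] A) : δ'.diag (TensorProduct.congr e e X) =
    TensorProduct.congr (TensorProduct.congr e e) g
      ((pairScale S (-p)).rTensor H (δ.diag (pairScale S p X))) := by
  refine S.ext₂ S (δ'.diag ∘ₗ (TensorProduct.congr e e).toLinearMap)
    ((TensorProduct.congr (TensorProduct.congr e e) g).toLinearMap ∘ₗ
      (pairScale S (-p)).rTensor H ∘ₗ δ.diag ∘ₗ pairScale S p) (fun i a ha j b hb => ?_) X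
  simp only [LinearMap.comp_apply, LinearEquiv.coe_coe, TensorProduct.congr_tmul,
    pairScale_tmul p ha hb, _root_.map_smul, diag_tmul, t.coact_map]
  refine t.coact_ext ha (mulTensor A' A' H' ∘ₗ (TensorProduct.mk ℂ _ _).flip
      (TensorProduct.map e.toLinearMap g.toLinearMap (δ.coact b)) ∘ₗ
      TensorProduct.map e.toLinearMap g.toLinearMap)
    (expPi (p i.2 j.2) • (TensorProduct.congr (TensorProduct.congr e e) g).toLinearMap ∘ₗ
      (pairScale S (-p)).rTensor H ∘ₗ mulTensor A A H ∘ₗ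
      (TensorProduct.mk ℂ _ _).flip (δ.coact b)) (fun s x hx h hh => ?_)
  refine t.coact_ext hb (mulTensor A' A' H' ∘ₗ TensorProduct.mk ℂ _ _
      (TensorProduct.map e.toLinearMap g.toLinearMap (x ⊗ₜ h)) ∘ₗ
      TensorProduct.map e.toLinearMap g.toLinearMap)
    (expPi (p i.2 j.2) • (TensorProduct.congr (TensorProduct.congr e e) g).toLinearMap ∘ₗ
      (pairScale S (-p)).rTensor H ∘ₗ mulTensor A A H ∘ₗ
      TensorProduct.mk ℂ _ _ (x ⊗ₜ h)) (fun s' y hy k hk => ?_)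
  simp only [LinearMap.comp_apply, LinearMap.smul_apply, TensorProduct.mk_apply,
    TensorProduct.map_tmul, mulTensor_tmul, LinearMap.rTensor_tmul, LinearEquiv.coe_coe,
    TensorProduct.congr_tmul, pairScale_tmul (-p) hx hy, _root_.map_smul,
    t.map_mul_hopf _ _ hh _ _ hk, TensorProduct.tmul_smul, ← TensorProduct.smul_tmul', smul_smul]
  rw [← expPi_add]
  congr 2
  simp only [AddMonoidHom.neg_apply]
  ring

/-- Second degrees in C are k and -k, and p(k, -k) = 0. The integer c allows for both p and -p. -/
theorem pairScale_inclES (c : ℤ) (x : δ.ES) : pairScale S (c • p) (δ.inclES x) = δ.inclES x := by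
  refine t.ES_ext (pairScale S (c • p) ∘ₗ δ.inclES) δ.inclES (fun i x hx => ?_) x
  have h := (S.tensor S).scale_of_mem_coarsen (fun i => ((i.1.1, i.2.1), i.1.2 + i.2.2))
    (c := fun i => expPi ((c • p) i.1.2 i.2.2)) (c' := fun _ => 1) (d := 1) (fun k hk => by
      have h0 : k.2.2 = -k.1.2 := (neg_eq_of_add_eq_zero_right (congrArg Prod.snd hk)).symm
      rw [h0]
      simp [t.p_self, expPi_zero]) (t.mem_splitES.1 hx)
  rw [one_smul, Splitting.scale_eq_self _ (fun _ => rfl)] at h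
  exact h

theorem diag_congr_iff (X : A ⊗[ℂ] A) :
    δ'.diag (TensorProduct.congr e e X) = TensorProduct.congr e e X ⊗ₜ 1 ↔
      δ.diag X = X ⊗ₜ 1 := by
  have h1 : ∀ Y : A ⊗[ℂ] A, TensorProduct.congr e e Y ⊗ₜ[ℂ] (1 : H') =
      TensorProduct.congr (TensorProduct.congr e e) g (Y ⊗ₜ 1) := fun Y => by
    simp [t.map_one_hopf]
  have hc := t.pairScale_inclES (-1)
  have hc' := t.pairScale_inclES 1
  rw [neg_one_zsmul] at hc
  rw [one_zsmul] at hc'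
  rw [t.diag_congr, h1, EquivLike.apply_eq_iff_eq]
  constructor
  -- Undoing the phase after the coaction shows that the rescaled X lies in C; rescaling fixes C, so
  -- X lies there as well.
  · intro h
    have h2 := congrArg ((pairScale S p).rTensor H) h
    have h3 : ∀ Z, (pairScale S p).rTensor H ((pairScale S (-p)).rTensor H Z) = Z := fun Z =>
      tensor_ext ((pairScale S p).rTensor H ∘ₗ (pairScale S (-p)).rTensor H) LinearMap.id
        (fun X h => by simp [pairScale_neg']) Z
    rw [h3, LinearMap.rTensor_tmul] at h2
    obtain ⟨x, hx⟩ := δ.exists_inclES_eq h2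
    have h4 : X = δ.inclES x := by rw [← hc x, hx, pairScale_neg]
    rw [h4]
    exact δ.diag_inclES x
  · intro h
    obtain ⟨x, rfl⟩ := δ.exists_inclES_eq h
    rw [hc', δ.diag_inclES, LinearMap.rTensor_tmul, hc]

theorem exists_mapES (x : δ.ES) : ∃ y : δ'.ES, δ'.inclES y = TensorProduct.congr e e (δ.inclES x) :=
  δ'.exists_inclES_eq ((t.diag_congr_iff _).2 (δ.diag_inclES x))

/-- The isomorphism of the Ehresmann--Schauenburg algebras, as vector spaces. -/
def mapES : δ.ES ≃ₗ[ℂ] δ'.ES :=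
  LinearEquiv.ofBijective
    { toFun := fun x => (t.exists_mapES x).choose
      map_add' := fun x y => δ'.inclES_injective <| (t.exists_mapES (x + y)).choose_spec.trans <| by
        rw [_root_.map_add, _root_.map_add, _root_.map_add, (t.exists_mapES x).choose_spec,
          (t.exists_mapES y).choose_spec]
      map_smul' := fun r x => δ'.inclES_injective <| (t.exists_mapES (r • x)).choose_spec.trans <| by
        rw [_root_.map_smul, _root_.map_smul, _root_.map_smul, (t.exists_mapES x).choose_spec]
        rfl }
    (by
      constructor
      · intro x y h
        have h := congrArg δ'.inclES h
        simp only [LinearMap.coe_mk, AddHom.coe_mk] at h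
        rw [(t.exists_mapES x).choose_spec, (t.exists_mapES y).choose_spec,
          EquivLike.apply_eq_iff_eq] at h
        exact δ.inclES_injective h
      · intro y
        obtain ⟨X, hX⟩ := (TensorProduct.congr e e).surjective (δ'.inclES y)
        have h := δ'.diag_inclES y
        rw [← hX, t.diag_congr_iff] at h
        obtain ⟨x, rfl⟩ := δ.exists_inclES_eq h
        exact ⟨x, δ'.inclES_injective ((t.exists_mapES x).choose_spec.trans hX)⟩)

theorem inclES_mapES (x : δ.ES) :
    δ'.inclES (t.mapES x) = TensorProduct.congr e e (δ.inclES x) :=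
  (t.exists_mapES x).choose_spec

/-- Commutativity of H' is not required: C' and C correspond as subspaces, and the flip does not
involve the products. -/
theorem diag_comm_inclES (h : ∀ x : δ.ES, δ.diag (TensorProduct.comm ℂ A A (δ.inclES x)) =
      TensorProduct.comm ℂ A A (δ.inclES x) ⊗ₜ 1) (y : δ'.ES) :
    δ'.diag (TensorProduct.comm ℂ A' A' (δ'.inclES y)) =
      TensorProduct.comm ℂ A' A' (δ'.inclES y) ⊗ₜ 1 := by
  obtain ⟨x, rfl⟩ := t.mapES.surjective y
  have e1 : ∀ X, TensorProduct.comm ℂ A' A' (TensorProduct.congr e e X) =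
      TensorProduct.congr e e (TensorProduct.comm ℂ A A X) := fun X =>
    tensor_ext ((TensorProduct.comm ℂ A' A').toLinearMap ∘ₗ (TensorProduct.congr e e).toLinearMap)
      ((TensorProduct.congr e e).toLinearMap ∘ₗ (TensorProduct.comm ℂ A A).toLinearMap)
      (fun _ _ => by simp) X
  rw [t.inclES_mapES, e1, t.diag_congr_iff, h]

/-- The operator on `A ⊗ A` that multiplies by `exp (-π i q(r, s))` in the first degrees `r` and
`s`, followed by the isomorphism with `A' ⊗ A'`. -/
def mapPair (q : D →+ D →+ ℝ) (S : Splitting (D × D) A) (e : A ≃ₗ[ℂ] A') :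
    A ⊗[ℂ] A →ₗ[ℂ] A' ⊗[ℂ] A' :=
  (TensorProduct.congr e e).toLinearMap ∘ₗ (S.tensor S).scale fun i => expPi (-q i.1.1 i.2.1)

omit t in
theorem mapPair_tmul {i : D × D} {a : A} (ha : a ∈ S.piece i) {j : D × D} {b : A}
    (hb : b ∈ S.piece j) : mapPair q S e (a ⊗ₜ b) = expPi (-q i.1 j.1) • (e a ⊗ₜ e b) := by
  rw [mapPair, LinearMap.comp_apply, Splitting.scale_of_mem _ (Splitting.tmul_mem ha hb)]
  simp

omit t in
theorem mapPair_surjective : Function.Surjective (mapPair q S e) :=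
  (TensorProduct.congr e e).surjective.comp
    (Splitting.scale_bijective _ fun _ => expPi_ne_zero _).2

/-- For first degrees r, s, l of a, b, c both sides of the relation carry the exponent -(q(r, s) +
q(r, l) + q(s, l)). The form p drops out because b has second degree 0. -/
theorem mapPair_mem (z : A ⊗[ℂ] A) (hz : δ.mkAA z = 0) : δ'.mkAA (mapPair q S e z) = 0 := by
  refine (?_ : balancedRel (fun b a => a * b : δ.coinv → A → A)
    (fun b a => b * a : δ.coinv → A → A) ≤ LinearMap.ker (δ'.mkAA ∘ₗ mapPair q S e))
    ((Submodule.Quotient.mk_eq_zero _).1 hz)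
  refine balancedRel_le _ fun b a c => ?_
  let f : A ⊗[ℂ] A →ₗ[ℂ] δ'.AA := δ'.mkAA ∘ₗ mapPair q S e
  refine t.coinv_ext (f ∘ₗ (TensorProduct.mk ℂ A A).flip c ∘ₗ LinearMap.mulLeft ℂ a ∘ₗ
    δ.coinv.val.toLinearMap) (f ∘ₗ TensorProduct.mk ℂ A A a ∘ₗ LinearMap.mulRight ℂ c ∘ₗ
    δ.coinv.val.toLinearMap) (fun s b hb => ?_) b
  refine S.ext (f ∘ₗ (TensorProduct.mk ℂ A A).flip c ∘ₗ LinearMap.mulRight ℂ (b : A))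
    (f ∘ₗ (TensorProduct.mk ℂ A A).flip (b * c)) (fun i a ha => ?_) a
  refine S.ext (f ∘ₗ TensorProduct.mk ℂ A A (a * b))
    (f ∘ₗ TensorProduct.mk ℂ A A a ∘ₗ LinearMap.mulLeft ℂ (b : A)) (fun j c hc => ?_) c
  simp only [f, LinearMap.comp_apply, TensorProduct.mk_apply, LinearMap.mulLeft_apply]
  rw [mapPair_tmul (t.mul_mem _ _ ha _ _ hb) hc, mapPair_tmul ha (t.mul_mem _ _ hb _ _ hc)]
  have e1 : e (a * b) = expPi (-q i.1 s) • (e a * e b) := by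
    rw [t.map_mul _ _ ha _ _ hb, smul_smul, ← expPi_add]
    simp [expPi_zero]
  have e2 : e (b * c) = expPi (-q s j.1) • (e b * e c) := by
    rw [t.map_mul _ _ hb _ _ hc, smul_smul, ← expPi_add]
    simp [expPi_zero]
  have e3 : δ'.mkAA ((e a * e b) ⊗ₜ e c) = δ'.mkAA (e a ⊗ₜ (e b * e c)) := by
    rw [← sub_eq_zero, ← map_sub]
    exact (Submodule.Quotient.mk_eq_zero _).2
      (Submodule.subset_span ⟨t.mapCoinv b, e a, e c, rfl⟩)
  rw [e1, e2, TensorProduct.tmul_smul, ← TensorProduct.smul_tmul', smul_smul, smul_smul,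
    ← expPi_add, ← expPi_add, _root_.map_smul, _root_.map_smul, e3]
  congr 2
  simp only [Prod.fst_add, _root_.map_add, AddMonoidHom.add_apply]
  ring

/-- The weight of `mapPair` cancels q. If a and b₀ have second degrees k and s, there remains p(k,
s) = p(k + s, s), where k + s is the second degree of ab₀ and s the first degree of b₁; so it is a
rescaling of A ⊗ H. -/
theorem galois_mapPair (z : A ⊗[ℂ] A) : δ'.galois (δ'.mkAA (mapPair q S e z)) =
    TensorProduct.congr e g ((S.tensor T).scale (fun i => expPi (p i.1.2 i.2.1))
      (δ.galois (δ.mkAA z))) := by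
  refine S.ext₂ S (δ'.galois ∘ₗ δ'.mkAA ∘ₗ mapPair q S e)
    ((TensorProduct.congr e g).toLinearMap ∘ₗ
      (S.tensor T).scale (fun i => expPi (p i.1.2 i.2.1)) ∘ₗ δ.galois ∘ₗ δ.mkAA)
    (fun i a ha j b hb => ?_) z
  simp only [LinearMap.comp_apply]
  rw [mapPair_tmul ha hb, _root_.map_smul, _root_.map_smul, galois_mkAA, galois_mkAA, t.coact_map]
  refine t.coact_ext hb (expPi (-q i.1 j.1) • LinearMap.mulLeft ℂ (e a ⊗ₜ (1 : H')) ∘ₗ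
      TensorProduct.map e.toLinearMap g.toLinearMap)
    ((TensorProduct.congr e g).toLinearMap ∘ₗ
      (S.tensor T).scale (fun i => expPi (p i.1.2 i.2.1)) ∘ₗ LinearMap.mulLeft ℂ (a ⊗ₜ (1 : H)))
    (fun s x hx k hk => ?_)
  simp only [LinearMap.comp_apply, LinearMap.smul_apply, LinearMap.mulLeft_apply,
    TensorProduct.map_tmul, LinearEquiv.coe_coe, Algebra.TensorProduct.tmul_mul_tmul, one_mul]
  rw [Splitting.scale_of_mem _ (Splitting.tmul_mem (t.mul_mem _ _ ha _ _ hx) hk),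
    t.map_mul _ _ ha _ _ hx, _root_.map_smul, TensorProduct.congr_tmul,
    ← TensorProduct.smul_tmul', smul_smul, ← expPi_add]
  congr 2
  simp [t.p_self]

theorem isHopfGalois (hG : δ.IsHopfGalois) : δ'.IsHopfGalois := by
  have hb : Function.Bijective ((S.tensor T).scale (fun i => expPi (p i.1.2 i.2.1))) :=
    Splitting.scale_bijective _ fun _ => expPi_ne_zero _
  constructor
  · rw [← LinearMap.ker_eq_bot, Submodule.eq_bot_iff]
    intro w hw
    obtain ⟨z, rfl⟩ := Submodule.mkQ_surjective _ w
    obtain ⟨z, rfl⟩ := mapPair_surjective (q := q) (S := S) (e := e) z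
    rw [LinearMap.mem_ker, t.galois_mapPair, LinearEquiv.map_eq_zero_iff] at hw
    refine t.mapPair_mem z (hG.1 ?_)
    rw [_root_.map_zero]
    exact hb.1 (hw.trans (_root_.map_zero _).symm)
  · intro y
    obtain ⟨y, rfl⟩ := (TensorProduct.congr e g).surjective y
    obtain ⟨y, rfl⟩ := hb.2 y
    obtain ⟨w, rfl⟩ := hG.2 y
    obtain ⟨z, rfl⟩ := Submodule.mkQ_surjective _ w
    exact ⟨δ'.mkAA (mapPair q S e z), t.galois_mapPair z⟩

end IsTwist

end ComoduleAlgebra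

/-! ### The phases of `mu₂` and `mu₃` -/

namespace ComoduleAlgebra

namespace IsTwist

variable {D H A H' A' : Type*} [AddCommGroup D] [Ring H] [HopfAlgebra ℂ H] [Ring A]
  [Algebra ℂ A] [Ring H'] [HopfAlgebra ℂ H'] [Ring A'] [Algebra ℂ A'] {q p : D →+ D →+ ℝ}
  {S : Splitting (D × D) A} {T : Splitting (D × D) H} {δ : ComoduleAlgebra H A}
  {δ' : ComoduleAlgebra H' A'} {e : A ≃ₗ[ℂ] A'} {g : H ≃ₗ[ℂ] H'}
  (t : IsTwist q p S T δ δ' e g)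
include t

section Star

variable {K W W' : Type*} [AddCommGroup W] [Module ℂ W] [AddCommGroup W'] [Module ℂ W']
  (SW : Splitting K W) (eW : W ≃ₗ[ℂ] W')

theorem star_mem (i : ((D × D) × D × D) × (D × D) × K) (z : (A ⊗[ℂ] A) ⊗[ℂ] (A ⊗[ℂ] W))
    (hz : z ∈ ((S.tensor S).tensor (S.tensor SW)).piece i) :
    star A W z ∈ (S.tensor (S.tensor SW)).piece (i.1.1, (i.1.2 + i.2.1, i.2.2)) := by
  refine Splitting.map_mem_tensor₄ S S S SW (S.tensor (S.tensor SW)) (star A W)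
    (fun i => (i.1.1, (i.1.2 + i.2.1, i.2.2)))
    (fun i a ha j b hb k c hc l w hw => ?_) i z hz
  rw [star_tmul]
  exact Splitting.tmul_mem ha (Splitting.tmul_mem (t.mul_mem _ _ hb _ _ hc) hw)

theorem star_congr (X : A ⊗[ℂ] A) (Y : A ⊗[ℂ] W) :
    star A' W' (TensorProduct.congr e e X ⊗ₜ TensorProduct.congr e eW Y) =
      TensorProduct.congr e (TensorProduct.congr e eW)
        (star A W (((S.tensor S).tensor (S.tensor SW)).scale
          (fun i => expPi (q i.1.2.1 i.2.1.1 + p i.1.2.2 i.2.1.2)) (X ⊗ₜ Y))) := by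
  refine Splitting.ext₄ S S S SW (star A' W' ∘ₗ TensorProduct.map
      (TensorProduct.congr e e).toLinearMap (TensorProduct.congr e eW).toLinearMap)
    ((TensorProduct.congr e (TensorProduct.congr e eW)).toLinearMap ∘ₗ star A W ∘ₗ
      ((S.tensor S).tensor (S.tensor SW)).scale
          (fun i => expPi (q i.1.2.1 i.2.1.1 + p i.1.2.2 i.2.1.2)))
    (fun i a ha j b hb k c hc l w hw => ?_) (X ⊗ₜ Y)
  simp only [LinearMap.comp_apply]
  rw [Splitting.scale_of_mem _
    (Splitting.tmul_mem (Splitting.tmul_mem ha hb) (Splitting.tmul_mem hc hw))]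
  simp only [TensorProduct.map_tmul, LinearEquiv.coe_coe, TensorProduct.congr_tmul, star_tmul,
    t.map_mul _ _ hb _ _ hc, _root_.map_smul, ← TensorProduct.smul_tmul', TensorProduct.tmul_smul]

/-- The product of the inner factors forgets their individual degrees. Its phase becomes an operator
on the target once it is a constant times a function of the resulting degrees, and this is required
only for the fine degrees allowed by those of X and Y. -/
theorem star_twist {J₁ J₂ : Type*} (f₁ : (D × D) × D × D → J₁) (f₂ : (D × D) × K → J₂) {j₁ : J₁}
    {j₂ : J₂} {X : A ⊗[ℂ] A} {Y : A ⊗[ℂ] W} (hX : X ∈ ((S.tensor S).coarsen f₁).piece j₁)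
    (hY : Y ∈ ((S.tensor SW).coarsen f₂).piece j₂) (c : (D × D) × (D × D) × K → ℂ) (d : ℂ)
    (hc : ∀ a b, f₁ a = j₁ → f₂ b = j₂ → expPi (q a.2.1 b.1.1 + p a.2.2 b.1.2) =
      d * c (a.1, (a.2 + b.1, b.2))) :
    star A' W' (TensorProduct.congr e e X ⊗ₜ TensorProduct.congr e eW Y) =
      d • TensorProduct.congr e (TensorProduct.congr e eW)
        ((S.tensor (S.tensor SW)).scale c (star A W (X ⊗ₜ Y))) := by
  have h := ((S.tensor S).tensor (S.tensor SW)).scale_of_mem_coarsen (Prod.map f₁ f₂)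
    (c := fun i => expPi (q i.1.2.1 i.2.1.1 + p i.1.2.2 i.2.1.2))
    (c' := fun i => c (i.1.1, (i.1.2 + i.2.1, i.2.2))) (d := d) (j := (j₁, j₂))
    (fun i hi => hc i.1 i.2 (congrArg Prod.fst hi) (congrArg Prod.snd hi))
    (Splitting.tmul_mem_coarsen f₁ f₂ hX hY)
  rw [t.star_congr SW eW, h, Splitting.scale_map ((S.tensor S).tensor (S.tensor SW))
    (S.tensor (S.tensor SW)) (star A W) (fun i => (i.1.1, (i.1.2 + i.2.1, i.2.2)))
    (t.star_mem SW), _root_.map_smul, _root_.map_smul]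

omit t in
theorem lTensor_star_mem {L U : Type*} [AddCommGroup U] [Module ℂ U] (SU : Splitting L U)
    (f : A ⊗[ℂ] W →ₗ[ℂ] U) {i : (D × D) × D} {X : A ⊗[ℂ] A} (hX : X ∈ (splitPair S).piece i)
    (Y : A ⊗[ℂ] W) : f.lTensor A (star A W (X ⊗ₜ Y)) ∈
      ((S.tensor SU).coarsen fun i => i.1.1).piece i.1.1 := by
  refine (S.tensor S).map_mem_coarsen ((S.tensor SU).coarsen fun i => i.1.1)
    (f.lTensor A ∘ₗ star A W ∘ₗ (TensorProduct.mk ℂ _ _).flip Y)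
    (fun i => ((i.1.1, i.2.1), i.1.2 + i.2.2)) (fun i => i.1.1) ?_ hX
  refine Splitting.map_mem_tensor S S ((S.tensor SU).coarsen fun i => i.1.1)
    (f.lTensor A ∘ₗ star A W ∘ₗ (TensorProduct.mk ℂ _ _).flip Y) (fun i => i.1.1)
    fun i a ha j b _ => ?_
  simp only [LinearMap.comp_apply, LinearMap.flip_apply, TensorProduct.mk_apply, star_tmul_left,
    LinearMap.lTensor_tmul]
  exact Splitting.tmul_mem_coarsen_fst SU Prod.fst ha _

end Star

/-- The operator on `C ⊗ C` that multiplies by `exp (-π i q(r', l))` in the degrees `(r, r')` and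
`(l, l')`, followed by the isomorphism with `C' ⊗ C'`. -/
def mapES₂ : δ.ES ⊗[ℂ] δ.ES →ₗ[ℂ] δ'.ES ⊗[ℂ] δ'.ES :=
  TensorProduct.map t.mapES.toLinearMap t.mapES.toLinearMap ∘ₗ
    (t.splitES.tensor t.splitES).scale fun i => expPi (-q i.1.1.2 i.2.1.1)

theorem mapES₂_tmul {i j : (D × D) × D} {x y : δ.ES} (hx : x ∈ t.splitES.piece i)
    (hy : y ∈ t.splitES.piece j) :
    t.mapES₂ (x ⊗ₜ y) = expPi (-q i.1.2 j.1.1) • (t.mapES x ⊗ₜ t.mapES y) := by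
  rw [mapES₂, LinearMap.comp_apply, Splitting.scale_of_mem _ (Splitting.tmul_mem hx hy)]
  simp

theorem mapES₂_surjective : Function.Surjective t.mapES₂ :=
  (TensorProduct.congr t.mapES t.mapES).surjective.comp
    (Splitting.scale_bijective _ fun _ => expPi_ne_zero _).2

/-- The operator on `C ⊗ (C ⊗ C)` that multiplies by `exp (-π i (q(r', l) + q(l', m)))` in the
degrees `(r, r')`, `(l, l')` and `(m, m')`, followed by the isomorphism with `C' ⊗ (C' ⊗ C')`. -/
def mapES₃ : δ.ES ⊗[ℂ] (δ.ES ⊗[ℂ] δ.ES) →ₗ[ℂ] δ'.ES ⊗[ℂ] (δ'.ES ⊗[ℂ] δ'.ES) :=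
  TensorProduct.map t.mapES.toLinearMap
      (TensorProduct.map t.mapES.toLinearMap t.mapES.toLinearMap) ∘ₗ
    (t.splitES.tensor (t.splitES.tensor t.splitES)).scale
      fun i => expPi (-q i.1.1.2 i.2.1.1.1 - q i.2.1.1.2 i.2.2.1.1)

theorem mapES₃_tmul {i j k : (D × D) × D} {x y w : δ.ES} (hx : x ∈ t.splitES.piece i)
    (hy : y ∈ t.splitES.piece j) (hw : w ∈ t.splitES.piece k) :
    t.mapES₃ (x ⊗ₜ (y ⊗ₜ w)) = expPi (-q i.1.2 j.1.1 - q j.1.2 k.1.1) •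
      (t.mapES x ⊗ₜ (t.mapES y ⊗ₜ t.mapES w)) := by
  rw [mapES₃, LinearMap.comp_apply,
    Splitting.scale_of_mem _ (Splitting.tmul_mem hx (Splitting.tmul_mem hy hw))]
  simp

theorem mapES₃_surjective : Function.Surjective t.mapES₃ :=
  (TensorProduct.congr t.mapES (TensorProduct.congr t.mapES t.mapES)).surjective.comp
    (Splitting.scale_bijective _ fun _ => expPi_ne_zero _).2

/-- The weight of `mapES₂` removes q. With k and m the second degrees of x' and y, the factor y' has
second degree -m, and the remaining p(k, m) = -p(k + m, -m) is a function of the second degrees of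
x'y and y'. -/
theorem mu₂_mapES₂ (z : δ.ES ⊗[ℂ] δ.ES) : δ'.mu₂ (t.mapES₂ z) =
    TensorProduct.congr e (TensorProduct.congr e e)
      ((pairScale S (-p)).lTensor A (δ.mu₂ z)) := by
  refine tensor_ext (δ'.mu₂ ∘ₗ t.mapES₂) ((TensorProduct.congr e
    (TensorProduct.congr e e)).toLinearMap ∘ₗ (pairScale S (-p)).lTensor A ∘ₗ δ.mu₂)
    (fun x y => ?_) z
  refine t.ES_ext (δ'.mu₂ ∘ₗ t.mapES₂ ∘ₗ (TensorProduct.mk ℂ _ _).flip y)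
    ((TensorProduct.congr e (TensorProduct.congr e e)).toLinearMap ∘ₗ
      (pairScale S (-p)).lTensor A ∘ₗ δ.mu₂ ∘ₗ (TensorProduct.mk ℂ _ _).flip y)
    (fun i x hx => ?_) x
  refine t.ES_ext (δ'.mu₂ ∘ₗ t.mapES₂ ∘ₗ TensorProduct.mk ℂ _ _ x)
    ((TensorProduct.congr e (TensorProduct.congr e e)).toLinearMap ∘ₗ
      (pairScale S (-p)).lTensor A ∘ₗ δ.mu₂ ∘ₗ TensorProduct.mk ℂ _ _ x)
    (fun j y hy => ?_) y
  simp only [LinearMap.comp_apply, TensorProduct.mk_apply, LinearEquiv.coe_coe]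
  rw [t.mapES₂_tmul hx hy, _root_.map_smul, mu₂_tmul, mu₂_tmul, t.inclES_mapES, t.inclES_mapES,
    t.star_twist S e _ _ (t.mem_splitES.1 hx) (t.mem_splitES.1 hy)
      (fun i => expPi ((-p) i.2.1.2 i.2.2.2)) (expPi (q i.2 j.1)) ?_, smul_smul, ← expPi_add,
    neg_add_cancel, expPi_zero, one_smul, pairScale, Splitting.scale_lTensor S]
  intro a b ha hb
  rw [← expPi_add]
  obtain ⟨⟨a1, a2⟩, a3, a4⟩ := a
  obtain ⟨⟨b1, b2⟩, b3, b4⟩ := b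
  simp only [Prod.mk.injEq] at ha hb
  obtain ⟨⟨rfl, rfl⟩, ha⟩ := ha
  obtain ⟨⟨rfl, rfl⟩, hb⟩ := hb
  obtain rfl := (neg_eq_of_add_eq_zero_right hb)
  congr 1
  simp [t.p_self]

/-- The operator on `A ⊗ (A ⊗ W)` that multiplies by `exp (π i p(l, k))` in the second degrees `k`
and `l` of the first two factors. -/
def tripleScale {K W : Type*} [AddCommGroup W] [Module ℂ W] (S : Splitting (D × D) A)
    (SW : Splitting K W) (p : D →+ D →+ ℝ) : A ⊗[ℂ] (A ⊗[ℂ] W) →ₗ[ℂ] A ⊗[ℂ] (A ⊗[ℂ] W) :=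
  (S.tensor (S.tensor SW)).scale fun i => expPi (p i.2.1.2 i.1.2)

/-- The product of y' and w contributes a `pairScale` as in `mu₂_mapES₂`. For x'y the degree of y'
is no longer visible, so the phase is read off from x instead, whose second degree is -k: p(k, m) =
p(k + m, -k), which is `tripleScale`. -/
theorem mu₃_mapES₃ (z : δ.ES ⊗[ℂ] (δ.ES ⊗[ℂ] δ.ES)) : δ'.mu₃ (t.mapES₃ z) =
    TensorProduct.congr e (TensorProduct.congr e (TensorProduct.congr e e))
      (tripleScale S (S.tensor S) p
        (((pairScale S (-p)).lTensor A).lTensor A (δ.mu₃ z))) := by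
  let F : A ⊗[ℂ] (A ⊗[ℂ] (A ⊗[ℂ] A)) →ₗ[ℂ] A' ⊗[ℂ] (A' ⊗[ℂ] (A' ⊗[ℂ] A')) :=
    (TensorProduct.congr e (TensorProduct.congr e (TensorProduct.congr e e))).toLinearMap ∘ₗ
      tripleScale S (S.tensor S) p ∘ₗ ((pairScale S (-p)).lTensor A).lTensor A
  have key : ∀ i, ∀ x ∈ t.splitES.piece (i, 0), ∀ j, ∀ y ∈ t.splitES.piece (j, 0), ∀ k,
      ∀ w ∈ t.splitES.piece (k, 0),
      δ'.mu₃ (t.mapES₃ (x ⊗ₜ (y ⊗ₜ w))) = F (δ.mu₃ (x ⊗ₜ (y ⊗ₜ w))) := by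
    intro i x hx j y hy k w hw
    have h1 : t.mapES₃ (x ⊗ₜ (y ⊗ₜ w)) =
        expPi (-q i.2 j.1) • (t.mapES x ⊗ₜ t.mapES₂ (y ⊗ₜ w)) := by
      rw [t.mapES₃_tmul hx hy hw, t.mapES₂_tmul hy hw, TensorProduct.tmul_smul, smul_smul,
        ← expPi_add, sub_eq_add_neg]
    rw [h1, _root_.map_smul, mu₃_tmul, mu₃_tmul, t.mu₂_mapES₂, mu₂_tmul, t.inclES_mapES,
      t.star_twist (S.tensor S) (TensorProduct.congr e e) _ _ (t.mem_splitES.1 hx)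
        (lTensor_star_mem (S.tensor S) (pairScale S (-p)) (t.mem_splitES.1 hy) (δ.inclES w))
        (fun i => expPi (p i.2.1.2 i.1.2)) (expPi (q i.2 j.1)) ?_, smul_smul, ← expPi_add,
      neg_add_cancel, expPi_zero, one_smul]
    · simp only [F, LinearMap.comp_apply, LinearEquiv.coe_coe, ← star_right]
      rfl
    · intro a b ha hb
      rw [← expPi_add]
      obtain ⟨⟨a1, a2⟩, a3, a4⟩ := a
      obtain ⟨⟨b1, b2⟩, b3⟩ := b
      simp only [Prod.mk.injEq] at ha hb
      obtain ⟨⟨rfl, rfl⟩, ha⟩ := ha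
      obtain rfl := hb
      obtain rfl := (neg_eq_of_add_eq_zero_left ha)
      congr 1
      simp [t.p_self, t.p_skew b2]
  refine tensor_ext (δ'.mu₃ ∘ₗ t.mapES₃) (F ∘ₗ δ.mu₃) (fun x v => ?_) z
  refine t.ES_ext (δ'.mu₃ ∘ₗ t.mapES₃ ∘ₗ (TensorProduct.mk ℂ _ _).flip v)
    (F ∘ₗ δ.mu₃ ∘ₗ (TensorProduct.mk ℂ _ _).flip v) (fun i x hx => ?_) x
  refine tensor_ext (δ'.mu₃ ∘ₗ t.mapES₃ ∘ₗ TensorProduct.mk ℂ _ _ x)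
    (F ∘ₗ δ.mu₃ ∘ₗ TensorProduct.mk ℂ _ _ x) (fun y w => ?_) v
  refine t.ES_ext (δ'.mu₃ ∘ₗ t.mapES₃ ∘ₗ TensorProduct.mk ℂ _ _ x ∘ₗ
      (TensorProduct.mk ℂ _ _).flip w)
    (F ∘ₗ δ.mu₃ ∘ₗ TensorProduct.mk ℂ _ _ x ∘ₗ (TensorProduct.mk ℂ _ _).flip w)
    (fun j y hy => ?_) y
  exact t.ES_ext (δ'.mu₃ ∘ₗ t.mapES₃ ∘ₗ TensorProduct.mk ℂ _ _ x ∘ₗ TensorProduct.mk ℂ _ _ y)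
    (F ∘ₗ δ.mu₃ ∘ₗ TensorProduct.mk ℂ _ _ x ∘ₗ TensorProduct.mk ℂ _ _ y)
    (fun k w hw => key i x hx j y hy k w hw) w

end IsTwist

end ComoduleAlgebra

/-- Composition with the projection onto coarse degree k fixes z and kills the pure homogeneous
tensors of other degrees. -/
theorem Splitting.ext₂_of_mem_coarsen {I J K M N P : Type*} [AddCommGroup M] [Module ℂ M]
    [AddCommGroup N] [Module ℂ N] [AddCommMonoid P] [Module ℂ P] (S : Splitting I M)
    (T : Splitting J N) (f : I × J → K) {k : K} (F F' : M ⊗[ℂ] N →ₗ[ℂ] P)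
    (h : ∀ i, ∀ m ∈ S.piece i, ∀ j, ∀ n ∈ T.piece j, f (i, j) = k → F (m ⊗ₜ n) = F' (m ⊗ₜ n))
    {z : M ⊗[ℂ] N} (hz : z ∈ ((S.tensor T).coarsen f).piece k) : F z = F' z := by
  classical
  have h := S.ext₂ T (F ∘ₗ Finsupp.lapply k ∘ₗ ((S.tensor T).coarsen f).dec)
    (F' ∘ₗ Finsupp.lapply k ∘ₗ ((S.tensor T).coarsen f).dec) (fun i m hm j n hn => by
      simp only [LinearMap.comp_apply, mem_piece.1 (mem_coarsen (tmul_mem hm hn) f),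
        Finsupp.lapply_apply, Finsupp.single_apply]
      split_ifs with hk
      · exact h i m hm j n hn hk
      · simp) z
  simpa [mem_piece.1 hz] using h

/-! ### Compatibility of the weights with the relations over `B` -/

namespace ComoduleAlgebra

namespace IsTwist

variable {D H A H' A' : Type*} [AddCommGroup D] [Ring H] [HopfAlgebra ℂ H] [Ring A]
  [Algebra ℂ A] [Ring H'] [HopfAlgebra ℂ H'] [Ring A'] [Algebra ℂ A'] {q p : D →+ D →+ ℝ}
  {S : Splitting (D × D) A} {T : Splitting (D × D) H} {δ : ComoduleAlgebra H A}
  {δ' : ComoduleAlgebra H' A'} {e : A ≃ₗ[ℂ] A'} {g : H ≃ₗ[ℂ] H'}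
  (t : IsTwist q p S T δ δ' e g)
include t

section Base

variable {s : D} {b : δ.coinv} (hb : (b : A) ∈ S.piece (s, 0)) {i : (D × D) × D} {x : δ.ES}
  (hx : x ∈ t.splitES.piece i)
include hb hx

theorem target_mul_mem :
    δ.target (.op b) * x ∈ t.splitES.piece ((i.1.1, i.1.2 + s), i.2) := by
  rw [t.mem_splitES, inclES_target_mul]
  refine S.ext₂_of_mem_coarsen S _
    ((splitPair S).dec ∘ₗ (LinearMap.mulRight ℂ (b : A)).lTensor A)
    (Finsupp.lsingle ((i.1.1, i.1.2 + s), i.2) ∘ₗ (LinearMap.mulRight ℂ (b : A)).lTensor A)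
    (fun j a ha k c hc hi => ?_) (t.mem_splitES.1 hx)
  have h := Splitting.mem_coarsen (Splitting.tmul_mem ha (t.mul_mem _ _ hc _ _ hb))
    (fun i => ((i.1.1, i.2.1), i.1.2 + i.2.2))
  rw [← hi]
  simpa [Splitting.mem_piece] using h

theorem source_mul_mem :
    δ.source b * x ∈ t.splitES.piece ((s + i.1.1, i.1.2), i.2) := by
  rw [t.mem_splitES, inclES_source_mul]
  refine S.ext₂_of_mem_coarsen S _
    ((splitPair S).dec ∘ₗ (LinearMap.mulLeft ℂ (b : A)).rTensor A)
    (Finsupp.lsingle ((s + i.1.1, i.1.2), i.2) ∘ₗ (LinearMap.mulLeft ℂ (b : A)).rTensor A)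
    (fun j a ha k c hc hi => ?_) (t.mem_splitES.1 hx)
  have h := Splitting.mem_coarsen (Splitting.tmul_mem (t.mul_mem _ _ hb _ _ ha) hc)
    (fun i => ((i.1.1, i.2.1), i.1.2 + i.2.2))
  rw [← hi]
  simpa [Splitting.mem_piece] using h

/-- Only q contributes, because b has second degree 0. -/
theorem mapES_target_mul : t.mapES (δ.target (.op b) * x) =
    expPi (-q i.1.2 s) • (δ'.target (.op (t.mapCoinv b)) * t.mapES x) := by
  apply δ'.inclES_injective
  rw [_root_.map_smul, t.inclES_mapES, inclES_target_mul, inclES_target_mul, t.inclES_mapES]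
  refine S.ext₂_of_mem_coarsen S _
    ((TensorProduct.congr e e).toLinearMap ∘ₗ (LinearMap.mulRight ℂ (b : A)).lTensor A)
    (expPi (-q i.1.2 s) • (LinearMap.mulRight ℂ (t.mapCoinv b : A')).lTensor A' ∘ₗ
      (TensorProduct.congr e e).toLinearMap)
    (fun j a ha k c hc hi => ?_) (t.mem_splitES.1 hx)
  subst hi
  simp only [LinearMap.comp_apply, LinearMap.smul_apply, LinearMap.lTensor_tmul,
    LinearMap.mulRight_apply, LinearEquiv.coe_coe, TensorProduct.congr_tmul, mapCoinv,
    t.map_mul _ _ hc _ _ hb, TensorProduct.tmul_smul, smul_smul, ← expPi_add]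
  simp [expPi_zero]

theorem mapES_source_mul : t.mapES (δ.source b * x) =
    expPi (-q s i.1.1) • (δ'.source (t.mapCoinv b) * t.mapES x) := by
  apply δ'.inclES_injective
  rw [_root_.map_smul, t.inclES_mapES, inclES_source_mul, inclES_source_mul, t.inclES_mapES]
  refine S.ext₂_of_mem_coarsen S _
    ((TensorProduct.congr e e).toLinearMap ∘ₗ (LinearMap.mulLeft ℂ (b : A)).rTensor A)
    (expPi (-q s i.1.1) • (LinearMap.mulLeft ℂ (t.mapCoinv b : A')).rTensor A' ∘ₗ
      (TensorProduct.congr e e).toLinearMap)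
    (fun j a ha k c hc hi => ?_) (t.mem_splitES.1 hx)
  subst hi
  simp only [LinearMap.comp_apply, LinearMap.smul_apply, LinearMap.rTensor_tmul,
    LinearMap.mulLeft_apply, LinearEquiv.coe_coe, TensorProduct.congr_tmul, mapCoinv,
    t.map_mul _ _ hb _ _ ha, ← TensorProduct.smul_tmul', smul_smul, ← expPi_add]
  simp [expPi_zero]

end Base

/-- The count of `mapPair_mem` again: with r' the inner first degree of x, s that of b and l that of
y, both sides carry the exponent -(q(r', s) + q(r', l) + q(s, l)). -/
theorem mkES_mapES₂_balanced (b : δ.coinv) (x y : δ.ES) :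
    δ'.mkES (t.mapES₂ ((δ.target (.op b) * x) ⊗ₜ y)) =
      δ'.mkES (t.mapES₂ (x ⊗ₜ (δ.source b * y))) := by
  let F : δ.ES ⊗[ℂ] δ.ES →ₗ[ℂ] δ'.ESTensor := δ'.mkES ∘ₗ t.mapES₂
  let τ : δ.coinv →ₗ[ℂ] δ.ES := δ.target.toLinearMap ∘ₗ (MulOpposite.opLinearEquiv ℂ).toLinearMap
  refine t.coinv_ext (F ∘ₗ (TensorProduct.mk ℂ _ _).flip y ∘ₗ LinearMap.mulRight ℂ x ∘ₗ τ)
    (F ∘ₗ TensorProduct.mk ℂ _ _ x ∘ₗ LinearMap.mulRight ℂ y ∘ₗ δ.source.toLinearMap)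
    (fun s b hb => ?_) b
  refine t.ES_ext (F ∘ₗ (TensorProduct.mk ℂ _ _).flip y ∘ₗ LinearMap.mulLeft ℂ (τ b))
    (F ∘ₗ (TensorProduct.mk ℂ _ _).flip (δ.source b * y)) (fun i x hx => ?_) x
  refine t.ES_ext (F ∘ₗ TensorProduct.mk ℂ _ _ (τ b * x))
    (F ∘ₗ TensorProduct.mk ℂ _ _ x ∘ₗ LinearMap.mulLeft ℂ (δ.source b)) (fun j y hy => ?_) y
  have h : δ'.mkES ((δ'.target (.op (t.mapCoinv b)) * t.mapES x) ⊗ₜ t.mapES y) =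
      δ'.mkES (t.mapES x ⊗ₜ (δ'.source (t.mapCoinv b) * t.mapES y)) := by
    rw [← sub_eq_zero, ← map_sub]
    exact (Submodule.Quotient.mk_eq_zero _).2 (Submodule.subset_span ⟨_, _, _, rfl⟩)
  change δ'.mkES (t.mapES₂ ((δ.target (.op b) * x) ⊗ₜ y)) =
    δ'.mkES (t.mapES₂ (x ⊗ₜ (δ.source b * y)))
  rw [t.mapES₂_tmul (t.target_mul_mem hb hx) hy, t.mapES₂_tmul hx (t.source_mul_mem hb hy),
    t.mapES_target_mul hb hx, t.mapES_source_mul hb hy, TensorProduct.tmul_smul,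
    ← TensorProduct.smul_tmul', smul_smul, smul_smul, ← expPi_add, ← expPi_add,
    _root_.map_smul, _root_.map_smul, h]
  congr 2
  simp only [_root_.map_add, AddMonoidHom.add_apply]
  ring

theorem mkES_mapES₂ (z : δ.ES ⊗[ℂ] δ.ES) (hz : δ.mkES z = 0) : δ'.mkES (t.mapES₂ z) = 0 :=
  (balancedRel_le (δ'.mkES ∘ₗ t.mapES₂) t.mkES_mapES₂_balanced :
    _ ≤ LinearMap.ker (δ'.mkES ∘ₗ t.mapES₂)) ((Submodule.Quotient.mk_eq_zero _).1 hz)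

end IsTwist

end ComoduleAlgebra

/-! ### Transfer of `IsBalancedFaithful` to the twist -/

namespace ComoduleAlgebra

namespace IsTwist

variable {D H A H' A' : Type*} [AddCommGroup D] [Ring H] [HopfAlgebra ℂ H] [Ring A]
  [Algebra ℂ A] [Ring H'] [HopfAlgebra ℂ H'] [Ring A'] [Algebra ℂ A'] {q p : D →+ D →+ ℝ}
  {S : Splitting (D × D) A} {T : Splitting (D × D) H} {δ : ComoduleAlgebra H A}
  {δ' : ComoduleAlgebra H' A'} {e : A ≃ₗ[ℂ] A'} {g : H ≃ₗ[ℂ] H'}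
  (t : IsTwist q p S T δ δ' e g)
include t

/-- The map `C ⊗ C ⊗ C → C' ⊗_{B'} C' ⊗_{B'} C'`. -/
def projES₃ : δ.ES ⊗[ℂ] (δ.ES ⊗[ℂ] δ.ES) →ₗ[ℂ]
    BTensor₃ (B := δ'.coinv) (L := δ'.ES) δ'.source δ'.target :=
  (balancedRel₃ (B := δ'.coinv) (L := δ'.ES) δ'.source δ'.target).mkQ ∘ₗ t.mapES₃

theorem projES₃_tmul {i j k : (D × D) × D} {x y w : δ.ES} (hx : x ∈ t.splitES.piece i)
    (hy : y ∈ t.splitES.piece j) (hw : w ∈ t.splitES.piece k) :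
    t.projES₃ (x ⊗ₜ (y ⊗ₜ w)) = expPi (-q i.1.2 j.1.1 - q j.1.2 k.1.1) •
      (balancedRel₃ (B := δ'.coinv) (L := δ'.ES) δ'.source δ'.target).mkQ
        (t.mapES x ⊗ₜ (t.mapES y ⊗ₜ t.mapES w)) := by
  rw [projES₃, LinearMap.comp_apply, t.mapES₃_tmul hx hy hw, _root_.map_smul]

/-- The weight between y and w involves the second factor of y, which s(b) leaves alone; the rest is
the count for two factors. -/
theorem projES₃_left (b : δ.coinv) (x y w : δ.ES) :
    t.projES₃ ((δ.target (.op b) * x) ⊗ₜ (y ⊗ₜ w)) =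
      t.projES₃ (x ⊗ₜ ((δ.source b * y) ⊗ₜ w)) := by
  let F := t.projES₃
  let τ : δ.coinv →ₗ[ℂ] δ.ES := δ.target.toLinearMap ∘ₗ (MulOpposite.opLinearEquiv ℂ).toLinearMap
  refine t.coinv_ext (F ∘ₗ (TensorProduct.mk ℂ _ _).flip (y ⊗ₜ w) ∘ₗ LinearMap.mulRight ℂ x ∘ₗ τ)
    (F ∘ₗ TensorProduct.mk ℂ _ _ x ∘ₗ (TensorProduct.mk ℂ _ _).flip w ∘ₗ
      LinearMap.mulRight ℂ y ∘ₗ δ.source.toLinearMap) (fun s b hb => ?_) b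
  refine t.ES_ext (F ∘ₗ (TensorProduct.mk ℂ _ _).flip (y ⊗ₜ w) ∘ₗ LinearMap.mulLeft ℂ (τ b))
    (F ∘ₗ (TensorProduct.mk ℂ _ _).flip ((δ.source b * y) ⊗ₜ w)) (fun i x hx => ?_) x
  refine t.ES_ext (F ∘ₗ TensorProduct.mk ℂ _ _ (τ b * x) ∘ₗ (TensorProduct.mk ℂ _ _).flip w)
    (F ∘ₗ TensorProduct.mk ℂ _ _ x ∘ₗ (TensorProduct.mk ℂ _ _).flip w ∘ₗ
      LinearMap.mulLeft ℂ (δ.source b)) (fun j y hy => ?_) y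
  refine t.ES_ext (F ∘ₗ TensorProduct.mk ℂ _ _ (τ b * x) ∘ₗ TensorProduct.mk ℂ _ _ y)
    (F ∘ₗ TensorProduct.mk ℂ _ _ x ∘ₗ TensorProduct.mk ℂ _ _ (δ.source b * y))
    (fun k w hw => ?_) w
  have h : (balancedRel₃ (B := δ'.coinv) (L := δ'.ES) δ'.source δ'.target).mkQ
        ((δ'.target (.op (t.mapCoinv b)) * t.mapES x) ⊗ₜ (t.mapES y ⊗ₜ t.mapES w)) =
      (balancedRel₃ (B := δ'.coinv) (L := δ'.ES) δ'.source δ'.target).mkQ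
        (t.mapES x ⊗ₜ ((δ'.source (t.mapCoinv b) * t.mapES y) ⊗ₜ t.mapES w)) := by
    rw [← sub_eq_zero, ← map_sub]
    exact (Submodule.Quotient.mk_eq_zero _).2 (Submodule.subset_span (Or.inl ⟨_, _, _, _, rfl⟩))
  change t.projES₃ ((δ.target (.op b) * x) ⊗ₜ (y ⊗ₜ w)) =
    t.projES₃ (x ⊗ₜ ((δ.source b * y) ⊗ₜ w))
  rw [t.projES₃_tmul (t.target_mul_mem hb hx) hy hw, t.projES₃_tmul hx (t.source_mul_mem hb hy) hw,
    t.mapES_target_mul hb hx, t.mapES_source_mul hb hy, ← TensorProduct.smul_tmul',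
    ← TensorProduct.smul_tmul', TensorProduct.tmul_smul, _root_.map_smul, _root_.map_smul,
    smul_smul, smul_smul, ← expPi_add, ← expPi_add, h]
  congr 2
  simp only [_root_.map_add, AddMonoidHom.add_apply]
  ring

theorem projES₃_right (b : δ.coinv) (x y w : δ.ES) :
    t.projES₃ (x ⊗ₜ ((δ.target (.op b) * y) ⊗ₜ w)) =
      t.projES₃ (x ⊗ₜ (y ⊗ₜ (δ.source b * w))) := by
  let F := t.projES₃
  let τ : δ.coinv →ₗ[ℂ] δ.ES := δ.target.toLinearMap ∘ₗ (MulOpposite.opLinearEquiv ℂ).toLinearMap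
  refine t.coinv_ext (F ∘ₗ TensorProduct.mk ℂ _ _ x ∘ₗ (TensorProduct.mk ℂ _ _).flip w ∘ₗ
      LinearMap.mulRight ℂ y ∘ₗ τ)
    (F ∘ₗ TensorProduct.mk ℂ _ _ x ∘ₗ TensorProduct.mk ℂ _ _ y ∘ₗ
      LinearMap.mulRight ℂ w ∘ₗ δ.source.toLinearMap) (fun s b hb => ?_) b
  refine t.ES_ext (F ∘ₗ (TensorProduct.mk ℂ _ _).flip ((τ b * y) ⊗ₜ w))
    (F ∘ₗ (TensorProduct.mk ℂ _ _).flip (y ⊗ₜ (δ.source b * w))) (fun i x hx => ?_) x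
  refine t.ES_ext (F ∘ₗ TensorProduct.mk ℂ _ _ x ∘ₗ (TensorProduct.mk ℂ _ _).flip w ∘ₗ
      LinearMap.mulLeft ℂ (τ b))
    (F ∘ₗ TensorProduct.mk ℂ _ _ x ∘ₗ (TensorProduct.mk ℂ _ _).flip (δ.source b * w))
    (fun j y hy => ?_) y
  refine t.ES_ext (F ∘ₗ TensorProduct.mk ℂ _ _ x ∘ₗ TensorProduct.mk ℂ _ _ (τ b * y))
    (F ∘ₗ TensorProduct.mk ℂ _ _ x ∘ₗ TensorProduct.mk ℂ _ _ y ∘ₗ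
      LinearMap.mulLeft ℂ (δ.source b)) (fun k w hw => ?_) w
  have h : (balancedRel₃ (B := δ'.coinv) (L := δ'.ES) δ'.source δ'.target).mkQ
        (t.mapES x ⊗ₜ ((δ'.target (.op (t.mapCoinv b)) * t.mapES y) ⊗ₜ t.mapES w)) =
      (balancedRel₃ (B := δ'.coinv) (L := δ'.ES) δ'.source δ'.target).mkQ
        (t.mapES x ⊗ₜ (t.mapES y ⊗ₜ (δ'.source (t.mapCoinv b) * t.mapES w))) := by
    rw [← sub_eq_zero, ← map_sub]
    exact (Submodule.Quotient.mk_eq_zero _).2 (Submodule.subset_span (Or.inr ⟨_, _, _, _, rfl⟩))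
  change t.projES₃ (x ⊗ₜ ((δ.target (.op b) * y) ⊗ₜ w)) =
    t.projES₃ (x ⊗ₜ (y ⊗ₜ (δ.source b * w)))
  rw [t.projES₃_tmul hx (t.target_mul_mem hb hy) hw, t.projES₃_tmul hx hy (t.source_mul_mem hb hw),
    t.mapES_target_mul hb hy, t.mapES_source_mul hb hw, ← TensorProduct.smul_tmul',
    TensorProduct.tmul_smul, TensorProduct.tmul_smul, TensorProduct.tmul_smul,
    _root_.map_smul, _root_.map_smul, smul_smul, smul_smul, ← expPi_add, ← expPi_add, h]
  congr 2
  simp only [_root_.map_add, AddMonoidHom.add_apply]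
  ring

theorem balancedRel₃_le_ker : balancedRel₃ (B := δ.coinv) (L := δ.ES) δ.source δ.target ≤
    LinearMap.ker t.projES₃ := by
  rw [balancedRel₃, Submodule.span_le]
  rintro _ (⟨b, x, y, w, rfl⟩ | ⟨b, x, y, w, rfl⟩)
  · exact LinearMap.mem_ker.2 ((map_sub _ _ _).trans (sub_eq_zero.2 (t.projES₃_left b x y w)))
  · exact LinearMap.mem_ker.2 ((map_sub _ _ _).trans (sub_eq_zero.2 (t.projES₃_right b x y w)))

theorem mapES₃_mem {z : δ.ES ⊗[ℂ] (δ.ES ⊗[ℂ] δ.ES)}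
    (hz : z ∈ balancedRel₃ (B := δ.coinv) (L := δ.ES) δ.source δ.target) :
    t.mapES₃ z ∈ balancedRel₃ (B := δ'.coinv) (L := δ'.ES) δ'.source δ'.target :=
  (Submodule.Quotient.mk_eq_zero _).1 (t.balancedRel₃_le_ker hz)

theorem congr_insOne (X : A ⊗[ℂ] A) :
    TensorProduct.congr e (TensorProduct.congr e e) (insOne A A X) =
      insOne A' A' (TensorProduct.congr e e X) :=
  tensor_ext ((TensorProduct.congr e (TensorProduct.congr e e)).toLinearMap ∘ₗ insOne A A)
    (insOne A' A' ∘ₗ (TensorProduct.congr e e).toLinearMap) (fun _ _ => by simp [t.map_one]) X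

theorem pairScale_insOne (X : A ⊗[ℂ] A) :
    (pairScale S (-p)).lTensor A (insOne A A X) = insOne A A X :=
  S.ext₂ S ((pairScale S (-p)).lTensor A ∘ₗ insOne A A) (insOne A A) (fun i a _ j b hb => by
    simp [pairScale_tmul (-p) t.one_mem hb, expPi_zero]) X

omit t in
theorem lTensor_pairScale (X : A ⊗[ℂ] (A ⊗[ℂ] A)) :
    (pairScale S p).lTensor A ((pairScale S (-p)).lTensor A X) = X :=
  tensor_ext ((pairScale S p).lTensor A ∘ₗ (pairScale S (-p)).lTensor A) LinearMap.id
    (fun a Y => by simp [pairScale_neg']) X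

omit t in
theorem lTensor_lTensor_pairScale (X : A ⊗[ℂ] (A ⊗[ℂ] (A ⊗[ℂ] A))) :
    ((pairScale S p).lTensor A).lTensor A (((pairScale S (-p)).lTensor A).lTensor A X) = X :=
  tensor_ext (((pairScale S p).lTensor A).lTensor A ∘ₗ ((pairScale S (-p)).lTensor A).lTensor A)
    LinearMap.id (fun a Y => by
      simp only [LinearMap.comp_apply, LinearMap.lTensor_tmul, lTensor_pairScale,
        LinearMap.id_apply]) X

theorem mu₂_eq_zero {z : δ.ES ⊗[ℂ] δ.ES} (hz : δ'.mu₂ (t.mapES₂ z) = 0) : δ.mu₂ z = 0 := by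
  rw [t.mu₂_mapES₂] at hz
  have h := (LinearEquiv.map_eq_zero_iff _).1 hz
  rw [← lTensor_pairScale (S := S) (p := p) (δ.mu₂ z), h, _root_.map_zero]

theorem mu₃_eq_zero {z : δ.ES ⊗[ℂ] (δ.ES ⊗[ℂ] δ.ES)} (hz : δ'.mu₃ (t.mapES₃ z) = 0) :
    δ.mu₃ z = 0 := by
  rw [t.mu₃_mapES₃] at hz
  have h := (LinearEquiv.map_eq_zero_iff _).1 hz
  rw [tripleScale] at h
  have h := (Splitting.scale_bijective _ fun _ => expPi_ne_zero _).1
    (h.trans (_root_.map_zero _).symm)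
  rw [← lTensor_lTensor_pairScale (S := S) (p := p) (δ.mu₃ z), h, _root_.map_zero]

theorem exists_mu₂_eq (hE : δ.IsBalancedFaithful) (y : δ'.ES) :
    ∃ z, δ'.mu₂ z = insOne A' A' (δ'.inclES y) := by
  obtain ⟨x, rfl⟩ := t.mapES.surjective y
  obtain ⟨z, hz⟩ := hE.exists_mu₂_eq x
  exact ⟨t.mapES₂ z, by
    rw [t.mu₂_mapES₂, hz, t.pairScale_insOne, t.congr_insOne, t.inclES_mapES]⟩

/-- The weighted identifications are onto, respect the relations over B and B', and intertwine `mu₂`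
and `mu₃` up to invertible operators. Nothing is asked of A' as a B'-module. -/
theorem isBalancedFaithful (hE : δ.IsBalancedFaithful) : δ'.IsBalancedFaithful where
  ker_mu₂_le z hz := by
    obtain ⟨z, rfl⟩ := t.mapES₂_surjective z
    exact t.mkES_mapES₂ z (hE.ker_mu₂_le z (t.mu₂_eq_zero hz))
  ker_mu₃_le z hz := by
    obtain ⟨z, rfl⟩ := t.mapES₃_surjective z
    exact t.mapES₃_mem (hE.ker_mu₃_le z (t.mu₃_eq_zero hz))
  exists_mu₂_eq := t.exists_mu₂_eq hE

end IsTwist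

end ComoduleAlgebra

/-! ### A common representative of the two coproducts -/

namespace ComoduleAlgebra

namespace IsTwist

variable {D H A H' A' : Type*} [AddCommGroup D] [Ring H] [HopfAlgebra ℂ H] [Ring A]
  [Algebra ℂ A] [Ring H'] [HopfAlgebra ℂ H'] [Ring A'] [Algebra ℂ A'] {q p : D →+ D →+ ℝ}
  {S : Splitting (D × D) A} {T : Splitting (D × D) H} {δ : ComoduleAlgebra H A}
  {δ' : ComoduleAlgebra H' A'} {e : A ≃ₗ[ℂ] A'} {g : H ≃ₗ[ℂ] H'}
  (t : IsTwist q p S T δ δ' e g)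
include t

omit t in
/-- The grading of `A ⊗ A ⊗ A` by the first degree of the middle factor. -/
abbrev splitMiddle (S : Splitting (D × D) A) : Splitting D (A ⊗[ℂ] (A ⊗[ℂ] A)) :=
  (S.tensor (S.tensor S)).coarsen fun i => i.2.1.1

theorem mu₂_tmul_mem (i : (D × D) × D) (x : δ.ES) (hx : x ∈ t.splitES.piece i) (j : (D × D) × D)
    (y : δ.ES) (hy : y ∈ t.splitES.piece j) :
    δ.mu₂ (x ⊗ₜ y) ∈ (splitMiddle S).piece (i.1.2 + j.1.1) := by
  rw [mu₂_tmul]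
  refine S.ext₂_of_mem_coarsen S _ ((splitMiddle S).dec ∘ₗ star A A ∘ₗ
      (TensorProduct.mk ℂ _ _).flip (δ.inclES y))
    (Finsupp.lsingle (i.1.2 + j.1.1) ∘ₗ star A A ∘ₗ
      (TensorProduct.mk ℂ _ _).flip (δ.inclES y)) (fun k a ha l b hb hi => ?_) (t.mem_splitES.1 hx)
  refine S.ext₂_of_mem_coarsen S _ ((splitMiddle S).dec ∘ₗ star A A ∘ₗ
      TensorProduct.mk ℂ _ _ (a ⊗ₜ b))
    (Finsupp.lsingle (i.1.2 + j.1.1) ∘ₗ star A A ∘ₗ TensorProduct.mk ℂ _ _ (a ⊗ₜ b))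
    (fun m c hc o d hd hj => ?_) (t.mem_splitES.1 hy)
  rw [← hi, ← hj]
  exact Splitting.mem_coarsen (t.star_mem S _ _
    (Splitting.tmul_mem (Splitting.tmul_mem ha hb) (Splitting.tmul_mem hc hd))) _

theorem scale_insOne {c : D → ℂ} (hc : c 0 = 1) (X : A ⊗[ℂ] A) :
    (splitMiddle S).scale c (insOne A A X) = insOne A A X := by
  refine S.ext₂ S ((splitMiddle S).scale c ∘ₗ insOne A A) (insOne A A) (fun i a ha j b hb => ?_) X
  have h : a ⊗ₜ (1 ⊗ₜ b) ∈ (splitMiddle S).piece 0 := Splitting.mem_coarsen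
    (Splitting.tmul_mem ha (Splitting.tmul_mem t.one_mem hb)) fun i => i.2.1.1
  rw [LinearMap.comp_apply, insOne_tmul, Splitting.scale_of_mem _ h, hc, one_smul]

open Classical in
/-- The projection of `C ⊗ C` onto the sum of its components of degrees `(r, r')` and `(l, l')` with
`r' + l = 0`. -/
def projMiddle : δ.ES ⊗[ℂ] δ.ES →ₗ[ℂ] δ.ES ⊗[ℂ] δ.ES :=
  (t.splitES.tensor t.splitES).scale fun i => if i.1.1.2 + i.2.1.1 = 0 then 1 else 0

theorem mu₂_mem (k : ((D × D) × D) × (D × D) × D) (z : δ.ES ⊗[ℂ] δ.ES)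
    (hz : z ∈ (t.splitES.tensor t.splitES).piece k) :
    δ.mu₂ z ∈ (splitMiddle S).piece (k.1.1.2 + k.2.1.1) :=
  Splitting.map_mem_tensor t.splitES t.splitES (splitMiddle S) δ.mu₂
    (fun i => i.1.1.2 + i.2.1.1) t.mu₂_tmul_mem k z hz

theorem mu₂_scale (c : D → ℂ) (z : δ.ES ⊗[ℂ] δ.ES) :
    (splitMiddle S).scale c (δ.mu₂ z) =
      δ.mu₂ ((t.splitES.tensor t.splitES).scale (fun i => c (i.1.1.2 + i.2.1.1)) z) :=
  (t.splitES.tensor t.splitES).scale_map (splitMiddle S) δ.mu₂ (fun i => i.1.1.2 + i.2.1.1)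
    t.mu₂_mem c z

-- Under `mu₂` the inner first degrees r' and l add up to the degree of the middle factor, so the
-- projection onto r' + l = 0 corresponds to the projection onto middle degree 0.
open Classical in
theorem mu₂_projMiddle (z : δ.ES ⊗[ℂ] δ.ES) :
    δ.mu₂ (t.projMiddle z) = (splitMiddle S).scale (fun d => if d = 0 then 1 else 0) (δ.mu₂ z) :=
  (t.mu₂_scale (fun d => if d = 0 then 1 else 0) z).symm

/-- Where r' + l = 0 the weight is trivial, as q(r', -r') = 0; elsewhere the projection vanishes. -/
theorem mapES₂_projMiddle (z : δ.ES ⊗[ℂ] δ.ES) : t.mapES₂ (t.projMiddle z) =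
    TensorProduct.map t.mapES.toLinearMap t.mapES.toLinearMap (t.projMiddle z) := by
  rw [mapES₂, LinearMap.comp_apply, projMiddle, Splitting.scale_scale]
  congr 3
  funext i
  split_ifs with h
  · rw [← neg_eq_of_add_eq_zero_right h]
    simp [t.q_self, expPi_zero]
  · simp

/-- The middle factor of a ⊗ 1 ⊗ a' has degree 0, so the projection of a representative of Δ(x) is
still one. On it the weighted identification, which carries representatives to representatives, is
the plain one. -/
theorem exists_comul_eq (hE : δ.IsBalancedFaithful) (hE' : δ'.IsBalancedFaithful) (x : δ.ES) :
    ∃ z, δ.mkES z = hE.comul x ∧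
      δ'.mkES (TensorProduct.map t.mapES.toLinearMap t.mapES.toLinearMap z) =
        hE'.comul (t.mapES x) := by
  obtain ⟨z, hz⟩ := hE.exists_mu₂_eq x
  have h : δ.mu₂ (t.projMiddle z) = insOne A A (δ.inclES x) := by
    rw [t.mu₂_projMiddle, hz, t.scale_insOne (if_pos rfl)]
  refine ⟨t.projMiddle z, hE.mk_eq_comul_iff.2 h, hE'.mk_eq_comul_iff.2 ?_⟩
  rw [← t.mapES₂_projMiddle, t.mu₂_mapES₂, h, t.pairScale_insOne, t.congr_insOne, t.inclES_mapES]

theorem deformsToHopfAlgebroid (hG : δ.IsHopfGalois) (hE : δ.IsBalancedFaithful)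
    (hF : ∀ x : δ.ES, δ.diag (TensorProduct.comm ℂ A A (δ.inclES x)) =
      TensorProduct.comm ℂ A A (δ.inclES x) ⊗ₜ 1) : δ.DeformsToHopfAlgebroid δ' e :=
  ⟨hG, t.isHopfGalois hG, hE.comul, flipES hF, (t.isBalancedFaithful hE).comul,
    flipES (t.diag_comm_inclES hF), t.mapES, isFlipHopfAlgebroid δ hG hE hF,
    isFlipHopfAlgebroid δ' _ _ _, t.coinv_iff, t.inclES_mapES,
    t.exists_comul_eq hE (t.isBalancedFaithful hE)⟩

end IsTwist

end ComoduleAlgebra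

/-! ### Stability of `C` under the flip, and the two scenarios as twists -/

namespace ComoduleAlgebra

/-- This is a₁b₁ = b₁a₁ in the commutative algebra H. -/
theorem diag_comm {H A : Type*} [CommRing H] [HopfAlgebra ℂ H] [Ring A] [Algebra ℂ A]
    (δ : ComoduleAlgebra H A) (X : A ⊗[ℂ] A) : δ.diag (TensorProduct.comm ℂ A A X) =
      (TensorProduct.comm ℂ A A).toLinearMap.rTensor H (δ.diag X) := by
  have h : ∀ z : (A ⊗[ℂ] H) ⊗[ℂ] (A ⊗[ℂ] H),
      mulTensor A A H (TensorProduct.comm ℂ _ _ z) =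
        (TensorProduct.comm ℂ A A).toLinearMap.rTensor H (mulTensor A A H z) :=
    tensor_ext₄ (mulTensor A A H ∘ₗ (TensorProduct.comm ℂ _ _).toLinearMap)
      ((TensorProduct.comm ℂ A A).toLinearMap.rTensor H ∘ₗ mulTensor A A H)
      (fun a h b k => by simp [mulTensor_tmul, mul_comm])
  refine tensor_ext (δ.diag ∘ₗ (TensorProduct.comm ℂ A A).toLinearMap)
    ((TensorProduct.comm ℂ A A).toLinearMap.rTensor H ∘ₗ δ.diag) (fun a b => ?_) X
  exact h (δ.coact a ⊗ₜ δ.coact b)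

theorem diag_comm_inclES {H A : Type*} [CommRing H] [HopfAlgebra ℂ H] [Ring A] [Algebra ℂ A]
    (δ : ComoduleAlgebra H A) (x : δ.ES) : δ.diag (TensorProduct.comm ℂ A A (δ.inclES x)) =
      TensorProduct.comm ℂ A A (δ.inclES x) ⊗ₜ 1 := by
  rw [diag_comm, diag_inclES]
  rfl

end ComoduleAlgebra

theorem Splitting.mem_trivial_iff {I M : Type*} [AddCommGroup M] [Module ℂ M] {i j : I} {m : M} :
    m ∈ (trivial i : Splitting I M).piece j ↔ i = j ∨ m = 0 := by
  refine (Finsupp.single_eq_single_iff i j m m).trans ?_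
  tauto

theorem tensorSub_mono {M N : Type*} [AddCommGroup M] [Module ℂ M] [AddCommGroup N] [Module ℂ N]
    {U U' : Submodule ℂ M} {V V' : Submodule ℂ N} (hU : U ≤ U') (hV : V ≤ V') :
    tensorSub U V ≤ tensorSub U' V' := by
  rintro _ ⟨z, rfl⟩
  exact ⟨TensorProduct.map (Submodule.inclusion hU) (Submodule.inclusion hV) z,
    tensor_ext (TensorProduct.map U'.subtype V'.subtype ∘ₗ
      TensorProduct.map (Submodule.inclusion hU) (Submodule.inclusion hV))
      (TensorProduct.map U.subtype V.subtype) (fun _ _ => rfl) z⟩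

section Graded

variable {n : ℕ} {A : Type*} [Ring A] [Algebra ℂ A] (𝒜 : Deg n → Submodule ℂ A) [GradedAlgebra 𝒜]

/-- A grading, as a bigrading that is concentrated in the second degree zero. -/
def splitGraded : Splitting (Deg n × Deg n) A :=
  (Splitting.ofDecomposition 𝒜).coarsen fun r => (r, 0)

theorem mem_splitGraded {r : Deg n × Deg n} {a : A} :
    a ∈ (splitGraded 𝒜).piece r ↔ (r.2 = 0 ∧ a ∈ 𝒜 r.1) ∨ a = 0 := by
  constructor
  · intro h
    by_cases hr : r.2 = 0
    · obtain ⟨r, l⟩ := r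
      obtain rfl : l = 0 := hr
      exact Or.inl ⟨rfl, (Splitting.mem_ofDecomposition 𝒜).1
        ((Splitting.ofDecomposition 𝒜).mem_piece_of_coarsen (f := fun r => (r, (0 : Deg n)))
          (fun _ _ h => congrArg Prod.fst h) h)⟩
    · exact Or.inr ((Splitting.ofDecomposition 𝒜).eq_zero_of_coarsen
        (fun i hi => hr (congrArg Prod.snd hi).symm) h)
  · rintro (⟨hr, h⟩ | rfl)
    · obtain ⟨r, l⟩ := r
      obtain rfl : l = 0 := hr
      exact Splitting.mem_coarsen ((Splitting.mem_ofDecomposition 𝒜).2 h) fun r => (r, 0)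
    · exact zero_mem _

end Graded

namespace ComoduleAlgebra

/-- Scenario I has p = 0: A is placed in second degree 0 and H entirely in degree (0, 0), so only s
= 0 is needed for the coaction. -/
theorem isTwist_deform {n : ℕ} (θ : SkewMatrix n) {H A : Type*} [Ring H] [HopfAlgebra ℂ H]
    [Ring A] [Algebra ℂ A] (δ : ComoduleAlgebra H A) (𝒜 : Deg n → Submodule ℂ A)
    [GradedAlgebra 𝒜] (hδ : δ.IsGraded 𝒜) :
    IsTwist (form θ.1) 0 (splitGraded 𝒜) (Splitting.trivial 0) δ (δ.deform (form θ.1) 𝒜 hδ)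
      (Twist.equiv (form θ.1) 𝒜) (LinearEquiv.refl ℂ H) where
  p_self _ := rfl
  q_self := form_self θ
  one_mem := (mem_splitGraded 𝒜).2 (Or.inl ⟨rfl, SetLike.GradedOne.one_mem⟩)
  mul_mem r a ha l b hb := by
    rw [mem_splitGraded] at ha hb ⊢
    rcases ha with ⟨hr, ha⟩ | rfl
    · rcases hb with ⟨hl, hb⟩ | rfl
      · exact Or.inl ⟨by rw [Prod.snd_add, hr, hl, add_zero], SetLike.GradedMul.mul_mem ha hb⟩
      · exact Or.inr (mul_zero a)
    · exact Or.inr (zero_mul b)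
  one_mem_hopf := Splitting.mem_trivial _ _
  mul_mem_hopf r h hh l k hk := by
    rw [Splitting.mem_trivial_iff] at hh hk ⊢
    rcases hh with rfl | rfl
    · rcases hk with rfl | rfl
      · exact Or.inl (add_zero 0).symm
      · exact Or.inr (mul_zero h)
    · exact Or.inr (zero_mul k)
  map_one := Twist.equiv_one _ 𝒜
  map_one_hopf := rfl
  map_mul r a ha l b hb := by
    rw [mem_splitGraded] at ha hb
    rcases ha with ⟨hr, ha⟩ | rfl
    · rcases hb with ⟨hl, hb⟩ | rfl
      · rw [Twist.equiv_mul_of_mem _ 𝒜 ha hb, AddMonoidHom.zero_apply, AddMonoidHom.zero_apply,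
          add_zero]
        rfl
      · simp
    · simp
  map_mul_hopf r h hh l k hk := by simp [expPi_zero]
  coact_mem r l a ha := by
    rw [mem_splitGraded] at ha
    rcases ha with ⟨rfl, ha⟩ | rfl
    · refine Submodule.mem_iSup_of_mem 0 (tensorSub_mono (fun x hx => ?_) (fun x _ => ?_) (hδ r a ha))
      · exact (mem_splitGraded 𝒜).2 (Or.inl ⟨rfl, hx⟩)
      · exact Splitting.mem_trivial _ _
    · rw [_root_.map_zero]
      exact zero_mem _
  coact_map _ := rfl

/-- Scenario II has q and p given by θ and -θ. Then (q, p) and (-p, p) are the same pair of forms,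
as it must be since A and H are twisted by the same Θ. -/
theorem isTwist_bideform {n : ℕ} (θ : SkewMatrix n) {H A : Type*} [Ring H] [HopfAlgebra ℂ H]
    [Ring A] [Algebra ℂ A] (δ : ComoduleAlgebra H A) (ℋ : Deg n × Deg n → Submodule ℂ H)
    [GradedAlgebra ℋ] [IsBigradedHopf ℋ] (𝒜 : Deg n × Deg n → Submodule ℂ A) [GradedAlgebra 𝒜]
    (hδ : δ.IsBigraded 𝒜 ℋ) :
    IsTwist (form θ.1) (form (-θ.1)) (Splitting.ofDecomposition 𝒜) (Splitting.ofDecomposition ℋ) δ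
      (δ.bideform θ ℋ 𝒜 hδ) (Twist.equiv (biform θ.1) 𝒜) (Twist.equiv (biform θ.1) ℋ) where
  p_self r := by rw [form_neg, form_self, neg_zero]
  q_self := form_self θ
  one_mem := (Splitting.mem_ofDecomposition 𝒜).2 SetLike.GradedOne.one_mem
  mul_mem r a ha l b hb := by
    rw [Splitting.mem_ofDecomposition] at ha hb ⊢
    exact SetLike.GradedMul.mul_mem ha hb
  one_mem_hopf := (Splitting.mem_ofDecomposition ℋ).2 SetLike.GradedOne.one_mem
  mul_mem_hopf r h hh l k hk := by
    rw [Splitting.mem_ofDecomposition] at hh hk ⊢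
    exact SetLike.GradedMul.mul_mem hh hk
  map_one := Twist.equiv_one _ 𝒜
  map_one_hopf := Twist.equiv_one _ ℋ
  map_mul r a ha l b hb := by
    rw [Splitting.mem_ofDecomposition] at ha hb
    exact Twist.equiv_mul_of_mem _ 𝒜 ha hb
  map_mul_hopf r h hh l k hk := by
    rw [Splitting.mem_ofDecomposition] at hh hk
    rw [form_neg, neg_neg]
    exact Twist.equiv_mul_of_mem _ ℋ hh hk
  coact_mem r l a ha := by
    rw [Splitting.mem_ofDecomposition] at ha
    refine (iSup_mono fun s => tensorSub_mono (fun x hx => ?_) (fun x hx => ?_) :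
      _ ≤ ⨆ s, _) (hδ r l a ha)
    · exact (Splitting.mem_ofDecomposition 𝒜).2 hx
    · exact (Splitting.mem_ofDecomposition ℋ).2 hx
  coact_map _ := rfl

end ComoduleAlgebra

end HopfAlgebroids

end

theorem mainTheorem1 {n : ℕ} (θ : SkewMatrix n) {H A : Type u} [CommRing H] [HopfAlgebra ℂ H]
    [Ring A] [Algebra ℂ A] (δ : ComoduleAlgebra H A) (hGalois : δ.IsHopfGalois)
    (hflat : δ.IsFaithfullyFlat) :
    (∀ (𝒜 : Deg n → Submodule ℂ A) [GradedAlgebra 𝒜] (hδ : δ.IsGraded 𝒜),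
      δ.DeformsToHopfAlgebroid (δ.deform (form θ.1) 𝒜 hδ) (Twist.equiv (form θ.1) 𝒜)) ∧
    (∀ (ℋ : Deg n × Deg n → Submodule ℂ H) [GradedAlgebra ℋ] [IsBigradedHopf ℋ]
      (𝒜 : Deg n × Deg n → Submodule ℂ A) [GradedAlgebra 𝒜] (hδ : δ.IsBigraded 𝒜 ℋ),
      δ.DeformsToHopfAlgebroid (δ.bideform θ ℋ 𝒜 hδ) (Twist.equiv (biform θ.1) 𝒜)) :=
  ⟨fun 𝒜 _ hδ => (δ.isTwist_deform θ 𝒜 hδ).deformsToHopfAlgebroid hGalois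
      (hflat.isBalancedFaithful hGalois) δ.diag_comm_inclES,
    fun ℋ _ _ 𝒜 _ hδ => (δ.isTwist_bideform θ ℋ 𝒜 hδ).deformsToHopfAlgebroid hGalois
      (hflat.isBalancedFaithful hGalois) δ.diag_comm_inclES⟩
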